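/- **Theorem (Outsourcing for Cloud-Based Blockchains).** *Conventions.* $\lambda$ is the security parameter. "Efficient" means computed by probabilistic Boolean circuits with polynomially many gates (non-uniform probabilistic polynomial time). All string lengths are polynomial in $\lambda$, and all algorithms of the building blocks are efficient. $\approx$ denotes indistinguishability of ensembles, with negligible advantage, by every efficient distinguisher. *Setting.* There are parties $E_1,\dots,E_N$ and finitely many blockchain nodes, among them a garbling node $N_G$ and an evaluator node $N_E$. Party $E_i$ has a private input $x_i\in\{0,1\}^{\ell(\lambda)}$. Let $S$ be a group consisting of all parties and a set of nodes that contains $N_G$ but not $N_E$. A request is a pair $(E_k,SC)$ of a calling party and a smart contract; its value is $y=SC(x_k,(x_j)_{j\le N})$. *Building blocks.* * A multiparty NIKE $(Setup,Publish,KeyGen)$ for groups of at most $M\ge|S|$ users. It is correct: all members of a group derive the same key. It is statically secure: the key of a group is indistinguishable from a uniform string, given the parameters, all public keys and the secret keys of the users outside the group. * A pseudorandom function $PRF$, keyed by NIKE group keys. * A symmetric encryption scheme $(Enc,Dec)$ whose keys are uniform strings of the output length of $PRF$. It is correct, IND-CPA secure, and rejects wrong keys: for every message $m$ and independent uniform keys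 $k,k'$, $Dec_{k'}(Enc_k(m))$ is "reject" except with negligible probability. * A projective garbling scheme (every input wire $(j,l)$ has two labels $w_{jl}^0,w_{jl}^1$, and the garbled input $x$ consists of the labels $w_{jl}^{x_j[l]}$) with correctness, simulation-based privacy and simulation-based obliviousness. The garbled function need not be hidden. Each pair (caller, contract) is compiled efficiently and correctly to a function of $(x_1,\dots,x_N)$. *Functionality B.1.* (1) Key exchange: run the NIKE among parties and nodes and publish the parameters and all public keys; the key $k_S$ is derived from these. (2) For each $E_i$, send $(\mathrm{SendPrivateParameters},E_i)$ to $N_E$. (3) On each request $(E_k,SC)$, compute $y=SC(x_k,(x_j)_j)$, send $y$ to $E_k$ and $(\mathrm{SECCOMP},SC,E_k)$ to $N_E$. Nothing else is sent. *Protocol B.2.* (1) $params\leftarrow Setup$; each party and node runs $Publish$ and publishes its public key; each member of $S$ derives $k_S$ with $KeyGen$. (2) Once, each $E_i$ chooses a random nonce $n_i\in\{0,1\}^\lambda$ and sends $n_i$ and $X_{il}=PRF_{k_S}(x_i[l],l,n_i)$, $l\le\ell$, to $N_E$, which stores them. (3) For each request $(E_k,SC)$, $N_G$ compiles and freshly garbles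 $SC$ for the caller $E_k$, retrieves the nonces, computes $s_{jl}^b=PRF_{k_S}(b,l,n_j)$ and sends to $N_E$ the garbled circuit and the pivot table whose entry $[j,l]$ contains $Enc_{s_{jl}^0}(w_{jl}^0)$ and $Enc_{s_{jl}^1}(w_{jl}^1)$ in random order. $N_E$ decrypts in each entry, with the stored $X_{jl}$, the ciphertext that is not rejected, evaluates the garbled circuit and sends the output to $N_G$, which decodes it and delivers the result to $E_k$. No party other than the caller takes part in (3), and the stored encodings are reused for all requests. *Adversary.* Channels between parties and nodes are secure: a message is seen only by its sender and its receiver. The adversary is semi-honest, corrupts a fixed set $C$, and sees the inputs, random coins and received messages of $C$. Restricted collusion: $C$ is either any set of parties, or any set of nodes outside $S$ (possibly including $N_E$). *Conclusion.* Protocol B.2 securely realises Functionality B.1: for every such $C$ there is an efficient simulator (of size polynomial in $\lambda$ plus the number of requests) such that for every polynomially bounded number of requests, all inputs $x_1,\dots,x_N$ and all sequences of requests, $$(\text{view of } C,\ \text{outputs})_{\text{real}}\approx(\text{output of the simulator},\ \text{outputs})_{\text{ideal}} .$$ Here the simulator receives only $\lambda$, the number of requests, the inputs and coins used by $C$ in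 Functionality B.1 (inputs, own requests and own NIKE coins), and the messages that B.1 sends to $C$. The outputs are the published parameters and public keys and the results of all requests; the real ones are those of the execution of Protocol B.2, the ideal ones those of Functionality B.1. -/

import Mathlib

noncomputable section

namespace Outsourcing

/-! ### Bit strings, circuits and efficiency -/

abbrev Bits (n : ℕ) : Type := Fin n → Bool

/-- Probabilistic Boolean circuits with oracle gates, as straight-line programs.
`ι` names the wires available so far, `κ` the output wires; an oracle gate feeds the wires `a` to
the oracle and receives the wires `b`. -/
inductive Circuit (a b κ : Type) : Type → Type 1
  | ret {ι : Type} (out : κ → ι) : Circuit a b κ ι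
  | const {ι : Type} (c : Bool) (rest : Circuit a b κ (Option ι)) : Circuit a b κ ι
  | coin {ι : Type} (rest : Circuit a b κ (Option ι)) : Circuit a b κ ι
  | nand {ι : Type} (i j : ι) (rest : Circuit a b κ (Option ι)) : Circuit a b κ ι
  | call {ι : Type} (query : a → ι) (rest : Circuit a b κ (ι ⊕ b)) : Circuit a b κ ι

namespace Circuit

variable {a b κ : Type}

/-- The number of gates. -/
def size : {ι : Type} → Circuit a b κ ι → ℕ
  | _, ret _ => 0
  | _, const _ rest => rest.size + 1
  | _, coin rest => rest.size + 1
  | _, nand _ _ rest => rest.size + 1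
  | _, call _ rest => rest.size + 1

/-- The output distribution on the input `v`, when oracle gates are answered by `O`
(with fresh randomness at every call). -/
def run (O : (a → Bool) → PMF (b → Bool)) :
    {ι : Type} → Circuit a b κ ι → (ι → Bool) → PMF (κ → Bool)
  | _, ret out, v => PMF.pure (fun k => v (out k))
  | _, const c rest, v => rest.run O (fun o => o.elim c v)
  | _, coin rest, v =>
      (PMF.uniformOfFintype Bool).bind fun c => rest.run O (fun o => o.elim c v)
  | _, nand i j rest, v => rest.run O (fun o => o.elim (!(v i && v j)) v)
  | _, call query rest, v =>
      (O (fun k => v (query k))).bind fun r => rest.run O (Sum.elim v r)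

end Circuit

/-- Representation of the elements of `α` as strings of bits, indexed by a finite set. -/
class BitRep (α : Type) where
  idx : Type
  finite_idx : Finite idx
  enc : α → idx → Bool
  enc_injective : Function.Injective enc

instance : BitRep Unit where
  idx := Empty
  finite_idx := inferInstance
  enc := fun _ i => i.elim
  enc_injective := fun _ _ _ => rfl

instance : BitRep Bool where
  idx := Unit
  finite_idx := inferInstance
  enc := fun c _ => c
  enc_injective := fun _ _ h => congrFun h ()

/-- One-hot encoding. -/
instance (N : ℕ) : BitRep (Fin N) where
  idx := Fin N
  finite_idx := inferInstance
  enc := fun i j => decide (i = j)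
  enc_injective := fun i j h => by
    have := congrFun h j
    simpa using this

instance (α β : Type) [A : BitRep α] [B : BitRep β] : BitRep (α × β) where
  idx := A.idx ⊕ B.idx
  finite_idx := by
    have := A.finite_idx
    have := B.finite_idx
    infer_instance
  enc := fun p => Sum.elim (A.enc p.1) (B.enc p.2)
  enc_injective := fun p q h => Prod.ext
    (A.enc_injective (funext fun i => congrFun h (Sum.inl i)))
    (B.enc_injective (funext fun i => congrFun h (Sum.inr i)))

instance (ι α : Type) [Finite ι] [A : BitRep α] : BitRep (ι → α) where
  idx := ι × A.idx
  finite_idx := by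
    have := A.finite_idx
    infer_instance
  enc := fun f i => A.enc (f i.1) i.2
  enc_injective := fun f g h => funext fun i =>
    A.enc_injective (funext fun j => congrFun h (i, j))

instance (α : Type) [A : BitRep α] : BitRep (Option α) where
  idx := Option A.idx
  finite_idx := by
    have := A.finite_idx
    infer_instance
  enc := fun o i => match o, i with
    | none, _ => false
    | some _, none => true
    | some x, some i => A.enc x i
  enc_injective := by
    intro o o' h
    cases o with
    | none =>
      cases o' with
      | none => rfl
      | some y => exact absurd (congrFun h none) (by simp)
    | some x =>
      cases o' with
      | none => exact absurd (congrFun h none) (by simp)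
      | some y => exact congrArg some (A.enc_injective (funext fun i => congrFun h (some i)))

def PolyBounded {P : Type} (size f : P → ℕ) : Prop :=
  ∃ p : Polynomial ℕ, ∀ i, f i ≤ p.eval (size i)

/-- Non-uniform probabilistic polynomial time: the family `A` of randomised maps is computed by
(oracle-free) probabilistic circuits with a number of gates polynomial in `size`. -/
def Efficient {P : Type} (size : P → ℕ) {α β : P → Type}
    [∀ i, BitRep (α i)] [∀ i, BitRep (β i)] (A : ∀ i, α i → PMF (β i)) : Prop :=
  ∃ C : ∀ i, Circuit Empty Empty (BitRep.idx (β i)) (BitRep.idx (α i)),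
    PolyBounded size (fun i => (C i).size) ∧
    ∀ i x, (C i).run (fun _ => PMF.pure Empty.elim) (BitRep.enc x) = (A i x).map BitRep.enc

/-- `Efficient` for deterministic maps, in terms of the security parameter. -/
def EfficientFun {α β : ℕ → Type} [∀ n, BitRep (α n)] [∀ n, BitRep (β n)]
    (f : ∀ n, α n → β n) : Prop :=
  Efficient id (fun n x => PMF.pure (f n x))

def Negligible (f : ℕ → ℝ) : Prop :=
  Asymptotics.SuperpolynomialDecay Filter.atTop (fun n : ℕ => (n : ℝ)) f

/-- The probability that a random bit is `1`. -/
def prTrue (D : PMF Bool) : ℝ := (D true).toReal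

/-- Computational indistinguishability of two ensembles. -/
def CompIndist {α : ℕ → Type} [∀ n, BitRep (α n)] (X Y : ∀ n, PMF (α n)) : Prop :=
  ∀ D : ∀ n, α n → PMF Bool, Efficient id D →
    Negligible fun n => |prTrue ((X n).bind (D n)) - prTrue ((Y n).bind (D n))|

/-- Independent samples from `p 0, …, p (m - 1)`. -/
def sampleAll {α : Type} : {m : ℕ} → (Fin m → PMF α) → PMF (Fin m → α)
  | 0, _ => PMF.pure Fin.elim0
  | _ + 1, p => (p 0).bind fun x => (sampleAll fun i => p i.succ).map (Fin.cons x)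

/-! ### Pseudorandom functions -/

structure PRF (keyLen inLen outLen : ℕ → ℕ) where
  eval : ∀ n, Bits (keyLen n) → Bits (inLen n) → Bits (outLen n)

namespace PRF

variable {keyLen inLen outLen : ℕ → ℕ} (F : PRF keyLen inLen outLen)

def IsEfficient : Prop :=
  PolyBounded id keyLen ∧ PolyBounded id inLen ∧ PolyBounded id outLen ∧
  EfficientFun (α := fun n => Bits (keyLen n) × Bits (inLen n)) (β := fun n => Bits (outLen n))
    (fun n p => F.eval n p.1 p.2)

/-- No efficient oracle adversary distinguishes `F` under a uniform key from a uniform function. -/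
def Pseudorandom : Prop :=
  ∀ A : ∀ n, Circuit (Fin (inLen n)) (Fin (outLen n)) Unit Empty,
    PolyBounded id (fun n => (A n).size) →
    Negligible fun n =>
      |prTrue ((PMF.uniformOfFintype (Bits (keyLen n))).bind fun k =>
          ((A n).run (fun x => PMF.pure (F.eval n k x)) Empty.elim).map fun out => out ()) -
       prTrue ((PMF.uniformOfFintype (Bits (inLen n) → Bits (outLen n))).bind fun f =>
          ((A n).run (fun x => PMF.pure (f x)) Empty.elim).map fun out => out ())|

end PRF

/-! ### Symmetric encryption -/

/-- Symmetric encryption with uniform keys; decryption may reject (`none`). -/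
structure SymEnc (keyLen msgLen : ℕ → ℕ) where
  ctLen : ℕ → ℕ
  enc : ∀ n, Bits (keyLen n) → Bits (msgLen n) → PMF (Bits (ctLen n))
  dec : ∀ n, Bits (keyLen n) → Bits (ctLen n) → Option (Bits (msgLen n))

namespace SymEnc

variable {keyLen msgLen : ℕ → ℕ} (E : SymEnc keyLen msgLen)

def IsEfficient : Prop :=
  PolyBounded id keyLen ∧ PolyBounded id msgLen ∧ PolyBounded id E.ctLen ∧
  Efficient id (α := fun n => Bits (keyLen n) × Bits (msgLen n)) (β := fun n => Bits (E.ctLen n))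
    (fun n p => E.enc n p.1 p.2) ∧
  EfficientFun (α := fun n => Bits (keyLen n) × Bits (E.ctLen n))
    (β := fun n => Option (Bits (msgLen n))) (fun n p => E.dec n p.1 p.2)

def Correct : Prop :=
  ∀ n k m, ∀ c ∈ (E.enc n k m).support, E.dec n k c = some m

/-- The left-or-right oracle: on a pair of messages, encrypt the one selected by `side`. -/
def lrOracle (n : ℕ) (k : Bits (keyLen n)) (side : Bool)
    (q : Fin (msgLen n) ⊕ Fin (msgLen n) → Bool) : PMF (Bits (E.ctLen n)) :=
  E.enc n k (if side then (fun i => q (Sum.inr i)) else (fun i => q (Sum.inl i)))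

/-- Indistinguishability under chosen-plaintext attacks (left-or-right formulation). -/
def IndCPA : Prop :=
  ∀ A : ∀ n, Circuit (Fin (msgLen n) ⊕ Fin (msgLen n)) (Fin (E.ctLen n)) Unit Empty,
    PolyBounded id (fun n => (A n).size) →
    Negligible fun n =>
      |prTrue ((PMF.uniformOfFintype (Bits (keyLen n))).bind fun k =>
          ((A n).run (E.lrOracle n k false) Empty.elim).map fun out => out ()) -
       prTrue ((PMF.uniformOfFintype (Bits (keyLen n))).bind fun k =>
          ((A n).run (E.lrOracle n k true) Empty.elim).map fun out => out ())|

/-- Decryption under an independent key rejects, except with negligible probability. -/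
def RejectsWrongKey : Prop :=
  ∀ m : ∀ n, Bits (msgLen n), Negligible fun n =>
    prTrue ((PMF.uniformOfFintype (Bits (keyLen n))).bind fun k =>
      (PMF.uniformOfFintype (Bits (keyLen n))).bind fun k' =>
        (E.enc n k (m n)).map fun c => (E.dec n k' c).isSome)

end SymEnc

/-! ### Multiparty non-interactive key exchange -/

/-- Multiparty NIKE for `U` users and groups of at most `M` users. `publish` takes the user's
random coins as an explicit argument. -/
structure NIKE (M U : ℕ) where
  paramLen : ℕ → ℕ
  coinLen : ℕ → ℕ
  skLen : ℕ → ℕ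
  pkLen : ℕ → ℕ
  keyLen : ℕ → ℕ
  setup : ∀ n, PMF (Bits (paramLen n))
  publish : ∀ n, Bits (paramLen n) → Fin U → Bits (coinLen n) → Bits (skLen n) × Bits (pkLen n)
  keyGen : ∀ n, Bits (paramLen n) → Fin U → Bits (skLen n) → (S : Finset (Fin U)) →
    (S → Bits (pkLen n)) → Bits (keyLen n)

namespace NIKE

variable {M U : ℕ} (K : NIKE M U)

def IsEfficient : Prop :=
  PolyBounded id K.paramLen ∧ PolyBounded id K.coinLen ∧ PolyBounded id K.skLen ∧
  PolyBounded id K.pkLen ∧ PolyBounded id K.keyLen ∧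
  Efficient id (α := fun _ => Unit) (β := fun n => Bits (K.paramLen n)) (fun n _ => K.setup n) ∧
  EfficientFun (α := fun n => Bits (K.paramLen n) × Fin U × Bits (K.coinLen n))
    (β := fun n => Bits (K.skLen n) × Bits (K.pkLen n))
    (fun n p => K.publish n p.1 p.2.1 p.2.2) ∧
  ∀ S : Finset (Fin U), EfficientFun
    (α := fun n => Bits (K.paramLen n) × Fin U × Bits (K.skLen n) × (S → Bits (K.pkLen n)))
    (β := fun n => Bits (K.keyLen n))
    (fun n p => K.keyGen n p.1 p.2.1 p.2.2.1 S p.2.2.2)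

/-- The secret and public key of user `i`, when the users' coins are `r`. -/
def sk (n : ℕ) (params : Bits (K.paramLen n)) (r : Fin U → Bits (K.coinLen n)) (i : Fin U) :
    Bits (K.skLen n) := (K.publish n params i (r i)).1

def pk (n : ℕ) (params : Bits (K.paramLen n)) (r : Fin U → Bits (K.coinLen n)) (i : Fin U) :
    Bits (K.pkLen n) := (K.publish n params i (r i)).2

/-- The key that user `i` derives for the group `S`. -/
def sharedKey (n : ℕ) (params : Bits (K.paramLen n)) (r : Fin U → Bits (K.coinLen n))
    (S : Finset (Fin U)) (i : Fin U) : Bits (K.keyLen n) :=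
  K.keyGen n params i (K.sk n params r i) S (fun j => K.pk n params r j)

/-- All members of a group derive the same key. -/
def Correct : Prop :=
  ∀ n, ∀ params ∈ (K.setup n).support, ∀ r, ∀ S : Finset (Fin U), S.card ≤ M →
    ∀ i ∈ S, ∀ j ∈ S, K.sharedKey n params r S i = K.sharedKey n params r S j

/-- Static security: given the parameters, all public keys and the secret keys of the users
outside `S`, the key of the group `S` is indistinguishable from a uniform string. -/
def Secure : Prop :=
  ∀ S : Finset (Fin U), S.card ≤ M → ∀ i ∈ S,
    CompIndist
      (α := fun n => Bits (K.paramLen n) × (Fin U → Bits (K.pkLen n)) ×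
        ({j : Fin U // j ∉ S} → Bits (K.skLen n)) × Bits (K.keyLen n))
      (fun n => (K.setup n).bind fun params =>
        (PMF.uniformOfFintype (Fin U → Bits (K.coinLen n))).map fun r =>
          (params, K.pk n params r, fun j => K.sk n params r j, K.sharedKey n params r S i))
      (fun n => (K.setup n).bind fun params =>
        (PMF.uniformOfFintype (Fin U → Bits (K.coinLen n))).bind fun r =>
          (PMF.uniformOfFintype (Bits (K.keyLen n))).map fun key =>
            (params, K.pk n params r, fun j => K.sk n params r j, key))

end NIKE

/-! ### Garbling schemes -/

/-- A projective garbling scheme for functions with input wires `W n`. Functions are given by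
descriptions `f`, and `ev n f` is the function described by `f`. The encoding information is a
pair of labels for every input wire. -/
structure GarblingScheme (W : ℕ → Type) (labelLen outLen : ℕ → ℕ) where
  funLen : ℕ → ℕ
  gcLen : ℕ → ℕ
  decLen : ℕ → ℕ
  goutLen : ℕ → ℕ
  ev : ∀ n, Bits (funLen n) → (W n → Bool) → Bits (outLen n)
  Gb : ∀ n, Bits (funLen n) →
    PMF (Bits (gcLen n) × (W n → Bool → Bits (labelLen n)) × Bits (decLen n))
  Ev : ∀ n, Bits (gcLen n) → (W n → Bits (labelLen n)) → Bits (goutLen n)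
  De : ∀ n, Bits (decLen n) → Bits (goutLen n) → Bits (outLen n)

/-- Projective input encoding. -/
def En {W : Type} {L : Type} (e : W → Bool → L) (x : W → Bool) : W → L := fun w => e w (x w)

namespace GarblingScheme

variable {W : ℕ → Type} [∀ n, Finite (W n)] {labelLen outLen : ℕ → ℕ}
  (G : GarblingScheme W labelLen outLen)

def IsEfficient : Prop :=
  PolyBounded id (fun n => Nat.card (W n)) ∧ PolyBounded id labelLen ∧ PolyBounded id outLen ∧
  PolyBounded id G.funLen ∧ PolyBounded id G.gcLen ∧ PolyBounded id G.decLen ∧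
  PolyBounded id G.goutLen ∧
  EfficientFun (α := fun n => Bits (G.funLen n) × (W n → Bool)) (β := fun n => Bits (outLen n))
    (fun n p => G.ev n p.1 p.2) ∧
  Efficient id (α := fun n => Bits (G.funLen n))
    (β := fun n => Bits (G.gcLen n) × (W n → Bool → Bits (labelLen n)) × Bits (G.decLen n))
    G.Gb ∧
  EfficientFun (α := fun n => Bits (G.gcLen n) × (W n → Bits (labelLen n)))
    (β := fun n => Bits (G.goutLen n)) (fun n p => G.Ev n p.1 p.2) ∧
  EfficientFun (α := fun n => Bits (G.decLen n) × Bits (G.goutLen n))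
    (β := fun n => Bits (outLen n)) (fun n p => G.De n p.1 p.2)

def Correct : Prop :=
  ∀ n f, ∀ g ∈ (G.Gb n f).support, ∀ x,
    G.De n g.2.2 (G.Ev n g.1 (En g.2.1 x)) = G.ev n f x

/-- Simulation-based privacy (the function description is not hidden): garbled circuit, garbled
input and decoding information are simulated from the function and its value. -/
def Private : Prop :=
  ∃ Sim : ∀ n, Bits (G.funLen n) × Bits (outLen n) →
      PMF (Bits (G.gcLen n) × (W n → Bits (labelLen n)) × Bits (G.decLen n)),
    Efficient id (α := fun n => Bits (G.funLen n) × Bits (outLen n))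
      (β := fun n => Bits (G.gcLen n) × (W n → Bits (labelLen n)) × Bits (G.decLen n)) Sim ∧
    ∀ (f : ∀ n, Bits (G.funLen n)) (x : ∀ n, W n → Bool),
      CompIndist
        (α := fun n => Bits (G.gcLen n) × (W n → Bits (labelLen n)) × Bits (G.decLen n))
        (fun n => (G.Gb n (f n)).map fun g => (g.1, En g.2.1 (x n), g.2.2))
        (fun n => Sim n (f n, G.ev n (f n) (x n)))

/-- Simulation-based obliviousness (the function description is not hidden): garbled circuit and
garbled input are simulated from the function alone. -/
def Oblivious : Prop :=
  ∃ Sim : ∀ n, Bits (G.funLen n) → PMF (Bits (G.gcLen n) × (W n → Bits (labelLen n))),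
    Efficient id (α := fun n => Bits (G.funLen n))
      (β := fun n => Bits (G.gcLen n) × (W n → Bits (labelLen n))) Sim ∧
    ∀ (f : ∀ n, Bits (G.funLen n)) (x : ∀ n, W n → Bool),
      CompIndist (α := fun n => Bits (G.gcLen n) × (W n → Bits (labelLen n)))
        (fun n => (G.Gb n (f n)).map fun g => (g.1, En g.2.1 (x n)))
        (fun n => Sim n (f n))

end GarblingScheme

/-! ### The outsourcing setting -/

/-- The building blocks for parties `E_1, …, E_N` and `m` blockchain nodes, and the roles of the
nodes. The users of the key exchange are the parties followed by the nodes. -/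
structure Setting (M N m : ℕ) where
  inputLen : ℕ → ℕ
  outLen : ℕ → ℕ
  scLen : ℕ → ℕ
  labelLen : ℕ → ℕ
  encKeyLen : ℕ → ℕ
  nike : NIKE M (N + m)
  prf : PRF nike.keyLen (fun n => 1 + inputLen n + n) encKeyLen
  enc : SymEnc encKeyLen labelLen
  garbling : GarblingScheme (fun n => Fin N × Fin (inputLen n)) labelLen outLen
  /-- `contract n SC x_k x` is the value `SC(x_k, x_1, …, x_N)` for a caller with input `x_k`. -/
  contract : ∀ n, Bits (scLen n) → Bits (inputLen n) → (Fin N → Bits (inputLen n)) →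
    Bits (outLen n)
  /-- The function (of all inputs) that is garbled for a contract and a calling party. -/
  compile : ∀ n, Fin N → Bits (scLen n) → Bits (garbling.funLen n)
  /-- The garbling node. -/
  nG : Fin m
  /-- The evaluator node. -/
  nE : Fin m
  /-- The nodes that share the group key with the parties. -/
  keyNodes : Finset (Fin m)

namespace Setting

variable {M N m : ℕ} (P : Setting M N m)

def CompileCorrect : Prop :=
  ∀ n k SC (x : Fin N → Bits (P.inputLen n)),
    P.garbling.ev n (P.compile n k SC) (fun w => x w.1 w.2) = P.contract n SC (x k) x

def IsEfficient : Prop :=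
  PolyBounded id P.inputLen ∧ PolyBounded id P.scLen ∧
  P.nike.IsEfficient ∧ P.prf.IsEfficient ∧ P.enc.IsEfficient ∧ P.garbling.IsEfficient ∧
  EfficientFun (α := fun n => Fin N × Bits (P.scLen n)) (β := fun n => Bits (P.garbling.funLen n))
    (fun n p => P.compile n p.1 p.2)

def party (_P : Setting M N m) (i : Fin N) : Fin (N + m) := Fin.castAdd m i

def node (_P : Setting M N m) (j : Fin m) : Fin (N + m) := Fin.natAdd N j

/-- The group that derives the shared key `k_S`. -/
def group : Finset (Fin (N + m)) :=
  Finset.univ.image P.party ∪ P.keyNodes.image P.node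

abbrev Params (n : ℕ) : Type := Bits (P.nike.paramLen n)
abbrev PubKeys (n : ℕ) : Type := Fin (N + m) → Bits (P.nike.pkLen n)
abbrev Coins (n : ℕ) : Type := Bits (P.nike.coinLen n)
abbrev Input (n : ℕ) : Type := Bits (P.inputLen n)
abbrev Output (n : ℕ) : Type := Bits (P.outLen n)
abbrev Contract (n : ℕ) : Type := Bits (P.scLen n)
/-- A computation request: the calling party and the contract. -/
abbrev Request (n : ℕ) : Type := Fin N × Bits (P.scLen n)
/-- Nonces have the length of the security parameter. -/
abbrev Nonce (_P : Setting M N m) (n : ℕ) : Type := Bits n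
abbrev EncKey (n : ℕ) : Type := Bits (P.encKeyLen n)
abbrev Cipher (n : ℕ) : Type := Bits (P.enc.ctLen n)
abbrev Pivot (n : ℕ) : Type := Fin N → Fin (P.inputLen n) → P.Cipher n × P.Cipher n

/-! ### The protocol -/

/-- The block `(c, l, nonce)` as a bit string; `l` is written one-hot. -/
def prfBlock (n : ℕ) (c : Bool) (l : Fin (P.inputLen n)) (nonce : P.Nonce n) :
    Bits (1 + P.inputLen n + n) :=
  Fin.append (Fin.append (fun _ : Fin 1 => c) (fun i => decide (i = l))) nonce

/-- `PRF_k(c, l, nonce)`. -/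
def bitKey (n : ℕ) (k : Bits (P.nike.keyLen n)) (c : Bool) (l : Fin (P.inputLen n))
    (nonce : P.Nonce n) : P.EncKey n :=
  P.prf.eval n k (P.prfBlock n c l nonce)

/-- One entry of a pivot table: both labels of a wire, each encrypted under the key of its bit,
in random order. -/
def pivotEntry (n : ℕ) (s : Bool → P.EncKey n) (w : Bool → Bits (P.labelLen n)) :
    PMF (P.Cipher n × P.Cipher n) :=
  (P.enc.enc n (s false) (w false)).bind fun c₀ =>
    (P.enc.enc n (s true) (w true)).bind fun c₁ =>
      (PMF.uniformOfFintype Bool).map fun swap => if swap then (c₁, c₀) else (c₀, c₁)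

/-- The evaluator's decryption of a pivot entry: the entry that is not rejected under the
encoding key `s` (an arbitrary default if both are rejected). -/
def openEntry (n : ℕ) (s : P.EncKey n) (c : P.Cipher n × P.Cipher n) : Bits (P.labelLen n) :=
  ((P.enc.dec n s c.1).or (P.enc.dec n s c.2)).getD (fun _ => false)

/-- What happens in one computation: the garbled circuit and the pivot table sent to the
evaluator, and the result decoded by the garbling node and sent to the caller. -/
abbrev Computation (n : ℕ) : Type := (Bits (P.garbling.gcLen n) × P.Pivot n) × P.Output n

/-- `SECCOMP`, when the garbling node holds the key `k`, the evaluator has stored the encodings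
`X` and the nonces. -/
def seccomp (n : ℕ) (k : Bits (P.nike.keyLen n)) (nonce : Fin N → P.Nonce n)
    (X : Fin N → Fin (P.inputLen n) → P.EncKey n) (req : P.Request n) : PMF (P.Computation n) :=
  (P.garbling.Gb n (P.compile n req.1 req.2)).bind fun g =>
    (sampleAll fun j => sampleAll fun l =>
      P.pivotEntry n (fun c => P.bitKey n k c l (nonce j)) (g.2.1 (j, l))).map fun piv =>
        ((g.1, piv), P.garbling.De n g.2.2
          (P.garbling.Ev n g.1 (fun w => P.openEntry n (X w.1 w.2) (piv w.1 w.2))))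

/-- The full record of an execution with `q` computations. -/
structure Transcript (n q : ℕ) where
  params : P.Params n
  coins : Fin (N + m) → P.Coins n
  nonce : Fin N → P.Nonce n
  encoding : Fin N → Fin (P.inputLen n) → P.EncKey n
  comp : Fin q → P.Computation n

/-- An execution of the protocol: key exchange, one upload of the encoded input per party, then
`q` computations on the stored encodings. Every participant uses the group key it derived. -/
def execute (n q : ℕ) (x : Fin N → P.Input n) (req : Fin q → P.Request n) :
    PMF (P.Transcript n q) :=
  (P.nike.setup n).bind fun params =>
    (PMF.uniformOfFintype (Fin (N + m) → P.Coins n)).bind fun coins =>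
      (PMF.uniformOfFintype (Fin N → P.Nonce n)).bind fun nonce =>
        let key := P.nike.sharedKey n params coins P.group
        let X : Fin N → Fin (P.inputLen n) → P.EncKey n := fun i l =>
          P.bitKey n (key (P.party i)) (x i l) l (nonce i)
        (sampleAll fun t => P.seccomp n (key (P.node P.nG)) nonce X (req t)).map fun comp =>
          ⟨params, coins, nonce, X, comp⟩

/-! ### Views, the ideal functionality and secure realisation -/

/-- What the corrupted users `C` see of the key exchange: parameters, all public keys and their
own coins. -/
abbrev KeyView (C : Finset (Fin (N + m))) (n : ℕ) : Type :=
  P.Params n × P.PubKeys n × (C → P.Coins n)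

def keyView (C : Finset (Fin (N + m))) (n : ℕ) (params : P.Params n)
    (coins : Fin (N + m) → P.Coins n) : P.KeyView C n :=
  (params, P.nike.pk n params coins, fun i => coins i)

/-- The outputs of an execution: the published key material, and the result of each computation
(delivered to its caller). -/
abbrev Outputs (n q : ℕ) : Type := (P.Params n × P.PubKeys n) × (Fin q → P.Output n)

def realOutputs {n q : ℕ} (T : P.Transcript n q) : P.Outputs n q :=
  ((T.params, P.nike.pk n T.params T.coins), fun t => (T.comp t).2)

/-- The results computed by the ideal functionality. -/
def idealResult (n q : ℕ) (x : Fin N → P.Input n) (req : Fin q → P.Request n) :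
    Fin q → P.Output n :=
  fun t => P.contract n (req t).2 (x (req t).1) x

/-- What the evaluator receives beyond the key exchange: the encoded inputs and nonces, the
requests, the garbled circuits and the pivot tables. -/
abbrev EvaluatorView (n q : ℕ) : Type :=
  (Fin N → (Fin (P.inputLen n) → P.EncKey n) × P.Nonce n) ×
    (Fin q → P.Request n × Bits (P.garbling.gcLen n) × P.Pivot n)

/-- What the ideal functionality sends to the evaluator: a notice naming the sender of every
upload, and the caller and contract of every computation. -/
abbrev EvaluatorIdeal (n q : ℕ) : Type := (Fin N → Fin N) × (Fin q → P.Request n)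

/-- The view of the corrupted nodes: beyond the key exchange, the evaluator's part is present
exactly if the evaluator is corrupted; the other nodes receive nothing. -/
abbrev NodeView (C : Finset (Fin m)) (n q : ℕ) : Type :=
  P.KeyView (C.image P.node) n × ({j : Fin m // j ∈ C ∧ j = P.nE} → P.EvaluatorView n q)

/-- What the corrupted nodes receive from the ideal functionality. -/
abbrev NodeIdeal (C : Finset (Fin m)) (n q : ℕ) : Type :=
  P.KeyView (C.image P.node) n × ({j : Fin m // j ∈ C ∧ j = P.nE} → P.EvaluatorIdeal n q)

/-- Secure realisation against a semi-honest adversary that statically corrupts the nodes `C`.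
Channels are secure: a message is seen by its sender and its receiver only. -/
def SecureAgainstNodes (C : Finset (Fin m)) : Prop :=
  ∃ Sim : ∀ i : ℕ × ℕ, P.NodeIdeal C i.1 i.2 → PMF (P.NodeView C i.1 i.2),
    Efficient (fun i : ℕ × ℕ => i.1 + i.2) Sim ∧
    ∀ Q : ℕ → ℕ, PolyBounded id Q →
    ∀ (x : ∀ n, Fin N → P.Input n) (req : ∀ n, Fin (Q n) → P.Request n),
      CompIndist (α := fun n => P.NodeView C n (Q n) × P.Outputs n (Q n))
        (fun n => (P.execute n (Q n) (x n) (req n)).map fun T =>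
          ((P.keyView (C.image P.node) n T.params T.coins,
            fun _ => (fun j => (T.encoding j, T.nonce j), fun t => (req n t, (T.comp t).1))),
           P.realOutputs T))
        (fun n => (P.nike.setup n).bind fun params =>
          (PMF.uniformOfFintype (Fin (N + m) → P.Coins n)).bind fun coins =>
            (Sim (n, Q n) (P.keyView (C.image P.node) n params coins,
                fun _ => (fun j => j, req n))).map fun view =>
              (view, (params, P.nike.pk n params coins),
                P.idealResult n (Q n) (x n) (req n)))

/-- The requests made by the parties in `I`, each with the result received. -/
def ownResults (I : Finset (Fin N)) {n q : ℕ} (req : Fin q → P.Request n)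
    (y : Fin q → P.Output n) : Fin q → Option (P.Contract n × P.Output n) :=
  fun t => if (req t).1 ∈ I then some ((req t).2, y t) else none

/-- The view of the corrupted parties: the key exchange, their inputs and nonces, and their own
requests with the results received. -/
abbrev PartyView (I : Finset (Fin N)) (n q : ℕ) : Type :=
  P.KeyView (I.image P.party) n × (I → P.Input n × P.Nonce n) ×
    (Fin q → Option (P.Contract n × P.Output n))

/-- What the corrupted parties supply to and receive from the ideal functionality. -/
abbrev PartyIdeal (I : Finset (Fin N)) (n q : ℕ) : Type :=
  P.KeyView (I.image P.party) n × (I → P.Input n) ×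
    (Fin q → Option (P.Contract n × P.Output n))

/-- Secure realisation against a semi-honest adversary that statically corrupts the parties `I`. -/
def SecureAgainstParties (I : Finset (Fin N)) : Prop :=
  ∃ Sim : ∀ i : ℕ × ℕ, P.PartyIdeal I i.1 i.2 → PMF (P.PartyView I i.1 i.2),
    Efficient (fun i : ℕ × ℕ => i.1 + i.2) Sim ∧
    ∀ Q : ℕ → ℕ, PolyBounded id Q →
    ∀ (x : ∀ n, Fin N → P.Input n) (req : ∀ n, Fin (Q n) → P.Request n),
      CompIndist (α := fun n => P.PartyView I n (Q n) × P.Outputs n (Q n))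
        (fun n => (P.execute n (Q n) (x n) (req n)).map fun T =>
          ((P.keyView (I.image P.party) n T.params T.coins,
            (fun i => (x n i, T.nonce i)),
            P.ownResults I (req n) (fun t => (T.comp t).2)),
           P.realOutputs T))
        (fun n => (P.nike.setup n).bind fun params =>
          (PMF.uniformOfFintype (Fin (N + m) → P.Coins n)).bind fun coins =>
            (Sim (n, Q n) (P.keyView (I.image P.party) n params coins,
                (fun i => x n i),
                P.ownResults I (req n) (P.idealResult n (Q n) (x n) (req n)))).map fun view =>
              (view, (params, P.nike.pk n params coins),
                P.idealResult n (Q n) (x n) (req n)))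

/-- Secure realisation under restricted collusion: the adversary corrupts either parties, or
nodes that do not hold the group key (among them the evaluator), but not both. -/
def SecurelyRealises : Prop :=
  (∀ I : Finset (Fin N), P.SecureAgainstParties I) ∧
  (∀ C : Finset (Fin m), Disjoint C P.keyNodes → P.SecureAgainstNodes C)

end Setting

end Outsourcing

end

/-!
Corrupted parties or corrupted nodes without the evaluator receive no protocol message whose
distribution depends on the inputs of others, except the results. Their simulators copy the view of
the ideal functionality and add uniform nonces, and only the correctness of the results is at stake.
A result can be wrong only if an entry of a pivot table is opened to the wrong label, that is, if a
ciphertext under the key of one wire value is accepted under the key of the other one. Both keys are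
values of the pseudorandom function under the group key, which is unknown to an outsider, so that
they may be replaced by independent uniform keys, under which the ciphertext is rejected
(`Setting.exists_wrongKey_bound`, `Setting.exists_execute_bound`).

If the evaluator is corrupted, its view is transformed in three steps. The garbling node encrypts,
for every wire, one label under the key of the actual input bit, which the evaluator has stored,
and the other label under the key of the other bit; the random order of the two ciphertexts makes
the roles of the two bits symmetric (`Setting.pivotEntry_eq`).
* Static security of the key exchange and pseudorandomness allow to replace the keys of all wire
  values by independent uniform ones, as long as the nonces of the parties are distinct, which
  fails with negligible probability (`Setting.indist_view_uniformKeys`).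
* The keys of the other bits are used for nothing but encryption, in the pivot tables of all
  computations. By chosen-plaintext security, the labels encrypted under them may be replaced by
  zeros (`Setting.indist_view_zeroLabels`).
* Only the garbled circuits and the labels of the actual inputs are left, and by obliviousness they
  can be simulated from the contracts (`Setting.indist_view_oblivious`).

The result is the distribution `Setting.simView`, which depends on the requests alone.

All reductions are carried out for families over an arbitrary index type (`Indist`) rather than over
the security parameter. Distinguishers are non-uniform, so values that do not depend on the
challenge (public keys, nonces, garblings, …) can be moved into the index (`Indist.average`), and
the hybrid argument (`Indist.sampleAll`) needs no efficient sampling of the other components. The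
definitions of the building blocks concern one adversary for every security parameter; the passage to
arbitrary index types takes the nearly best adversary of every size (`Negligible.uniform`).
Efficiency of the reductions is shown by closure properties of circuits (`OracleEfficient`); maps
that only copy bits, and so need no gates, are recognised by `fun_prop` (`Wire`).
-/

namespace Outsourcing

/-! ### Independent samples -/

theorem sampleAll_bind {α β : Type} {m : ℕ} (p : Fin m → PMF α) (f : Fin m → α → PMF β) :
    (sampleAll fun t => (p t).bind (f t)) = (sampleAll p).bind fun y => sampleAll fun t => f t (y t) := by
  induction m with
  | zero => simp only [sampleAll, PMF.pure_bind]
  | succ m ih =>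
    simp only [sampleAll, ih, PMF.bind_bind, PMF.map_bind, PMF.bind_map, Function.comp_def,
      Fin.cons_zero, Fin.cons_succ]
    congr 1; funext x
    rw [PMF.bind_comm]

theorem sampleAll_pure {α : Type} {m : ℕ} (f : Fin m → α) :
    (sampleAll fun t => PMF.pure (f t)) = PMF.pure f := by
  induction m with
  | zero => simp only [sampleAll]; congr 1; funext t; exact t.elim0
  | succ m ih =>
    simp only [sampleAll, ih, PMF.pure_bind, PMF.pure_map]
    congr 1; exact Fin.cons_self_tail f

theorem sampleAll_map {α β : Type} {m : ℕ} (p : Fin m → PMF α) (f : Fin m → α → β) :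
    (sampleAll fun t => (p t).map (f t)) = (sampleAll p).map fun y t => f t (y t) := by
  simp only [← PMF.bind_pure_comp, sampleAll_bind, Function.comp_def, sampleAll_pure]

theorem sampleAll_apply {α : Type} {m : ℕ} (p : Fin m → PMF α) (y : Fin m → α) :
    sampleAll p y = ∏ t, p t (y t) := by
  induction m with
  | zero => simp [sampleAll, PMF.pure_apply, Subsingleton.elim y Fin.elim0]
  | succ m ih =>
    rw [Fin.prod_univ_succ, sampleAll, PMF.bind_apply, tsum_eq_single (y 0)]
    · congr 1
      rw [PMF.map_apply, tsum_eq_single (Fin.tail y)]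
      · rw [if_pos (Fin.cons_self_tail y).symm, ih]; rfl
      · intro z hz
        rw [if_neg]
        intro h
        have h' := congrArg Fin.tail h
        rw [Fin.tail_cons] at h'
        exact hz h'.symm
    · intro x hx
      convert mul_zero _
      rw [PMF.map_apply, ENNReal.tsum_eq_zero]
      intro z
      rw [if_neg]
      rintro rfl
      exact hx rfl

namespace Circuit

variable {a b κ : Type}

/-- Renaming of the input wires. -/
def rename : {ι ι' : Type} → (ι → ι') → Circuit a b κ ι → Circuit a b κ ι'
  | _, _, f, ret out => ret (fun k => f (out k))
  | _, _, f, const c rest => const c (rest.rename (Option.map f))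
  | _, _, f, coin rest => coin (rest.rename (Option.map f))
  | _, _, f, nand i j rest => nand (f i) (f j) (rest.rename (Option.map f))
  | _, _, f, call q rest => call (fun k => f (q k)) (rest.rename (Sum.map f id))

theorem size_rename {ι ι' : Type} (f : ι → ι') (c : Circuit a b κ ι) :
    (c.rename f).size = c.size := by
  induction c generalizing ι' with
  | ret out => rfl
  | const _ _ ih => simp [rename, size, ih]
  | coin _ ih => simp [rename, size, ih]
  | nand _ _ _ ih => simp [rename, size, ih]
  | call _ _ ih => simp [rename, size, ih]

theorem elim_comp_optionMap {ι ι' γ : Type} (f : ι → ι') (c : γ) (v : ι' → γ) :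
    (fun o : Option ι => (Option.map f o).elim c v) = fun o => o.elim c (fun i => v (f i)) := by
  funext o; cases o <;> rfl

theorem run_rename (O : (a → Bool) → PMF (b → Bool)) {ι ι' : Type} (f : ι → ι')
    (c : Circuit a b κ ι) (v : ι' → Bool) :
    (c.rename f).run O v = c.run O (fun i => v (f i)) := by
  induction c generalizing ι' with
  | ret out => rfl
  | const c rest ih => simp only [rename, run, ih, elim_comp_optionMap]
  | coin rest ih => simp only [rename, run, ih, elim_comp_optionMap]
  | nand i j rest ih => simp only [rename, run, ih, elim_comp_optionMap]
  | call q rest ih =>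
    simp only [rename, run, ih]
    congr 1; funext r; congr 1; funext o; cases o <;> rfl

/-- Sequential composition; the second circuit also reads the inputs of the first one. -/
def andThen {κ' : Type} : {ι : Type} → Circuit a b κ ι → Circuit a b κ' (ι ⊕ κ) →
    Circuit a b κ' ι
  | _, ret out, d => d.rename (Sum.elim id out)
  | _, const c rest, d => const c (rest.andThen (d.rename (Sum.map some id)))
  | _, coin rest, d => coin (rest.andThen (d.rename (Sum.map some id)))
  | _, nand i j rest, d => nand i j (rest.andThen (d.rename (Sum.map some id)))
  | _, call q rest, d => call q (rest.andThen (d.rename (Sum.map Sum.inl id)))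

theorem size_andThen {κ' ι : Type} (c : Circuit a b κ ι) (d : Circuit a b κ' (ι ⊕ κ)) :
    (c.andThen d).size = c.size + d.size := by
  induction c with
  | ret out => simp [andThen, size, size_rename]
  | const _ _ ih => simp only [andThen, size, ih, size_rename]; omega
  | coin _ ih => simp only [andThen, size, ih, size_rename]; omega
  | nand _ _ _ ih => simp only [andThen, size, ih, size_rename]; omega
  | call _ _ ih => simp only [andThen, size, ih, size_rename]; omega

theorem run_andThen (O : (a → Bool) → PMF (b → Bool)) {κ' ι : Type} (c : Circuit a b κ ι)
    (d : Circuit a b κ' (ι ⊕ κ)) (v : ι → Bool) :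
    (c.andThen d).run O v = (c.run O v).bind fun w => d.run O (Sum.elim v w) := by
  have key : ∀ {ι ι' : Type} (f : ι → ι') (v : ι' → Bool) (w : κ → Bool),
      (fun o : ι ⊕ κ => Sum.elim v w (Sum.map f id o)) = Sum.elim (fun i => v (f i)) w := by
    intro ι ι' f v w; funext o; cases o <;> rfl
  induction c with
  | ret out =>
    simp only [andThen, run, run_rename, PMF.pure_bind]
    congr 1; funext o; cases o <;> rfl
  | const c rest ih => simp only [andThen, run, ih, run_rename, key, Option.elim_some]
  | coin rest ih => simp only [andThen, run, ih, run_rename, key, Option.elim_some, PMF.bind_bind]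
  | nand i j rest ih => simp only [andThen, run, ih, run_rename, key, Option.elim_some]
  | call q rest ih => simp only [andThen, run, ih, run_rename, key, Sum.elim_inl, PMF.bind_bind]

/-- An oracle-free circuit, seen as an oracle circuit. -/
def lift (a b : Type) : {ι : Type} → Circuit Empty Empty κ ι → Circuit a b κ ι
  | _, ret out => ret out
  | _, const c rest => const c (rest.lift a b)
  | _, coin rest => coin (rest.lift a b)
  | _, nand i j rest => nand i j (rest.lift a b)
  | _, call _ rest => (rest.lift a b).rename (Sum.elim id Empty.elim)

theorem size_lift_le {ι : Type} (c : Circuit Empty Empty κ ι) :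
    (c.lift a b).size ≤ c.size := by
  induction c with
  | ret out => exact le_rfl
  | const _ _ ih => exact Nat.succ_le_succ ih
  | coin _ ih => exact Nat.succ_le_succ ih
  | nand _ _ _ ih => exact Nat.succ_le_succ ih
  | call _ _ ih => simp only [lift, size, size_rename]; omega

theorem run_lift (O : (a → Bool) → PMF (b → Bool)) (O' : (Empty → Bool) → PMF (Empty → Bool))
    {ι : Type} (c : Circuit Empty Empty κ ι) (v : ι → Bool) :
    (c.lift a b).run O v = c.run O' v := by
  induction c with
  | ret out => rfl
  | const _ _ ih => simp only [lift, run, ih]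
  | coin _ ih => simp only [lift, run, ih]
  | nand _ _ _ ih => simp only [lift, run, ih]
  | call q rest ih =>
    simp only [lift, run, run_rename, ih]
    have h : ∀ r : Empty → Bool,
        (fun i => v (Sum.elim id Empty.elim i)) = (Sum.elim v r : _ ⊕ Empty → Bool) := by
      intro r; funext o; rcases o with o | o
      · rfl
      · exact o.elim
    simp only [← h, PMF.bind_const]

/-- `m` circuits side by side. -/
def loop {ι : Type} : {m : ℕ} → (Fin m → Circuit a b κ ι) → Circuit a b (Fin m × κ) ι
  | 0, _ => ret fun k => k.1.elim0
  | _ + 1, c => (c 0).andThen (((loop fun t => c t.succ).rename Sum.inl).andThen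
      (ret fun k => Fin.cases (Sum.inl (Sum.inr k.2)) (fun t => Sum.inr (t, k.2)) k.1))

theorem size_loop_le {ι : Type} {m : ℕ} (c : Fin m → Circuit a b κ ι) (s : ℕ)
    (h : ∀ t, (c t).size ≤ s) : (loop c).size ≤ m * s := by
  induction m with
  | zero => simp [loop, size]
  | succ m ih =>
    have h1 := ih (fun t => c t.succ) fun t => h t.succ
    have h2 := h 0
    simp only [loop, size_andThen, size_rename, size, Nat.add_zero]
    rw [Nat.succ_mul]; omega

theorem run_loop (O : (a → Bool) → PMF (b → Bool)) {ι : Type} {m : ℕ}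
    (c : Fin m → Circuit a b κ ι) (v : ι → Bool) :
    (loop c).run O v = (sampleAll fun t => (c t).run O v).map fun w k => w k.1 k.2 := by
  induction m with
  | zero =>
    simp only [loop, run, sampleAll, PMF.pure_map]
    congr 1; funext k; exact k.1.elim0
  | succ m ih =>
    simp only [loop, run_andThen, run_rename, run, sampleAll, PMF.map_bind, Sum.elim_inl]
    congr 1; funext w
    rw [ih, PMF.bind_map, PMF.map_comp, ← PMF.bind_pure_comp]
    congr 1; funext w'
    simp only [Function.comp]
    congr 1; funext k
    obtain ⟨t, k⟩ := k
    refine Fin.cases ?_ (fun t => ?_) t <;> simp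

end Circuit

/-! ### Polynomial bounds -/

namespace PolyBounded

variable {P : Type} {size f g : P → ℕ}

theorem mono (hg : PolyBounded size g) (h : ∀ i, f i ≤ g i) : PolyBounded size f := by
  obtain ⟨p, hp⟩ := hg
  exact ⟨p, fun i => (h i).trans (hp i)⟩

theorem const (c : ℕ) : PolyBounded size fun _ => c := ⟨Polynomial.C c, fun _ => by simp⟩

theorem self : PolyBounded size size := ⟨Polynomial.X, fun _ => by simp⟩

theorem add (hf : PolyBounded size f) (hg : PolyBounded size g) :
    PolyBounded size fun i => f i + g i := by
  obtain ⟨p, hp⟩ := hf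
  obtain ⟨q, hq⟩ := hg
  exact ⟨p + q, fun i => by simpa using add_le_add (hp i) (hq i)⟩

theorem mul (hf : PolyBounded size f) (hg : PolyBounded size g) :
    PolyBounded size fun i => f i * g i := by
  obtain ⟨p, hp⟩ := hf
  obtain ⟨q, hq⟩ := hg
  exact ⟨p * q, fun i => by simpa using Nat.mul_le_mul (hp i) (hq i)⟩

theorem eval_mono (p : Polynomial ℕ) {m n : ℕ} (h : m ≤ n) : p.eval m ≤ p.eval n := by
  rw [Polynomial.eval_eq_sum, Polynomial.eval_eq_sum]
  exact Finset.sum_le_sum fun i _ => Nat.mul_le_mul_left _ (Nat.pow_le_pow_left h i)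

theorem trans {f : P → ℕ} (hf : PolyBounded g f) (hg : PolyBounded size g) :
    PolyBounded size f := by
  obtain ⟨p, hp⟩ := hf
  obtain ⟨q, hq⟩ := hg
  exact ⟨p.comp q, fun i => (hp i).trans (by rw [Polynomial.eval_comp]; exact eval_mono p (hq i))⟩

theorem comap {P' : Type} (h : PolyBounded size f) (g : P' → P) :
    PolyBounded (fun i => size (g i)) fun i => f (g i) := by
  obtain ⟨p, hp⟩ := h
  exact ⟨p, fun i => hp (g i)⟩

/-- A bound in terms of the security parameter, at an index whose security parameter is `g`. -/
theorem at_index {f : ℕ → ℕ} {g : P → ℕ} (h : PolyBounded id f) (hg : PolyBounded size g) :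
    PolyBounded size fun i => f (g i) :=
  (h.comap g).trans hg

end PolyBounded

/-! ### Maps that only move bits -/

/-- Every bit of the output of `f` is a fixed bit of the input or a constant. -/
@[fun_prop]
def Wire {α β : Type} [BitRep α] [BitRep β] (f : α → β) : Prop :=
  ∃ g : BitRep.idx β → BitRep.idx α ⊕ Bool,
    ∀ x k, BitRep.enc (f x) k = Sum.elim (BitRep.enc x) id (g k)

namespace Wire

variable {α β γ : Type} [BitRep α] [BitRep β] [BitRep γ]

@[fun_prop]
theorem id : Wire (fun x : α => x) := ⟨Sum.inl, fun _ _ => rfl⟩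

@[fun_prop]
theorem const (y : β) : Wire (fun _ : α => y) := ⟨fun k => Sum.inr (BitRep.enc y k), fun _ _ => rfl⟩

@[fun_prop]
theorem comp {g : β → γ} {f : α → β} (hg : Wire g) (hf : Wire f) : Wire (fun x => g (f x)) := by
  obtain ⟨u, hu⟩ := hg
  obtain ⟨w, hw⟩ := hf
  refine ⟨fun k => Sum.elim w Sum.inr (u k), fun x k => ?_⟩
  rw [hu]
  dsimp only
  cases u k with
  | inl i => exact hw x i
  | inr c => rfl

@[fun_prop]
theorem fst : Wire (fun p : α × β => p.1) := ⟨fun k => Sum.inl (Sum.inl k), fun _ _ => rfl⟩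

@[fun_prop]
theorem snd : Wire (fun p : α × β => p.2) := ⟨fun k => Sum.inl (Sum.inr k), fun _ _ => rfl⟩

@[fun_prop]
theorem prodMk {f : α → β} {g : α → γ} (hf : Wire f) (hg : Wire g) :
    Wire (fun x => (f x, g x)) := by
  obtain ⟨u, hu⟩ := hf
  obtain ⟨w, hw⟩ := hg
  refine ⟨Sum.elim u w, fun x k => ?_⟩
  cases k with
  | inl k => exact hu x k
  | inr k => exact hw x k

@[fun_prop]
theorem apply {ι : Type} [Finite ι] (i : ι) : Wire (fun f : ι → β => f i) :=
  ⟨fun k => Sum.inl (i, k), fun _ _ => rfl⟩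

@[fun_prop]
theorem pi {ι : Type} [Finite ι] {f : α → ι → β} (hf : ∀ i, Wire fun x => f x i) :
    Wire (fun x i => f x i) := by
  choose u hu using hf
  exact ⟨fun k => u k.1 k.2, fun x k => hu k.1 x k.2⟩

theorem isSome : Wire (fun o : Option β => o.isSome) := by
  refine ⟨fun _ => Sum.inl none, fun x k => ?_⟩
  cases x <;> rfl

end Wire

/-! ### Efficient randomised maps with an oracle -/

/-- `A i O x` is the output distribution of a probabilistic circuit with polynomially many gates
that queries the oracle `O`. -/
def OracleEfficient {P : Type} (size : P → ℕ) {a b α β : P → Type}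
    [∀ i, BitRep (α i)] [∀ i, BitRep (β i)]
    (A : ∀ i, ((a i → Bool) → PMF (b i → Bool)) → α i → PMF (β i)) : Prop :=
  ∃ C : ∀ i, Circuit (a i) (b i) (BitRep.idx (β i)) (BitRep.idx (α i)),
    PolyBounded size (fun i => (C i).size) ∧
    ∀ i O x, (C i).run O (BitRep.enc x) = (A i O x).map BitRep.enc

section

variable {P : Type} {size : P → ℕ} {a b α β γ : P → Type}
  [∀ i, BitRep (α i)] [∀ i, BitRep (β i)] [∀ i, BitRep (γ i)]

theorem Efficient.oracleEfficient {A : ∀ i, α i → PMF (β i)} (h : Efficient size A) :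
    OracleEfficient size (a := a) (b := b) (fun i _ x => A i x) := by
  obtain ⟨C, hC, hr⟩ := h
  refine ⟨fun i => (C i).lift _ _, hC.mono fun i => Circuit.size_lift_le _, fun i O x => ?_⟩
  rw [← hr]
  exact Circuit.run_lift _ _ _ _

theorem OracleEfficient.efficient {A : ∀ i, α i → PMF (β i)}
    (h : OracleEfficient size (a := fun _ => Empty) (b := fun _ => Empty) (fun i _ x => A i x)) :
    Efficient size A := by
  obtain ⟨C, hC, hr⟩ := h
  exact ⟨C, hC, fun i x => hr i _ x⟩

namespace OracleEfficient

theorem comap {A : ∀ i, ((a i → Bool) → PMF (b i → Bool)) → α i → PMF (β i)}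
    (h : OracleEfficient size A) {P' : Type} {size' : P' → ℕ} (g : P' → P)
    (hg : PolyBounded size' fun i => size (g i)) :
    OracleEfficient size' (fun i => A (g i)) := by
  obtain ⟨C, hC, hr⟩ := h
  exact ⟨fun i => C (g i), (hC.comap g).trans hg, fun i => hr (g i)⟩

theorem pure {f : ∀ i, α i → β i} (hf : ∀ i, Wire (f i)) :
    OracleEfficient size (a := a) (b := b) (fun i _ x => PMF.pure (f i x)) := by
  choose g hg using hf
  -- The constants are computed once and can then be used for any number of output bits.
  refine ⟨fun i => .const true (.const false (.ret fun k =>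
    Sum.elim (fun j => some (some j)) (fun c => if c then some none else none) (g i k))),
    PolyBounded.const 2, fun i O x => ?_⟩
  simp only [Circuit.run, PMF.pure_map]
  congr 1; funext k
  rw [hg]
  cases g i k with
  | inl j => rfl
  | inr c => cases c <;> rfl

theorem bind {A : ∀ i, ((a i → Bool) → PMF (b i → Bool)) → α i → PMF (β i)}
    {B : ∀ i, ((a i → Bool) → PMF (b i → Bool)) → α i → β i → PMF (γ i)}
    (hA : OracleEfficient size A)
    (hB : OracleEfficient size (α := fun i => α i × β i) (fun i O p => B i O p.1 p.2)) :
    OracleEfficient size (fun i O x => (A i O x).bind (B i O x)) := by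
  obtain ⟨C, hC, hr⟩ := hA
  obtain ⟨D, hD, hs⟩ := hB
  refine ⟨fun i => (C i).andThen (D i), (hC.add hD).mono fun i => (Circuit.size_andThen _ _).le,
    fun i O x => ?_⟩
  rw [Circuit.run_andThen, hr, PMF.bind_map, PMF.map_bind]
  congr 1; funext y
  exact hs i O (x, y)

theorem map {A : ∀ i, ((a i → Bool) → PMF (b i → Bool)) → α i → PMF (β i)}
    {f : ∀ i, α i → β i → γ i}
    (hA : OracleEfficient size A) (hf : ∀ i, Wire fun p : α i × β i => f i p.1 p.2) :
    OracleEfficient size (fun i O x => (A i O x).map (f i x)) :=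
  hA.bind (B := fun i _ x y => PMF.pure (f i x y)) (pure hf)

/-- The input may be rearranged by `f`; this takes a circuit only because `f` may insert
constants. -/
theorem precomp {A : ∀ i, ((a i → Bool) → PMF (b i → Bool)) → β i → PMF (γ i)}
    {f : ∀ i, α i → β i}
    (hA : OracleEfficient size A) (hf : ∀ i, Wire (f i)) :
    OracleEfficient size (fun i O x => A i O (f i x)) := by
  obtain ⟨C, hC, hr⟩ := pure (size := size) (a := a) (b := b) hf
  obtain ⟨D, hD, hs⟩ := hA
  refine ⟨fun i => (C i).andThen ((D i).rename Sum.inr),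
    (hC.add hD).mono fun i => by rw [Circuit.size_andThen, Circuit.size_rename], fun i O x => ?_⟩
  rw [Circuit.run_andThen, hr, PMF.pure_map, PMF.pure_bind, Circuit.run_rename]
  exact hs i O (f i x)

theorem sampleAll {q : P → ℕ} (hq : PolyBounded size q)
    {A : ∀ i, Fin (q i) → ((a i → Bool) → PMF (b i → Bool)) → α i → PMF (β i)}
    (hA : OracleEfficient (P := Σ i, Fin (q i)) (fun p => size p.1) (a := fun p => a p.1)
      (b := fun p => b p.1) (α := fun p => α p.1) (β := fun p => β p.1)
      (fun p O x => A p.1 p.2 O x)) :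
    OracleEfficient size (fun i O x => Outsourcing.sampleAll fun t => A i t O x) := by
  obtain ⟨C, ⟨r, hC⟩, hr⟩ := hA
  refine ⟨fun i => Circuit.loop fun t => C ⟨i, t⟩,
    (hq.mul ⟨r, fun i => le_rfl⟩).mono fun i =>
      Circuit.size_loop_le _ _ fun t => hC ⟨i, t⟩, fun i O x => ?_⟩
  rw [Circuit.run_loop]
  have h : (fun t => (C ⟨i, t⟩).run O (BitRep.enc x)) = fun t => (A i t O x).map BitRep.enc :=
    funext fun t => hr ⟨i, t⟩ O x
  rw [h, sampleAll_map, PMF.map_comp]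
  rfl

theorem coin : OracleEfficient size (a := a) (b := b) (α := α) (β := fun _ => Bool)
    (fun _ _ _ => PMF.uniformOfFintype Bool) := by
  refine ⟨fun i => .coin (.ret fun _ => none), PolyBounded.const 1, fun i O x => ?_⟩
  simp only [Circuit.run]
  rfl

/-- The choice between two circuits may depend on the index; it is part of the advice. -/
theorem ite (c : P → Prop) [∀ i, Decidable (c i)]
    {A B : ∀ i, ((a i → Bool) → PMF (b i → Bool)) → α i → PMF (β i)}
    (hA : OracleEfficient size A) (hB : OracleEfficient size B) :
    OracleEfficient size (fun i O x => if c i then A i O x else B i O x) := by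
  obtain ⟨C, hC, hr⟩ := hA
  obtain ⟨D, hD, hs⟩ := hB
  refine ⟨fun i => if c i then C i else D i, (hC.add hD).mono fun i => ?_, fun i O x => ?_⟩
  · dsimp only
    split <;> omega
  · dsimp only
    split
    · exact hr i O x
    · exact hs i O x

/-- Selection between two bits. -/
theorem mux {s f g : ∀ i, α i → Bool} (hs : ∀ i, Wire (s i)) (hf : ∀ i, Wire (f i))
    (hg : ∀ i, Wire (g i)) :
    OracleEfficient size (a := a) (b := b)
      (fun i _ x => PMF.pure (if s i x then f i x else g i x)) := by
  -- `if s then f else g` is `nand (nand s f) (nand (nand s s) g)`.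
  have h : OracleEfficient size (a := a) (b := b) (α := fun _ => Bool × Bool × Bool)
      (β := fun _ => Bool) (fun _ _ x => PMF.pure (if x.1 then x.2.1 else x.2.2)) := by
    refine ⟨fun i => .nand (.inl ()) (.inl ()) (.nand (some (.inl ())) (some (.inr (.inl ())))
      (.nand (some none) (some (some (.inr (.inr ())))) (.nand none (some none)
        (.ret fun _ => none)))), PolyBounded.const 4, fun i O x => ?_⟩
    simp only [Circuit.run, PMF.pure_map]
    congr 1; funext k
    obtain ⟨x, y, z⟩ := x
    cases x <;> cases y <;> cases z <;> rfl
  exact h.precomp (f := fun i x => (s i x, f i x, g i x)) fun i =>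
    (hs i).prodMk ((hf i).prodMk (hg i))

/-- Selection between two bit strings. -/
theorem muxBits {L : P → ℕ} (hL : PolyBounded size L) {s : ∀ i, α i → Bool}
    {f g : ∀ i, α i → Bits (L i)} (hs : ∀ i, Wire (s i)) (hf : ∀ i, Wire (f i))
    (hg : ∀ i, Wire (g i)) :
    OracleEfficient size (a := a) (b := b)
      (fun i _ x => PMF.pure (if s i x then f i x else g i x)) := by
  have h := sampleAll (size := size) (a := a) (b := b) hL
    (A := fun i t _ x => PMF.pure (if s i x then f i x t else g i x t))
    (mux (fun p => hs p.1) (fun p => (Wire.apply p.2).comp (hf p.1))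
      (fun p => (Wire.apply p.2).comp (hg p.1)))
  refine cast ?_ h
  congr 1
  funext i O x
  rw [sampleAll_pure]
  congr 1; funext t; split <;> rfl

end OracleEfficient

end

theorem Efficient.comap {P : Type} {size : P → ℕ} {α β : P → Type} [∀ i, BitRep (α i)]
    [∀ i, BitRep (β i)] {A : ∀ i, α i → PMF (β i)} (h : Efficient size A) {P' : Type}
    {size' : P' → ℕ} (g : P' → P) (hg : PolyBounded size' fun i => size (g i)) :
    Efficient size' fun i => A (g i) := by
  obtain ⟨C, hC, hr⟩ := h
  exact ⟨fun i => C (g i), (hC.comap g).trans hg, fun i => hr (g i)⟩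

/-! ### Acceptance probabilities -/

theorem prTrue_nonneg (p : PMF Bool) : 0 ≤ prTrue p := ENNReal.toReal_nonneg

theorem prTrue_le_one (p : PMF Bool) : prTrue p ≤ 1 :=
  ENNReal.toReal_mono ENNReal.one_ne_top (p.coe_le_one true)

theorem abs_prTrue_sub_le_one (p q : PMF Bool) : |prTrue p - prTrue q| ≤ 1 :=
  abs_sub_le_of_nonneg_of_le (prTrue_nonneg p) (prTrue_le_one p) (prTrue_nonneg q)
    (prTrue_le_one q)

theorem summable_pmf_toReal {α : Type} (p : PMF α) : Summable fun a => (p a).toReal :=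
  ENNReal.summable_toReal p.tsum_coe_ne_top

theorem summable_mul_prTrue {α : Type} (p : PMF α) (f : α → PMF Bool) :
    Summable fun a => (p a).toReal * prTrue (f a) :=
  (summable_pmf_toReal p).of_nonneg_of_le
    (fun _ => mul_nonneg ENNReal.toReal_nonneg (prTrue_nonneg _))
    fun _ => mul_le_of_le_one_right ENNReal.toReal_nonneg (prTrue_le_one _)

theorem prTrue_bind {α : Type} (p : PMF α) (f : α → PMF Bool) :
    prTrue (p.bind f) = ∑' a, (p a).toReal * prTrue (f a) := by
  simp only [prTrue, PMF.bind_apply]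
  rw [ENNReal.tsum_toReal_eq]
  · simp only [ENNReal.toReal_mul]
  · exact fun a => ENNReal.mul_ne_top (p.apply_ne_top a) ((f a).apply_ne_top true)

/-- Two continuations that are `ε`-close outside of a bad event stay close after averaging, up to
the probability of the bad event. -/
theorem abs_prTrue_bind_sub_le {α : Type} (p : PMF α) (f g : α → PMF Bool) (bad : Set α) {ε : ℝ}
    (hε : 0 ≤ ε) (h : ∀ a ∈ p.support, a ∉ bad → |prTrue (f a) - prTrue (g a)| ≤ ε) :
    |prTrue (p.bind f) - prTrue (p.bind g)| ≤ ε + (p.toOuterMeasure bad).toReal := by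
  have hp := summable_pmf_toReal p
  have hb : Summable fun a => (bad.indicator p a).toReal := by
    refine hp.of_nonneg_of_le (fun _ => ENNReal.toReal_nonneg) fun a => ?_
    by_cases ha : a ∈ bad <;> simp [ha]
  have hs : Summable fun a => (p a).toReal * |prTrue (f a) - prTrue (g a)| :=
    hp.of_nonneg_of_le (fun _ => mul_nonneg ENNReal.toReal_nonneg (abs_nonneg _))
      fun _ => mul_le_of_le_one_right ENNReal.toReal_nonneg (abs_prTrue_sub_le_one _ _)
  have h1 : ∑' a, (p a).toReal = 1 := by
    rw [← ENNReal.tsum_toReal_eq p.apply_ne_top, p.tsum_coe]; rfl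
  rw [prTrue_bind, prTrue_bind, ← (summable_mul_prTrue p f).tsum_sub (summable_mul_prTrue p g)]
  simp only [← mul_sub]
  calc |∑' a, (p a).toReal * (prTrue (f a) - prTrue (g a))|
      ≤ ∑' a, (p a).toReal * |prTrue (f a) - prTrue (g a)| := by
        have hs' : Summable fun a => ‖(p a).toReal * (prTrue (f a) - prTrue (g a))‖ := by
          simpa [abs_mul, Real.norm_eq_abs] using hs
        have := norm_tsum_le_tsum_norm hs'
        simpa [abs_mul, Real.norm_eq_abs] using this
    _ ≤ ∑' a, ((p a).toReal * ε + (bad.indicator p a).toReal) := by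
        refine hs.tsum_le_tsum (fun a => ?_) ((hp.mul_right ε).add hb)
        by_cases h0 : p a = 0
        · simp [h0]
        by_cases ha : a ∈ bad
        · simp only [ha, Set.indicator_of_mem]
          have : (p a).toReal * |prTrue (f a) - prTrue (g a)| ≤ (p a).toReal :=
            mul_le_of_le_one_right ENNReal.toReal_nonneg (abs_prTrue_sub_le_one _ _)
          have h2 : 0 ≤ (p a).toReal * ε := mul_nonneg ENNReal.toReal_nonneg hε
          linarith
        · simp only [ha, not_false_eq_true, Set.indicator_of_notMem, ENNReal.toReal_zero, add_zero]
          exact mul_le_mul_of_nonneg_left (h a ((p.mem_support_iff a).2 h0) ha)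
            ENNReal.toReal_nonneg
    _ = ε + (p.toOuterMeasure bad).toReal := by
        rw [(hp.mul_right ε).tsum_add hb, tsum_mul_right, h1, one_mul, PMF.toOuterMeasure_apply,
          ENNReal.tsum_toReal_eq]
        intro a
        by_cases ha : a ∈ bad <;> simp [ha, p.apply_ne_top]

theorem abs_prTrue_bind_sub_le' {α : Type} (p : PMF α) (f g : α → PMF Bool) {ε : ℝ}
    (h : ∀ a, |prTrue (f a) - prTrue (g a)| ≤ ε) :
    |prTrue (p.bind f) - prTrue (p.bind g)| ≤ ε := by
  obtain ⟨a, -⟩ := p.support_nonempty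
  have := abs_prTrue_bind_sub_le p f g ∅ ((abs_nonneg _).trans (h a)) fun a _ _ => h a
  simpa using this

/-- The hybrid argument for independent samples, in terms of the largest advantage at a single
position when all other samples are fixed. -/
theorem abs_prTrue_sampleAll_sub_le {α : Type} {m : ℕ} (X Y : Fin m → PMF α)
    (D : (Fin m → α) → PMF Bool) (ε : ℝ)
    (h : ∀ t y, |prTrue ((X t).bind fun x => D (Function.update y t x)) -
      prTrue ((Y t).bind fun x => D (Function.update y t x))| ≤ ε) :
    |prTrue ((sampleAll X).bind D) - prTrue ((sampleAll Y).bind D)| ≤ m * ε := by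
  induction m with
  | zero => simp [sampleAll]
  | succ m ih =>
    have e : ∀ U V : Fin (m + 1) → PMF α, ((U 0).bind fun x => (sampleAll fun i => V i.succ).map
        fun w => (Fin.cons x w : Fin (m + 1) → α)).bind D =
        (U 0).bind fun x => (sampleAll fun i => V i.succ).bind fun w => D (Fin.cons x w) := by
      intro U V; simp only [PMF.bind_bind, PMF.bind_map, Function.comp_def]
    have h1 : |prTrue ((X 0).bind fun x => (sampleAll fun i => X i.succ).bind fun w =>
          D (Fin.cons x w)) -
        prTrue ((Y 0).bind fun x => (sampleAll fun i => X i.succ).bind fun w =>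
          D (Fin.cons x w))| ≤ ε := by
      rw [PMF.bind_comm, PMF.bind_comm (Y 0)]
      refine abs_prTrue_bind_sub_le' _ _ _ fun w => ?_
      obtain ⟨x0, -⟩ := (X 0).support_nonempty
      have := h 0 (Fin.cons x0 w)
      simpa only [Fin.update_cons_zero] using this
    have h2 : |prTrue ((Y 0).bind fun x => (sampleAll fun i => X i.succ).bind fun w =>
          D (Fin.cons x w)) -
        prTrue ((Y 0).bind fun x => (sampleAll fun i => Y i.succ).bind fun w =>
          D (Fin.cons x w))| ≤ m * ε := by
      refine abs_prTrue_bind_sub_le' _ _ _ fun x => ?_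
      refine ih _ _ (fun w => D (Fin.cons x w)) fun t y => ?_
      have := h t.succ (Fin.cons x y)
      simpa only [Fin.cons_update] using this
    simp only [sampleAll, e]
    push_cast
    calc _ ≤ _ := abs_sub_le _ _ _
      _ ≤ ε + m * ε := add_le_add h1 h2
      _ = _ := by ring

/-! ### Negligible functions -/

namespace Negligible

variable {f g : ℕ → ℝ}

theorem mono (hf : Negligible f) (h : ∀ n, |g n| ≤ f n) : Negligible g :=
  Asymptotics.SuperpolynomialDecay.trans_abs_le hf fun n => (h n).trans (le_abs_self _)

theorem zero : Negligible fun _ => 0 := fun n => by simp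

theorem add (hf : Negligible f) (hg : Negligible g) : Negligible fun n => f n + g n :=
  Asymptotics.SuperpolynomialDecay.add hf hg

theorem abs (hf : Negligible f) : Negligible fun n => |f n| :=
  Asymptotics.SuperpolynomialDecay.trans_abs_le hf fun _ => (abs_abs _).le

theorem const_mul (hf : Negligible f) (c : ℝ) : Negligible fun n => c * f n :=
  Asymptotics.SuperpolynomialDecay.const_mul hf c

theorem poly_mul (hf : Negligible f) {q : ℕ → ℕ} (hq : PolyBounded id q) :
    Negligible fun n => q n * f n := by
  obtain ⟨p, hp⟩ := hq
  have h := Asymptotics.SuperpolynomialDecay.polynomial_mul hf.abs (p.map (Nat.castRingHom ℝ))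
  refine mono h fun n => ?_
  rw [abs_mul, Nat.abs_cast]
  refine mul_le_mul_of_nonneg_right ?_ (abs_nonneg _)
  rw [Polynomial.eval_natCast_map, Nat.coe_castRingHom]
  exact Nat.cast_le.2 (hp n)

theorem inv_two_pow : Negligible fun n => ((2 : ℝ) ^ n)⁻¹ := fun k => by
  simpa [div_eq_mul_inv] using tendsto_pow_const_div_const_pow_of_one_lt k (one_lt_two (α := ℝ))

/-- If every selection of adversaries of polynomial size has negligible advantage, then the
advantages of all adversaries below a given polynomial size have a common negligible bound. -/
theorem uniform {C : ℕ → Type*} (adv : ∀ n, C n → ℝ) (sz : ∀ n, C n → ℕ)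
    (h1 : ∀ n c, adv n c ≤ 1) (c₀ : ∀ n, C n) (hc₀ : ∀ n, sz n (c₀ n) ≤ 1)
    (hadv₀ : ∀ n, 0 ≤ adv n (c₀ n))
    (H : ∀ A : ∀ n, C n, PolyBounded id (fun n => sz n (A n)) → Negligible fun n => adv n (A n))
    (p : Polynomial ℕ) :
    ∃ ε, Negligible ε ∧ ∀ n c, sz n c ≤ p.eval n → adv n c ≤ ε n := by
  -- The bound is the supremum of the advantages. An adversary with at least half of it exists. The
  -- size limit is increased by one to make room for the default adversary `c₀`.
  let S : ∀ n, Set ℝ := fun n => {a | ∃ c, sz n c ≤ p.eval n + 1 ∧ adv n c = a}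
  have hne : ∀ n, (S n).Nonempty := fun n => ⟨_, c₀ n, (hc₀ n).trans (Nat.le_add_left _ _), rfl⟩
  have hb : ∀ n, BddAbove (S n) := fun n => ⟨1, by rintro _ ⟨c, -, rfl⟩; exact h1 n c⟩
  have hle : ∀ n c, sz n c ≤ p.eval n + 1 → adv n c ≤ sSup (S n) :=
    fun n c hc => le_csSup (hb n) ⟨c, hc, rfl⟩
  have h0 : ∀ n, 0 ≤ sSup (S n) :=
    fun n => (hadv₀ n).trans (hle n (c₀ n) ((hc₀ n).trans (Nat.le_add_left _ _)))
  have hA : ∀ n, ∃ c, sz n c ≤ p.eval n + 1 ∧ sSup (S n) / 2 ≤ adv n c := by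
    intro n
    rcases (h0 n).eq_or_lt with h | h
    · exact ⟨c₀ n, (hc₀ n).trans (Nat.le_add_left _ _), by rw [← h]; simpa using hadv₀ n⟩
    · obtain ⟨_, ⟨c, hc, rfl⟩, hlt⟩ := exists_lt_of_lt_csSup (hne n) (half_lt_self h)
      exact ⟨c, hc, hlt.le⟩
  choose A hsz hA using hA
  refine ⟨fun n => sSup (S n), ((H A ⟨p + 1, fun n => by simpa using hsz n⟩).const_mul 2).mono fun n => ?_,
    fun n c hc => hle n c (hc.trans (Nat.le_succ _))⟩
  rw [abs_of_nonneg (h0 n)]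
  linarith [hA n]

end Negligible

/-! ### Indistinguishability of families -/

/-- Indistinguishability of two families over an arbitrary index type, where `size` is the security
parameter: the advantages of an efficient family of distinguishers are bounded by one negligible
function of the security parameter. -/
def Indist {P : Type} (size : P → ℕ) {α : P → Type} [∀ i, BitRep (α i)]
    (X Y : ∀ i, PMF (α i)) : Prop :=
  ∀ D : ∀ i, α i → PMF Bool, Efficient size D →
    ∃ ε, Negligible ε ∧ ∀ i, |prTrue ((X i).bind (D i)) - prTrue ((Y i).bind (D i))| ≤ ε (size i)

theorem finite_of_bitRep (α : Type) [A : BitRep α] : Finite α := by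
  have := A.finite_idx
  exact Finite.of_injective _ A.enc_injective

namespace Indist

variable {P : Type} {size : P → ℕ} {α β : P → Type} [∀ i, BitRep (α i)] [∀ i, BitRep (β i)]

theorem refl (X : ∀ i, PMF (α i)) : Indist size X X := fun _ _ =>
  ⟨fun _ => 0, Negligible.zero, fun i => by simp⟩

theorem trans {X Y Z : ∀ i, PMF (α i)} (h : Indist size X Y) (h' : Indist size Y Z) :
    Indist size X Z := by
  intro D hD
  obtain ⟨ε, hε, h⟩ := h D hD
  obtain ⟨ε', hε', h'⟩ := h' D hD
  exact ⟨_, hε.add hε', fun i => (abs_sub_le _ _ _).trans (add_le_add (h i) (h' i))⟩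

theorem congr {X Y X' Y' : ∀ i, PMF (α i)} (h : Indist size X Y) (hX : ∀ i, X' i = X i)
    (hY : ∀ i, Y' i = Y i) : Indist size X' Y' := by
  rw [funext hX, funext hY]
  exact h

/-- Efficient randomised post-processing. -/
theorem bind {X Y : ∀ i, PMF (α i)} (h : Indist size X Y) {A : ∀ i, α i → PMF (β i)}
    (hA : Efficient size A) : Indist size (fun i => (X i).bind (A i)) (fun i => (Y i).bind (A i)) := by
  intro D hD
  simp only [PMF.bind_bind]
  refine h (fun i x => (A i x).bind (D i)) (OracleEfficient.efficient ?_)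
  exact hA.oracleEfficient.bind (hD.oracleEfficient.precomp fun i => Wire.snd)

theorem map {X Y : ∀ i, PMF (α i)} (h : Indist size X Y) {f : ∀ i, α i → β i}
    (hf : ∀ i, Wire (f i)) : Indist size (fun i => (X i).map (f i)) (fun i => (Y i).map (f i)) :=
  h.bind (A := fun i x => PMF.pure (f i x)) (OracleEfficient.pure hf).efficient

/-- Families that are indistinguishable for every fixed value of an auxiliary random variable
outside of a negligible bad event are indistinguishable. Distinguishers being non-uniform, the
auxiliary value can be part of the index. -/
theorem average_of_bad {Z : P → Type} (μ : ∀ i, PMF (Z i)) {X Y : ∀ i, Z i → PMF (α i)}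
    (bad : ∀ i, Set (Z i)) {δ : ℕ → ℝ} (hδ : Negligible δ)
    (hbad : ∀ i, ((μ i).toOuterMeasure (bad i)).toReal ≤ δ (size i))
    (h : Indist (P := Σ i, {z : Z i // z ∈ (μ i).support ∧ z ∉ bad i}) (fun p => size p.1)
      (α := fun p => α p.1) (fun p => X p.1 p.2) (fun p => Y p.1 p.2)) :
    Indist size (fun i => (μ i).bind (X i)) (fun i => (μ i).bind (Y i)) := by
  intro D hD
  obtain ⟨ε, hε, h⟩ := h (fun p => D p.1)
    (hD.comap (fun p : Σ i, {z : Z i // z ∈ (μ i).support ∧ z ∉ bad i} => p.1)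
      PolyBounded.self)
  refine ⟨_, hε.abs.add hδ, fun i => ?_⟩
  rw [PMF.bind_bind, PMF.bind_bind]
  refine (abs_prTrue_bind_sub_le _ _ _ (bad i) (abs_nonneg (ε (size i)))
    fun z hz hz' => ?_).trans (add_le_add le_rfl (hbad i))
  exact (h ⟨i, z, hz, hz'⟩).trans (le_abs_self _)

theorem average {Z : P → Type} (μ : ∀ i, PMF (Z i)) {X Y : ∀ i, Z i → PMF (α i)}
    (h : Indist (P := Σ i, Z i) (fun p => size p.1)
      (α := fun p => α p.1) (fun p => X p.1 p.2) (fun p => Y p.1 p.2)) :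
    Indist size (fun i => (μ i).bind (X i)) (fun i => (μ i).bind (Y i)) := by
  intro D hD
  obtain ⟨ε, hε, h⟩ := h (fun p => D p.1)
    (hD.comap (fun p : Σ i, Z i => p.1) PolyBounded.self)
  refine ⟨ε, hε, fun i => ?_⟩
  rw [PMF.bind_bind, PMF.bind_bind]
  exact abs_prTrue_bind_sub_le' _ _ _ fun z => h ⟨i, z⟩

/-- The hybrid argument: polynomially many independent samples may be replaced at once. As the
distinguisher is non-uniform, the samples need not be efficiently computable. -/
theorem sampleAll {q : P → ℕ} (hq : PolyBounded size q) {X Y : ∀ i, Fin (q i) → PMF (α i)}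
    (h : Indist (P := Σ i, Fin (q i)) (fun p => size p.1)
      (α := fun p => α p.1) (fun p => X p.1 p.2) (fun p => Y p.1 p.2)) :
    Indist size (fun i => Outsourcing.sampleAll (X i)) (fun i => Outsourcing.sampleAll (Y i)) := by
  intro D hD
  -- Fix all other samples to the values that maximise the advantage.
  have hmax : ∀ p : Σ i, Fin (q i), ∃ y : Fin (q p.1) → α p.1, ∀ y',
      |prTrue ((X p.1 p.2).bind fun x => D p.1 (Function.update y' p.2 x)) -
        prTrue ((Y p.1 p.2).bind fun x => D p.1 (Function.update y' p.2 x))| ≤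
      |prTrue ((X p.1 p.2).bind fun x => D p.1 (Function.update y p.2 x)) -
        prTrue ((Y p.1 p.2).bind fun x => D p.1 (Function.update y p.2 x))| := by
    intro p
    have := finite_of_bitRep (α p.1)
    obtain ⟨x, -⟩ := (X p.1 p.2).support_nonempty
    have : Nonempty (Fin (q p.1) → α p.1) := ⟨fun _ => x⟩
    exact Finite.exists_max _
  choose y hy using hmax
  obtain ⟨ε, hε, h⟩ := h (fun p x => D p.1 (Function.update (y p) p.2 x)) <| by
    refine OracleEfficient.efficient (OracleEfficient.precomp
      (hD.comap (fun p : Σ i, Fin (q i) => p.1) PolyBounded.self).oracleEfficient fun p => ?_)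
    refine Wire.pi fun t => ?_
    by_cases ht : t = p.2
    · subst ht; simpa using Wire.id
    · simpa [ht] using Wire.const _
  obtain ⟨r, hr⟩ := hq
  refine ⟨fun n => (r.eval n : ℕ) * |ε n|, hε.abs.poly_mul ⟨r, fun n => le_rfl⟩, fun i => ?_⟩
  refine (abs_prTrue_sampleAll_sub_le _ _ _ |ε (size i)| fun t y' =>
    (hy ⟨i, t⟩ y').trans ((h ⟨i, t⟩).trans (le_abs_self _))).trans ?_
  exact mul_le_mul_of_nonneg_right (Nat.cast_le.2 (hr i)) (abs_nonneg _)

/-- Statistically close families. -/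
theorem of_bad {Z : P → Type} (μ : ∀ i, PMF (Z i)) {X Y : ∀ i, Z i → PMF (α i)}
    (bad : ∀ i, Set (Z i)) {δ : ℕ → ℝ} (hδ : Negligible δ)
    (hbad : ∀ i, ((μ i).toOuterMeasure (bad i)).toReal ≤ δ (size i))
    (h : ∀ i, ∀ z ∉ bad i, X i z = Y i z) :
    Indist size (fun i => (μ i).bind (X i)) (fun i => (μ i).bind (Y i)) :=
  average_of_bad μ bad hδ hbad (by
    have : (fun p : Σ i, {z : Z i // z ∈ (μ i).support ∧ z ∉ bad i} => X p.1 p.2) =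
        fun p : Σ i, {z : Z i // z ∈ (μ i).support ∧ z ∉ bad i} => Y p.1 p.2 :=
      funext fun p => h p.1 _ p.2.2.2
    rw [this]
    exact refl _)

theorem compIndist {α : ℕ → Type} [∀ n, BitRep (α n)] {X Y : ∀ n, PMF (α n)}
    (h : Indist (fun n => n) X Y) : CompIndist X Y := by
  intro D hD
  obtain ⟨ε, hε, h⟩ := h D hD
  exact hε.mono fun n => by rw [abs_abs]; exact h n

end Indist

/-- The test that runs a circuit with one output bit. -/
noncomputable def Circuit.test {α : Type} [BitRep α] (c : Circuit Empty Empty Unit (BitRep.idx α))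
    (x : α) : PMF Bool :=
  (c.run (fun _ => PMF.pure Empty.elim) (BitRep.enc x)).map fun o => o ()

theorem Circuit.efficient_test {P : Type} {size : P → ℕ} {α : P → Type} [∀ i, BitRep (α i)]
    (c : ∀ i, Circuit Empty Empty Unit (BitRep.idx (α i)))
    (hc : PolyBounded size fun i => (c i).size) : Efficient size fun i => (c i).test := by
  refine ⟨c, hc, fun i x => ?_⟩
  simp only [Circuit.test]
  rw [PMF.map_comp]
  exact (PMF.map_id _).symm

theorem map_enc_bool (p : PMF Bool) : (p.map BitRep.enc).map (fun o : Unit → Bool => o ()) = p := by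
  rw [PMF.map_comp]
  exact PMF.map_id _

/-- If two families that depend on a parameter in `J n` are computationally indistinguishable for
every choice of the parameters, they are indistinguishable uniformly in the parameters. -/
theorem Indist.of_forall_compIndist {J : ℕ → Type} [∀ n, Nonempty (J n)] {α : ℕ → Type}
    [∀ n, BitRep (α n)] {X Y : ∀ n, J n → PMF (α n)}
    (h : ∀ j : ∀ n, J n, CompIndist (fun n => X n (j n)) (fun n => Y n (j n)))
    {P : Type} {size : P → ℕ} (j : ∀ i, J (size i)) :
    Indist size (fun i => X (size i) (j i)) (fun i => Y (size i) (j i)) := by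
  rintro D ⟨c, ⟨p, hc⟩, hr⟩
  obtain ⟨ε, hε, hb⟩ := Negligible.uniform
    (C := fun n => J n × Circuit Empty Empty Unit (BitRep.idx (α n)))
    (fun n c => |prTrue ((X n c.1).bind c.2.test) - prTrue ((Y n c.1).bind c.2.test)|)
    (fun n c => c.2.size) (fun n c => abs_prTrue_sub_le_one _ _)
    (fun n => (Classical.arbitrary _, .const true (.ret fun _ => none))) (fun n => le_rfl)
    (fun n => abs_nonneg _) (fun A hA => h (fun n => (A n).1) _ (Circuit.efficient_test _ hA)) p
  refine ⟨ε, hε, fun i => ?_⟩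
  have h1 := hb (size i) (j i, c i) (hc i)
  have h2 : (c i).test = D i := funext fun x => by
    rw [Circuit.test]
    refine Eq.trans ?_ (map_enc_bool (D i x))
    rw [← hr]
  rwa [h2] at h1

theorem CompIndist.indist {α : ℕ → Type} [∀ n, BitRep (α n)] {X Y : ∀ n, PMF (α n)}
    (h : CompIndist X Y) {P : Type} (size : P → ℕ) :
    Indist size (fun i => X (size i)) (fun i => Y (size i)) :=
  Indist.of_forall_compIndist (J := fun _ => Unit) (X := fun n _ => X n) (Y := fun n _ => Y n)
    (fun _ => h) fun _ => ()

/-! ### Uniform distributions -/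

theorem uniform_map_equiv {α β : Type} [Fintype α] [Nonempty α] [Fintype β] [Nonempty β]
    (e : α ≃ β) : (PMF.uniformOfFintype α).map e = PMF.uniformOfFintype β := by
  ext y
  rw [PMF.map_apply, tsum_eq_single (e.symm y)]
  · simp [Fintype.card_congr e]
  · intro x hx
    rw [if_neg]
    rintro rfl
    exact hx (e.symm_apply_apply x).symm

theorem uniform_bind_pair {α β : Type} [Fintype α] [Nonempty α] [Fintype β] [Nonempty β] :
    ((PMF.uniformOfFintype α).bind fun x => (PMF.uniformOfFintype β).map fun y => (x, y)) =
      PMF.uniformOfFintype (α × β) := by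
  ext ⟨x, y⟩
  rw [PMF.bind_apply, tsum_eq_single x]
  · rw [PMF.map_apply, tsum_eq_single y]
    · simp only [if_true, PMF.uniformOfFintype_apply, Fintype.card_prod, Nat.cast_mul]
      rw [ENNReal.mul_inv] <;> simp
    · intro z hz
      rw [if_neg]
      rintro h
      exact hz (congrArg Prod.snd h).symm
  · intro z hz
    convert mul_zero _
    rw [PMF.map_apply, ENNReal.tsum_eq_zero]
    intro w
    rw [if_neg]
    intro h
    exact hz (congrArg Prod.fst h).symm

theorem uniform_bool_fun {B : Type} [Fintype B] [Nonempty B] :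
    PMF.uniformOfFintype (Bool → B) = (PMF.uniformOfFintype B).bind fun k =>
      (PMF.uniformOfFintype B).map fun k' c => if c then k' else k := by
  rw [← uniform_map_equiv (Equiv.boolArrowEquivProd B).symm, ← uniform_bind_pair, PMF.map_bind]
  congr 1; funext k
  rw [PMF.map_comp]
  congr 1

theorem uniform_map_fst {α β : Type} [Fintype α] [Nonempty α] [Fintype β] [Nonempty β] :
    (PMF.uniformOfFintype (α × β)).map Prod.fst = PMF.uniformOfFintype α := by
  rw [← uniform_bind_pair, PMF.map_bind]
  simp only [PMF.map_comp, Function.comp_def]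
  have : ∀ x : α, (PMF.uniformOfFintype β).map (fun _ => x) = PMF.pure x := fun x =>
    PMF.map_const _ x
  simp only [this]
  exact PMF.bind_pure _

theorem sampleAll_uniform {α : Type} [Fintype α] [Nonempty α] (m : ℕ) :
    (sampleAll fun _ : Fin m => PMF.uniformOfFintype α) = PMF.uniformOfFintype (Fin m → α) := by
  ext y
  rw [sampleAll_apply]
  simp [ENNReal.inv_pow]

/-- A uniform function takes independent uniform values at distinct points. -/
theorem uniform_map_comp {A B ι : Type} [Fintype A] [DecidableEq A] [Fintype B] [Nonempty B]
    [Fintype ι] [DecidableEq ι] (pts : ι → A) (h : Function.Injective pts) :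
    ((PMF.uniformOfFintype (A → B)).map fun f t => f (pts t)) =
      PMF.uniformOfFintype (ι → B) := by
  classical
  -- A uniform function is a pair of independent uniform functions, on the points and elsewhere.
  let e1 := Equiv.piEquivPiSubtypeProd (fun x => x ∈ Set.range pts) (fun _ : A => B)
  let e2 : ({x // x ∈ Set.range pts} → B) ≃ (ι → B) :=
    (Equiv.ofInjective pts h).symm.arrowCongr (Equiv.refl B)
  have h1 : (fun (f : A → B) t => f (pts t)) = e2 ∘ Prod.fst ∘ e1 := by
    funext f t
    simp [e1, e2, Equiv.arrowCongr]
  rw [h1, ← PMF.map_comp, ← PMF.map_comp, uniform_map_equiv e1, uniform_map_fst,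
    uniform_map_equiv e2]

/-- Coordinates outside of `S` may be resampled. -/
theorem uniform_merge {ι B : Type} [Fintype ι] [DecidableEq ι] [Fintype B] [Nonempty B]
    (S : Finset ι) :
    ((PMF.uniformOfFintype (ι → B)).bind fun r => (PMF.uniformOfFintype (ι → B)).map
      fun r' j => if j ∈ S then r j else r' j) = PMF.uniformOfFintype (ι → B) := by
  -- Exchanging the coordinates outside of `S` is an involution on pairs.
  let e : (ι → B) × (ι → B) ≃ (ι → B) × (ι → B) :=
    { toFun := fun p => (fun j => if j ∈ S then p.1 j else p.2 j,
        fun j => if j ∈ S then p.2 j else p.1 j)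
      invFun := fun p => (fun j => if j ∈ S then p.1 j else p.2 j,
        fun j => if j ∈ S then p.2 j else p.1 j)
      left_inv := fun p => by
        ext j <;> by_cases hj : j ∈ S <;> simp [hj]
      right_inv := fun p => by
        ext j <;> by_cases hj : j ∈ S <;> simp [hj] }
  have h := uniform_map_fst (α := ι → B) (β := ι → B)
  rw [← uniform_map_equiv e, ← uniform_bind_pair] at h
  simp only [PMF.map_bind, PMF.map_comp] at h
  exact h

namespace OracleEfficient

variable {P : Type} {size : P → ℕ} {a b α : P → Type} [∀ i, BitRep (α i)]

theorem uniform_pi {β : P → Type} [∀ i, BitRep (β i)] [∀ i, Fintype (β i)]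
    [∀ i, Nonempty (β i)] {q : P → ℕ} (hq : PolyBounded size q)
    (h : OracleEfficient size (a := a) (b := b) (α := α)
      (fun i _ _ => PMF.uniformOfFintype (β i))) :
    OracleEfficient size (a := a) (b := b) (α := α)
      (fun i _ _ => PMF.uniformOfFintype (Fin (q i) → β i)) := by
  simp only [← sampleAll_uniform]
  exact sampleAll hq (A := fun i _ _ _ => PMF.uniformOfFintype (β i))
    (h.comap (fun p : Σ i, Fin (q i) => p.1) PolyBounded.self)

theorem uniform_bits {L : P → ℕ} (hL : PolyBounded size L) :
    OracleEfficient size (a := a) (b := b) (α := α)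
      (fun i _ _ => PMF.uniformOfFintype (Bits (L i))) :=
  uniform_pi hL coin

theorem uniform_pair {L : P → ℕ} (hL : PolyBounded size L) :
    OracleEfficient size (a := a) (b := b) (α := α)
      fun i _ _ => PMF.uniformOfFintype (Bool → Bits (L i)) := by
  have h := map (β := fun i => Fin 2 → Bits (L i)) (γ := fun i => Bool → Bits (L i))
    (f := fun i (_ : α i) (v : Fin 2 → Bits (L i)) c => v (finTwoEquiv.symm c))
    (uniform_pi (size := size) (a := a) (b := b) (PolyBounded.const 2)
      (uniform_bits hL)) fun i => by fun_prop
  refine cast ?_ h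
  congr 1
  funext i O z
  exact uniform_map_equiv (finTwoEquiv.arrowCongr (Equiv.refl (Bits (L i))))

/-- An oracle call on a fixed query. -/
theorem call_const {L : P → ℕ} (x : ∀ i, a i → Bool) :
    OracleEfficient size (a := a) (b := fun i => Fin (L i)) (α := α) (β := fun i => Bits (L i))
      (fun i O _ => O (x i)) := by
  -- The query is fed from two constant wires; the input is not used.
  refine ⟨fun i => .const true (.const false (.call
    (fun k => if x i k then some none else none) (.ret fun k => Sum.inr k.1))),
    PolyBounded.const 3, fun i O y => ?_⟩
  simp only [Circuit.run]
  have h : (fun k => (if x i k then some (none : Option (BitRep.idx (α i))) else none).elim false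
      fun o => o.elim true (BitRep.enc y)) = x i := by
    funext k; cases x i k <;> rfl
  rw [h]
  rfl

end OracleEfficient

/-- The circuits of an oracle algorithm without input and with a one-bit output. -/
theorem OracleEfficient.exists_circuit {P : Type} {size : P → ℕ} {a b : P → Type}
    {A : ∀ i, ((a i → Bool) → PMF (b i → Bool)) → PMF Bool}
    (h : OracleEfficient size (α := fun _ => Unit) (β := fun _ => Bool) fun i O _ => A i O) :
    ∃ c : ∀ i, Circuit (a i) (b i) Unit Empty, PolyBounded size (fun i => (c i).size) ∧
      ∀ i O, ((c i).run O Empty.elim).map (fun out => out ()) = A i O := by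
  obtain ⟨c, hc, hr⟩ := h
  refine ⟨c, hc, fun i O => ?_⟩
  rw [← map_enc_bool (A i O), ← hr i O ()]
  congr 2

/-! ### The building blocks under non-uniform parameters -/

/-- The values of a pseudorandom function at distinct points look like independent uniform
strings. -/
theorem PRF.indist {keyLen inLen outLen : ℕ → ℕ} (F : PRF keyLen inLen outLen)
    (hF : F.Pseudorandom) {P : Type} {size q : P → ℕ} (hq : PolyBounded size q)
    (pts : ∀ i, Fin (q i) → Bits (inLen (size i))) (hpts : ∀ i, Function.Injective (pts i)) :
    Indist size
      (fun i => (PMF.uniformOfFintype (Bits (keyLen (size i)))).map fun k t =>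
        F.eval (size i) k (pts i t))
      (fun i => PMF.uniformOfFintype (Fin (q i) → Bits (outLen (size i)))) := by
  intro D hD
  have hA : OracleEfficient size (a := fun i => Fin (inLen (size i)))
      (b := fun i => Fin (outLen (size i))) (α := fun _ => Unit)
      (fun i O _ => (sampleAll fun t => O (pts i t)).bind (D i)) :=
    (OracleEfficient.sampleAll hq (β := fun i => Bits (outLen (size i)))
      (A := fun i t O _ => O (pts i t))
      (OracleEfficient.call_const fun p : Σ i, Fin (q i) => pts p.1 p.2)).bind
      (B := fun i _ _ => D i) (hD.oracleEfficient.precomp fun i => Wire.snd)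
  obtain ⟨c, ⟨p, hc⟩, hr⟩ := hA.exists_circuit
  obtain ⟨ε, hε, hb⟩ := Negligible.uniform
    (C := fun n => Circuit (Fin (inLen n)) (Fin (outLen n)) Unit Empty)
    (fun n A => |prTrue ((PMF.uniformOfFintype (Bits (keyLen n))).bind fun k =>
          (A.run (fun x => PMF.pure (F.eval n k x)) Empty.elim).map fun out => out ()) -
       prTrue ((PMF.uniformOfFintype (Bits (inLen n) → Bits (outLen n))).bind fun f =>
          (A.run (fun x => PMF.pure (f x)) Empty.elim).map fun out => out ())|)
    (fun n c => c.size) (fun n c => abs_prTrue_sub_le_one _ _)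
    (fun n => .const true (.ret fun _ => none)) (fun n => le_rfl)
    (fun n => abs_nonneg _) (fun A hA => hF A hA) p
  refine ⟨ε, hε, fun i => ?_⟩
  have h1 := hb (size i) (c i) (hc i)
  simp only [hr, sampleAll_pure, PMF.pure_bind] at h1
  dsimp only
  rw [← uniform_map_comp (B := Bits (outLen (size i))) (pts i) (hpts i), PMF.bind_map,
    PMF.bind_map]
  exact h1

/-- Two lists of messages, all encrypted under one key, are indistinguishable. -/
theorem SymEnc.indist {keyLen msgLen : ℕ → ℕ} (E : SymEnc keyLen msgLen) (hE : E.IndCPA)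
    {P : Type} {size q : P → ℕ} (hq : PolyBounded size q)
    (w w' : ∀ i, Fin (q i) → Bits (msgLen (size i))) :
    Indist size
      (fun i => (PMF.uniformOfFintype (Bits (keyLen (size i)))).bind fun k =>
        sampleAll fun t => E.enc (size i) k (w i t))
      (fun i => (PMF.uniformOfFintype (Bits (keyLen (size i)))).bind fun k =>
        sampleAll fun t => E.enc (size i) k (w' i t)) := by
  intro D hD
  have hA : OracleEfficient size (a := fun i => Fin (msgLen (size i)) ⊕ Fin (msgLen (size i)))
      (b := fun i => Fin (E.ctLen (size i))) (α := fun _ => Unit)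
      (fun i O _ => (sampleAll fun t => O (Sum.elim (w i t) (w' i t))).bind (D i)) :=
    (OracleEfficient.sampleAll hq (β := fun i => Bits (E.ctLen (size i)))
      (A := fun i t O _ => O (Sum.elim (w i t) (w' i t)))
      (OracleEfficient.call_const fun p : Σ i, Fin (q i) =>
        Sum.elim (w p.1 p.2) (w' p.1 p.2))).bind
      (B := fun i _ _ => D i) (hD.oracleEfficient.precomp fun i => Wire.snd)
  obtain ⟨c, ⟨p, hc⟩, hr⟩ := hA.exists_circuit
  obtain ⟨ε, hε, hb⟩ := Negligible.uniform
    (C := fun n => Circuit (Fin (msgLen n) ⊕ Fin (msgLen n)) (Fin (E.ctLen n)) Unit Empty)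
    (fun n A => |prTrue ((PMF.uniformOfFintype (Bits (keyLen n))).bind fun k =>
          (A.run (E.lrOracle n k false) Empty.elim).map fun out => out ()) -
       prTrue ((PMF.uniformOfFintype (Bits (keyLen n))).bind fun k =>
          (A.run (E.lrOracle n k true) Empty.elim).map fun out => out ())|)
    (fun n c => c.size) (fun n c => abs_prTrue_sub_le_one _ _)
    (fun n => .const true (.ret fun _ => none)) (fun n => le_rfl)
    (fun n => abs_nonneg _) (fun A hA => hE A hA) p
  refine ⟨ε, hε, fun i => ?_⟩
  have h1 := hb (size i) (c i) (hc i)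
  simp only [hr] at h1
  rw [PMF.bind_bind, PMF.bind_bind]
  exact h1

/-- Wrong keys are rejected with a bound that is uniform in the message. -/
theorem SymEnc.exists_reject_bound {keyLen msgLen : ℕ → ℕ} (E : SymEnc keyLen msgLen)
    (hE : E.RejectsWrongKey) : ∃ ε, Negligible ε ∧ ∀ n w,
      prTrue ((PMF.uniformOfFintype (Bits (keyLen n))).bind fun k =>
      (PMF.uniformOfFintype (Bits (keyLen n))).bind fun k' =>
        (E.enc n k w).map fun c => (E.dec n k' c).isSome) ≤ ε n := by
  obtain ⟨ε, hε, hb⟩ := Negligible.uniform (C := fun n => Bits (msgLen n))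
    (fun n w => prTrue ((PMF.uniformOfFintype (Bits (keyLen n))).bind fun k =>
      (PMF.uniformOfFintype (Bits (keyLen n))).bind fun k' =>
        (E.enc n k w).map fun c => (E.dec n k' c).isSome))
    (fun _ _ => 0) (fun n c => prTrue_le_one _) (fun n _ => false) (fun n => Nat.zero_le _)
    (fun n => prTrue_nonneg _) (fun w _ => hE w) 0
  exact ⟨ε, hε, fun n w => hb n w (Nat.zero_le _)⟩

namespace NIKE

variable {M U : ℕ} (K : NIKE M U)

/-- The key of a group depends only on the coins of its members. -/
theorem sharedKey_congr (n : ℕ) (params : Bits (K.paramLen n)) {r r' : Fin U → Bits (K.coinLen n)}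
    {S : Finset (Fin U)} {i : Fin U} (hi : i ∈ S) (h : ∀ j ∈ S, r j = r' j) :
    K.sharedKey n params r S i = K.sharedKey n params r' S i := by
  have h1 : (fun j : S => K.pk n params r j) = fun j : S => K.pk n params r' j := by
    funext j
    simp only [pk, h j j.2]
  simp only [sharedKey, h1, sk, h i hi]

/-- What users in `C` see of the key exchange: parameters, public keys and their own coins. -/
abbrev CoinView (C : Finset (Fin U)) (n : ℕ) : Type :=
  Bits (K.paramLen n) × (Fin U → Bits (K.pkLen n)) × (C → Bits (K.coinLen n))

/-- The view of the users in `C` together with the key of `S`, computed from a challenge of the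
security game when the users outside of `S` are given the coins `r'` instead of their own. -/
noncomputable def resample (S C : Finset (Fin U)) (n : ℕ) (r' : Fin U → Bits (K.coinLen n))
    (z : Bits (K.paramLen n) × (Fin U → Bits (K.pkLen n)) ×
      ({j : Fin U // j ∉ S} → Bits (K.skLen n)) × Bits (K.keyLen n)) :
    PMF (K.CoinView C n × Bits (K.keyLen n)) :=
  (sampleAll fun j => if j ∈ S then PMF.pure (z.2.1 j) else
    (PMF.pure (K.publish n z.1 j (r' j))).map Prod.snd).map fun pk =>
      ((z.1, pk, fun j => r' j), z.2.2.2)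

/-- On an honest challenge, the users outside of `S` have the coins `r'` and the members of `S` those
of the challenge. -/
theorem resample_eq (S C : Finset (Fin U)) (hC : Disjoint C S) (n : ℕ)
    (params : Bits (K.paramLen n)) (r r' : Fin U → Bits (K.coinLen n))
    (sk : {j : Fin U // j ∉ S} → Bits (K.skLen n)) (key : Bits (K.keyLen n)) :
    K.resample S C n r' (params, K.pk n params r, sk, key) =
      PMF.pure ((params, K.pk n params (fun j => if j ∈ S then r j else r' j),
        fun j : C => if j.1 ∈ S then r j else r' j), key) := by
  have h1 : (fun j => if j ∈ S then PMF.pure (K.pk n params r j) else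
      (PMF.pure (K.publish n params j (r' j))).map Prod.snd) =
      fun j => PMF.pure (K.pk n params (fun j => if j ∈ S then r j else r' j) j) := by
    funext j
    by_cases hj : j ∈ S
    · simp only [hj, if_true, pk]
    · simp only [hj, if_false, pk, PMF.pure_map]
  have h2 : (fun j : C => if j.1 ∈ S then r j else r' j) = fun j : C => r' j := by
    funext j
    simp [Finset.disjoint_left.1 hC j.2]
  rw [resample]
  simp only []
  rw [h1, sampleAll_pure, PMF.pure_map, h2]

theorem efficient_resample (hEff : K.IsEfficient) (S C : Finset (Fin U)) {P : Type} {size : P → ℕ}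
    (r' : ∀ i, Fin U → Bits (K.coinLen (size i))) :
    Efficient size fun i => K.resample S C (size i) (r' i) := by
  obtain ⟨-, -, -, -, -, -, hpub, -⟩ := hEff
  refine OracleEfficient.efficient ?_
  unfold resample
  refine OracleEfficient.map (OracleEfficient.sampleAll (PolyBounded.const U)
    (β := fun i => Bits (K.pkLen (size i))) ?_) fun i => by fun_prop
  refine OracleEfficient.ite (fun p : Σ _ : P, Fin U => p.2 ∈ S)
    (OracleEfficient.pure fun p => by fun_prop) ?_
  refine OracleEfficient.map (f := fun p _ z => z.2)
    (β := fun p : Σ _ : P, Fin U => Bits (K.skLen (size p.1)) × Bits (K.pkLen (size p.1))) ?_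
    fun p => by fun_prop
  exact OracleEfficient.precomp
    (hpub.comap (size' := fun p : Σ _ : P, Fin U => size p.1) (fun p => size p.1)
      PolyBounded.self).oracleEfficient
    (f := fun (p : Σ _ : P, Fin U) (z : Bits (K.paramLen (size p.1)) ×
      (Fin U → Bits (K.pkLen (size p.1))) × ({j : Fin U // j ∉ S} → Bits (K.skLen (size p.1))) × Bits (K.keyLen (size p.1))) =>
      (z.1, p.2, r' p.1 p.2)) fun p => by fun_prop

/-- Security of the group key against an adversary that sees even the coins of users outside of
the group: they are independent of the key, so that fresh ones can be used in the reduction. -/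
theorem indist (hEff : K.IsEfficient) (hK : K.Secure) (S C : Finset (Fin U)) (hS : S.card ≤ M)
    {u : Fin U} (hu : u ∈ S) (hC : Disjoint C S) {P : Type} (size : P → ℕ) :
    Indist size (α := fun i => K.CoinView C (size i) × Bits (K.keyLen (size i)))
      (fun i => (K.setup (size i)).bind fun params =>
        (PMF.uniformOfFintype (Fin U → Bits (K.coinLen (size i)))).map fun r =>
          ((params, K.pk (size i) params r, fun j => r j), K.sharedKey (size i) params r S u))
      (fun i => (K.setup (size i)).bind fun params =>
        (PMF.uniformOfFintype (Fin U → Bits (K.coinLen (size i)))).bind fun r =>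
          (PMF.uniformOfFintype (Bits (K.keyLen (size i)))).map fun key =>
            ((params, K.pk (size i) params r, fun j => r j), key)) := by
  have h0 := Indist.bind ((hK S hS u hu).indist
      (fun p : Σ i, (Fin U → Bits (K.coinLen (size i))) => size p.1))
      (K.efficient_resample hEff S C (size := fun p : Σ i, (Fin U → Bits (K.coinLen (size i))) =>
        size p.1) fun p => p.2)
  have key := Indist.average (size := size)
    (fun i => PMF.uniformOfFintype (Fin U → Bits (K.coinLen (size i))))
    (X := fun i r' => ((K.setup (size i)).bind fun params =>
        (PMF.uniformOfFintype (Fin U → Bits (K.coinLen (size i)))).map fun r =>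
          (params, K.pk (size i) params r, fun j : {j : Fin U // j ∉ S} => K.sk (size i) params r j,
            K.sharedKey (size i) params r S u)).bind (K.resample S C (size i) r'))
    (Y := fun i r' => ((K.setup (size i)).bind fun params =>
        (PMF.uniformOfFintype (Fin U → Bits (K.coinLen (size i)))).bind fun r =>
          (PMF.uniformOfFintype (Bits (K.keyLen (size i)))).map fun key =>
          (params, K.pk (size i) params r, fun j : {j : Fin U // j ∉ S} => K.sk (size i) params r j,
            key)).bind (K.resample S C (size i) r'))
    h0
  -- The coins may be composed of those of the group and fresh ones for all other users.
  have e : ∀ n (F : ∀ params (r : Fin U → Bits (K.coinLen n)),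
      PMF (K.CoinView C n × Bits (K.keyLen n))),
      ((K.setup n).bind fun params =>
        (PMF.uniformOfFintype (Fin U → Bits (K.coinLen n))).bind fun r => F params r) =
      (PMF.uniformOfFintype (Fin U → Bits (K.coinLen n))).bind fun r' =>
        (K.setup n).bind fun params =>
          (PMF.uniformOfFintype (Fin U → Bits (K.coinLen n))).bind fun r =>
            F params fun j => if j ∈ S then r j else r' j := by
    intro n F
    rw [PMF.bind_comm (PMF.uniformOfFintype (Fin U → Bits (K.coinLen n))) (K.setup n)]
    congr 1; funext params
    conv_lhs => rw [← uniform_merge S]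
    rw [PMF.bind_comm]
    simp only [PMF.bind_bind, PMF.bind_map, Function.comp_def]
  refine key.congr (fun i => ?_) fun i => ?_
  · refine (e (size i) fun params r => PMF.pure ((params, K.pk (size i) params r,
      fun j => r j), K.sharedKey (size i) params r S u)).trans ?_
    simp only [← PMF.bind_pure_comp, Function.comp_def, PMF.bind_bind, PMF.pure_bind,
      K.resample_eq S C hC]
    congr 1; funext r'; congr 1; funext params; congr 1; funext r
    rw [K.sharedKey_congr (size i) params hu (r' := r) fun j hj => if_pos hj]
  · refine (e (size i) fun params r => (PMF.uniformOfFintype (Bits (K.keyLen (size i)))).map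
      fun key => ((params, K.pk (size i) params r, fun j => r j), key)).trans ?_
    simp only [PMF.bind_bind, PMF.bind_map, Function.comp_def, K.resample_eq S C hC]
    rfl

end NIKE

/-! ### Probabilities of events -/

theorem pmf_bind_congr {α β : Type} (p : PMF α) {f g : α → PMF β}
    (h : ∀ a ∈ p.support, f a = g a) : p.bind f = p.bind g := by
  ext b
  simp only [PMF.bind_apply]
  refine tsum_congr fun a => ?_
  by_cases ha : p a = 0
  · simp [ha]
  · rw [h a ((p.mem_support_iff a).2 ha)]

theorem prTrue_bind_le {α : Type} (p : PMF α) (f : α → PMF Bool) {ε : ℝ}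
    (h : ∀ a, prTrue (f a) ≤ ε) : prTrue (p.bind f) ≤ ε := by
  have h1 : ∑' a, (p a).toReal = 1 := by
    rw [← ENNReal.tsum_toReal_eq p.apply_ne_top, p.tsum_coe]; rfl
  rw [prTrue_bind]
  calc _ ≤ ∑' a, (p a).toReal * ε :=
        (summable_mul_prTrue p f).tsum_le_tsum
          (fun a => mul_le_mul_of_nonneg_left (h a) ENNReal.toReal_nonneg)
          ((summable_pmf_toReal p).mul_right ε)
    _ = ε := by rw [tsum_mul_right, h1, one_mul]

theorem toOuterMeasure_bind_le_of_zero {α β : Type} (p : PMF α) (f : α → PMF β) {s : Set β}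
    {t : Set α} (h : ∀ a ∈ p.support, a ∉ t → (f a).toOuterMeasure s = 0) :
    (p.bind f).toOuterMeasure s ≤ p.toOuterMeasure t := by
  rw [PMF.toOuterMeasure_bind_apply, PMF.toOuterMeasure_apply]
  refine ENNReal.tsum_le_tsum fun a => ?_
  by_cases h0 : p a = 0
  · simp [h0]
  by_cases ha : a ∈ t
  · rw [Set.indicator_of_mem ha]
    refine mul_le_of_le_one_right zero_le ?_
    refine (MeasureTheory.OuterMeasure.mono _ (Set.subset_univ s)).trans ?_
    exact ((f a).toOuterMeasure_apply_eq_one_iff _).2 (Set.subset_univ _) |>.le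
  · rw [h a ((p.mem_support_iff a).2 h0) ha, mul_zero]
    exact zero_le

/-- A union bound, passed through a first random choice. -/
theorem toOuterMeasure_bind_le_sum {α β ι : Type} [Fintype ι] (p : PMF α) (f : α → PMF β)
    {s : Set β} (B : ι → α → PMF Bool)
    (h : ∀ a ∈ p.support, (f a).toOuterMeasure s ≤ ∑ i, B i a true) :
    (p.bind f).toOuterMeasure s ≤ ∑ i, (p.bind (B i)) true := by
  simp only [PMF.toOuterMeasure_bind_apply, PMF.bind_apply]
  rw [← Summable.tsum_finsetSum fun _ _ => ENNReal.summable]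
  refine ENNReal.tsum_le_tsum fun a => ?_
  rw [← Finset.mul_sum]
  by_cases h0 : p a = 0
  · simp [h0]
  · exact mul_le_mul_right (h a ((p.mem_support_iff a).2 h0)) _

theorem sampleAll_map_apply {α : Type} {m : ℕ} (p : Fin m → PMF α) (t : Fin m) :
    (sampleAll p).map (fun y => y t) = p t := by
  induction m with
  | zero => exact t.elim0
  | succ m ih =>
    rw [sampleAll]
    simp only [PMF.map_bind, PMF.map_comp, Function.comp_def]
    refine Fin.cases ?_ (fun t => ?_) t
    · simp only [Fin.cons_zero]
      have : ∀ x : α, (sampleAll fun i => p i.succ).map (fun _ => x) = PMF.pure x := fun x =>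
        PMF.map_const _ x
      simp only [this]
      exact PMF.bind_pure _
    · simp only [Fin.cons_succ]
      rw [PMF.bind_const, ih]

theorem toOuterMeasure_sampleAll_le {α : Type} {m : ℕ} (p : Fin m → PMF α)
    (s : Fin m → Set α) :
    (sampleAll p).toOuterMeasure {y | ∃ t, y t ∈ s t} ≤ ∑ t, (p t).toOuterMeasure (s t) := by
  have h : {y : Fin m → α | ∃ t, y t ∈ s t} = ⋃ t, (fun y => y t) ⁻¹' s t := by
    ext y; simp
  rw [h]
  refine (MeasureTheory.measure_iUnion_le _).trans ?_
  rw [tsum_fintype]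
  refine Finset.sum_le_sum fun t _ => ?_
  rw [← PMF.toOuterMeasure_map_apply, sampleAll_map_apply]

theorem sampleAll_comm {α : Type} {m k : ℕ} (p : Fin m → Fin k → PMF α) :
    (sampleAll fun i => sampleAll fun j => p i j) =
      (sampleAll fun j => sampleAll fun i => p i j).map fun y i j => y j i := by
  ext y
  rw [PMF.map_apply, tsum_eq_single fun j i => y i j]
  · simp only [if_true, sampleAll_apply]
    exact Finset.prod_comm
  · intro z hz
    rw [if_neg]
    rintro rfl
    exact hz rfl

/-! ### Keys derived from the group key -/

namespace Setting

variable {M N m : ℕ} (P : Setting M N m)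

theorem node_nG_mem_group (hG : P.nG ∈ P.keyNodes) : P.node P.nG ∈ P.group :=
  Finset.mem_union_right _ (Finset.mem_image_of_mem _ hG)

theorem party_mem_group (j : Fin N) : P.party j ∈ P.group :=
  Finset.mem_union_left _ (Finset.mem_image_of_mem _ (Finset.mem_univ j))

theorem card_group_le (hM : N + P.keyNodes.card ≤ M) : P.group.card ≤ M := by
  refine (Finset.card_union_le _ _).trans (le_trans (add_le_add ?_ Finset.card_image_le) hM)
  exact Finset.card_image_le.trans (by simp)

theorem disjoint_nodes_group {C : Finset (Fin m)} (hC : Disjoint C P.keyNodes) :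
    Disjoint (C.image P.node) P.group := by
  rw [Finset.disjoint_left]
  intro u hu hu'
  obtain ⟨j, hj, rfl⟩ := Finset.mem_image.1 hu
  rcases Finset.mem_union.1 hu' with h | h
  · obtain ⟨i, -, hi⟩ := Finset.mem_image.1 h
    have := congrArg Fin.val hi
    simp only [party, node, Fin.val_castAdd, Fin.val_natAdd] at this
    omega
  · obtain ⟨i, hi, hij⟩ := Finset.mem_image.1 h
    have : i = j := Fin.natAdd_injective _ _ hij
    exact Finset.disjoint_left.1 hC hj (this ▸ hi)

section

variable {J : Type} {size : J → ℕ}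

/-- Values of the pseudorandom function under the group key look like independent uniform strings
to users outside of the group. -/
theorem indist_groupKey (hG : P.nG ∈ P.keyNodes) (hM : N + P.keyNodes.card ≤ M)
    (hEff : P.IsEfficient) (hNike : P.nike.Secure) (hPRF : P.prf.Pseudorandom)
    {C : Finset (Fin (N + m))} (hC : Disjoint C P.group) {q : J → ℕ}
    (hq : PolyBounded size q)
    (pts : ∀ i, Fin (q i) → Bits (1 + P.inputLen (size i) + size i))
    (hpts : ∀ i, Function.Injective (pts i)) :
    Indist size (α := fun i => P.KeyView C (size i) × (Fin (q i) → P.EncKey (size i)))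
      (fun i => (P.nike.setup (size i)).bind fun params =>
        (PMF.uniformOfFintype (Fin (N + m) → P.Coins (size i))).map fun coins =>
          (P.keyView C (size i) params coins, fun t => P.prf.eval (size i)
            (P.nike.sharedKey (size i) params coins P.group (P.node P.nG)) (pts i t)))
      (fun i => (P.nike.setup (size i)).bind fun params =>
        (PMF.uniformOfFintype (Fin (N + m) → P.Coins (size i))).bind fun coins =>
          (PMF.uniformOfFintype (Fin (q i) → P.EncKey (size i))).map fun τ =>
            (P.keyView C (size i) params coins, τ)) := by
  -- Replace the group key by a uniform key, then the function values by uniform strings.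
  have h1 := P.nike.indist hEff.2.2.1 hNike P.group C (P.card_group_le hM)
    (P.node_nG_mem_group hG) hC size
  have hA : Efficient size (α := fun i => P.KeyView C (size i) × Bits (P.nike.keyLen (size i)))
      (β := fun i => P.KeyView C (size i) × (Fin (q i) → P.EncKey (size i)))
      (fun i z => (sampleAll fun t => PMF.pure (P.prf.eval (size i) z.2 (pts i t))).map
        fun τ => (z.1, τ)) := by
    refine OracleEfficient.efficient (OracleEfficient.map (OracleEfficient.sampleAll hq
      (β := fun i => P.EncKey (size i)) ?_) fun i => by fun_prop)
    exact OracleEfficient.precomp (hEff.2.2.2.1.2.2.2.comap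
      (size' := fun p : Σ i, Fin (q i) => size p.1) (fun p => size p.1)
      PolyBounded.self).oracleEfficient
      (f := fun (p : Σ i, Fin (q i)) (z : P.KeyView C (size p.1) ×
        Bits (P.nike.keyLen (size p.1))) => (z.2, pts p.1 p.2)) fun p => by fun_prop
  refine ((h1.bind hA).congr (fun i => ?_) fun i => rfl).trans ?_
  · simp only [PMF.bind_bind, PMF.bind_map, sampleAll_pure, PMF.pure_map, Function.comp_def]
    rfl
  · simp only [PMF.bind_bind, PMF.bind_map, sampleAll_pure, PMF.pure_map, Function.comp_def]
    refine Indist.average _ (Indist.average _ ?_)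
    have h2 := PRF.indist P.prf hPRF
      (size := fun p : Σ p : Σ i, P.Params (size i), Fin (N + m) → P.Coins (size p.1) =>
        size p.1.1) (q := fun p => q p.1.1) (hq.comap
        fun p : (Σ p : Σ i, P.Params (size i), Fin (N + m) → P.Coins (size p.1)) => p.1.1)
      (fun p => pts p.1.1) fun p => hpts p.1.1
    refine (h2.map (f := fun p τ => (P.keyView C (size p.1.1) p.1.2 p.2, τ))
      fun p => by fun_prop).congr (fun p => ?_) fun p => rfl
    rw [PMF.map_comp]
    rfl

end

/-! ### Correctness of the computations -/

/-- Encryptions of `w` under `k` and of `w'` under `k'`, in random order. -/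
noncomputable def mixEntry (n : ℕ) (k : P.EncKey n) (w : Bits (P.labelLen n)) (k' : P.EncKey n)
    (w' : Bits (P.labelLen n)) : PMF (P.Cipher n × P.Cipher n) :=
  (P.enc.enc n k w).bind fun c => (P.enc.enc n k' w').bind fun c' =>
    (PMF.uniformOfFintype Bool).map fun swap => if swap then (c', c) else (c, c')

theorem mixEntry_comm (n : ℕ) (k : P.EncKey n) (w : Bits (P.labelLen n)) (k' : P.EncKey n)
    (w' : Bits (P.labelLen n)) : P.mixEntry n k w k' w' = P.mixEntry n k' w' k w := by
  rw [mixEntry, PMF.bind_comm, mixEntry]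
  congr 1; funext c; congr 1; funext c'
  conv_lhs => rw [← uniform_map_equiv Equiv.boolNot, PMF.map_comp]
  congr 1; funext b
  cases b <;> rfl

/-- As the order is random, the entry of the wire value `b` may come first. -/
theorem pivotEntry_eq (n : ℕ) (s : Bool → P.EncKey n) (w : Bool → Bits (P.labelLen n)) (b : Bool) :
    P.pivotEntry n s w = P.mixEntry n (s b) (w b) (s !b) (w !b) := by
  cases b
  · rfl
  · rw [mixEntry_comm]; rfl

/-- By correctness, the entry is opened to the right label unless the other ciphertext is accepted,
whatever the order of the two. -/
theorem mixEntry_open_le (hEnc : P.enc.Correct) (n : ℕ) (k : P.EncKey n)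
    (w : Bits (P.labelLen n)) (k' : P.EncKey n) (w' : Bits (P.labelLen n)) :
    (P.mixEntry n k w k' w').toOuterMeasure {c | P.openEntry n k c ≠ w} ≤
      ((P.enc.enc n k' w').map fun c => (P.enc.dec n k c).isSome) true := by
  have h : ((P.enc.enc n k' w').map fun c => (P.enc.dec n k c).isSome) true =
      (P.enc.enc n k' w').toOuterMeasure {c | (P.enc.dec n k c).isSome} := by
    rw [← PMF.toOuterMeasure_apply_singleton, PMF.toOuterMeasure_map_apply]
    rfl
  rw [h, mixEntry, PMF.bind_comm]
  refine toOuterMeasure_bind_le_of_zero _ _ fun c' _ hc' => ?_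
  rw [PMF.toOuterMeasure_apply_eq_zero_iff, Set.disjoint_left]
  intro z hz hne
  simp only [PMF.mem_support_bind_iff, PMF.mem_support_map_iff] at hz
  obtain ⟨c, hc, b, -, rfl⟩ := hz
  have h1 := hEnc n k w c hc
  have h2 : P.enc.dec n k c' = none := by simpa using hc'
  apply hne
  cases b <;> simp [openEntry, h1, h2]

theorem prfBlock_injective (n : ℕ) {c c' : Bool} {l l' : Fin (P.inputLen n)} {ν ν' : P.Nonce n}
    (h : P.prfBlock n c l ν = P.prfBlock n c' l' ν') : c = c' ∧ l = l' ∧ ν = ν' := by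
  refine ⟨?_, ?_, funext fun i => ?_⟩
  · simpa [prfBlock, Fin.append_left] using
      congrFun h (Fin.castAdd n (Fin.castAdd (P.inputLen n) (0 : Fin 1)))
  · have := congrFun h (Fin.castAdd n (Fin.natAdd 1 l))
    simpa [prfBlock, Fin.append_left, Fin.append_right] using this
  · simpa [prfBlock, Fin.append_right] using congrFun h (Fin.natAdd (1 + P.inputLen n) i)

/-- A label encrypted under the key of one value of a wire is rejected under the key of the other
value. -/
theorem exists_wrongKey_bound (hG : P.nG ∈ P.keyNodes) (hM : N + P.keyNodes.card ≤ M)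
    (hEff : P.IsEfficient) (hNike : P.nike.Secure) (hPRF : P.prf.Pseudorandom)
    (hRej : P.enc.RejectsWrongKey) :
    ∃ ε, Negligible ε ∧ ∀ n l b (ν : P.Nonce n) w,
      prTrue ((P.nike.setup n).bind fun params =>
        (PMF.uniformOfFintype (Fin (N + m) → P.Coins n)).bind fun coins =>
          (P.enc.enc n (P.bitKey n
            (P.nike.sharedKey n params coins P.group (P.node P.nG)) (!b) l ν) w).map fun c =>
            (P.enc.dec n (P.bitKey n
              (P.nike.sharedKey n params coins P.group (P.node P.nG)) b l ν) c).isSome) ≤ ε n := by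
  -- The keys of both values of the wire may be replaced by two uniform ones; rejection is a test that
  -- sees these keys only. The bound is uniform in the wire, the bit, the nonce and the label, which
  -- are part of the index.
  let J : Type := Σ n, Fin (P.inputLen n) × Bool × P.Nonce n × Bits (P.labelLen n)
  let size : J → ℕ := fun p => p.1
  have h1 := P.indist_groupKey hG hM hEff hNike hPRF (C := ∅) (Finset.disjoint_empty_left _)
    (size := size) (q := fun _ => 2) (PolyBounded.const 2)
    (fun p t => P.prfBlock p.1 (if t = 0 then p.2.2.1 else !p.2.2.1) p.2.1 p.2.2.2.1)
    (fun p t t' h => by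
      have h2 : ∀ (b : Bool) (t t' : Fin 2),
          ((if t = 0 then b else !b) = if t' = 0 then b else !b) → t = t' := by decide
      exact h2 _ _ _ (P.prfBlock_injective _ h).1)
  obtain ⟨ε, hε, h1⟩ := h1 (fun p z => (P.enc.enc p.1 (z.2 1) p.2.2.2.2).bind fun c =>
      (PMF.pure (P.enc.dec p.1 (z.2 0) c)).map Option.isSome) <| by
    refine OracleEfficient.efficient ?_
    refine OracleEfficient.bind (β := fun p : J => P.Cipher p.1)
      (OracleEfficient.precomp (hEff.2.2.2.2.1.2.2.2.1.comap (size' := size) size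
        PolyBounded.self).oracleEfficient
        (f := fun (p : J) (z : P.KeyView ∅ p.1 × (Fin 2 → P.EncKey p.1)) => (z.2 1, p.2.2.2.2))
        fun p => by fun_prop) ?_
    refine OracleEfficient.map (β := fun p : J => Option (Bits (P.labelLen p.1)))
      (f := fun p _ o => o.isSome)
      (OracleEfficient.precomp (hEff.2.2.2.2.1.2.2.2.2.comap (size' := size) size
        PolyBounded.self).oracleEfficient
        (f := fun (p : J) (z : (P.KeyView ∅ p.1 × (Fin 2 → P.EncKey p.1)) × P.Cipher p.1) =>
          (z.1.2 0, z.2)) fun p => by fun_prop) fun p => Wire.isSome.comp Wire.snd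
  obtain ⟨δ, hδ, h2⟩ := P.enc.exists_reject_bound hRej
  refine ⟨_, hε.add hδ, fun n l b ν w => ?_⟩
  have h3 := h1 ⟨n, l, b, ν, w⟩
  have h4 := h2 n w
  simp only [PMF.bind_bind, PMF.bind_map, PMF.pure_map, Function.comp_def] at h3
  have h5 : prTrue ((P.nike.setup n).bind fun params =>
      (PMF.uniformOfFintype (Fin (N + m) → P.Coins n)).bind fun coins =>
        (PMF.uniformOfFintype (Fin 2 → P.EncKey n)).bind fun τ =>
          (P.enc.enc n (τ 1) w).bind fun c => PMF.pure (P.enc.dec n (τ 0) c).isSome) ≤ δ n := by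
    simp only [PMF.bind_const]
    rw [← sampleAll_uniform]
    simp only [sampleAll, PMF.bind_bind, PMF.pure_map, PMF.pure_bind, PMF.map_bind]
    rw [PMF.bind_comm]
    exact h4
  have h6 := (le_abs_self _).trans h3
  have h7 : ∀ a b c d : ℝ, a - b ≤ c → b ≤ d → a ≤ c + d := fun a b c d _ _ => by linarith
  exact h7 _ _ _ _ h6 h5

/-- A wrong result requires that, at some wire, the ciphertext of the other wire value is accepted
under the stored key. -/
theorem seccomp_wrong_le (hCompile : P.CompileCorrect) (hEnc : P.enc.Correct)
    (hGarb : P.garbling.Correct) (n : ℕ) (k : Bits (P.nike.keyLen n)) (nonce : Fin N → P.Nonce n)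
    (x : Fin N → P.Input n) (req : P.Request n) :
    (P.seccomp n k nonce (fun i l => P.bitKey n k (x i l) l (nonce i)) req).toOuterMeasure
        {c | c.2 ≠ P.contract n req.2 (x req.1) x} ≤
      ∑ w : Fin N × Fin (P.inputLen n), ((P.garbling.Gb n (P.compile n req.1 req.2)).bind fun g =>
        (P.enc.enc n (P.bitKey n k (!x w.1 w.2) w.2 (nonce w.1)) (g.2.1 w (!x w.1 w.2))).map
          fun c => (P.enc.dec n (P.bitKey n k (x w.1 w.2) w.2 (nonce w.1)) c).isSome) true := by
  rw [seccomp]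
  refine toOuterMeasure_bind_le_sum _ _ (fun w g => _) fun g hg => ?_
  rw [PMF.toOuterMeasure_map_apply]
  -- If every entry opens to the label of its wire, the garbled circuit computes the contract.
  refine (MeasureTheory.OuterMeasure.mono _ (show _ ⊆ {piv : P.Pivot n | ∃ j, piv j ∈
    {row | ∃ l, row l ∈ {c | P.openEntry n (P.bitKey n k (x j l) l (nonce j)) c ≠
      g.2.1 (j, l) (x j l)}}} from ?_)).trans ?_
  · intro piv hpiv
    by_contra hcon
    simp only [Set.mem_ofPred_eq, not_exists, not_not] at hcon
    apply hpiv
    have h1 : (fun w : Fin N × Fin (P.inputLen n) => P.openEntry n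
        (P.bitKey n k (x w.1 w.2) w.2 (nonce w.1)) (piv w.1 w.2)) =
        En g.2.1 (fun w => x w.1 w.2) := funext fun w => hcon w.1 w.2
    dsimp only
    rw [h1, hGarb n _ g hg]
    exact hCompile n _ _ _
  · refine (toOuterMeasure_sampleAll_le _ _).trans ?_
    rw [Fintype.sum_prod_type]
    refine Finset.sum_le_sum fun j _ => (toOuterMeasure_sampleAll_le _ _).trans ?_
    refine Finset.sum_le_sum fun l _ => ?_
    rw [P.pivotEntry_eq n _ _ (x j l)]
    exact P.mixEntry_open_le hEnc n _ _ _ _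

theorem sharedKey_party (hG : P.nG ∈ P.keyNodes) (hM : N + P.keyNodes.card ≤ M)
    (hK : P.nike.Correct) (n : ℕ) {params : P.Params n} (h : params ∈ (P.nike.setup n).support)
    (coins : Fin (N + m) → P.Coins n) (i : Fin N) :
    P.nike.sharedKey n params coins P.group (P.party i) =
      P.nike.sharedKey n params coins P.group (P.node P.nG) :=
  hK n params h coins P.group (P.card_group_le hM) _ (P.party_mem_group i) _
    (P.node_nG_mem_group hG)

theorem execute_wrong_le (hG : P.nG ∈ P.keyNodes) (hM : N + P.keyNodes.card ≤ M)
    (hK : P.nike.Correct) (hCompile : P.CompileCorrect) (hEnc : P.enc.Correct)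
    (hGarb : P.garbling.Correct) (n q : ℕ) (x : Fin N → P.Input n) (req : Fin q → P.Request n) :
    (P.execute n q x req).toOuterMeasure
        {T | (fun t => (T.comp t).2) ≠ P.idealResult n q x req} ≤
      ∑ i : Fin q × (Fin N × Fin (P.inputLen n)), ((P.nike.setup n).bind fun params =>
        (PMF.uniformOfFintype (Fin (N + m) → P.Coins n)).bind fun coins =>
        (PMF.uniformOfFintype (Fin N → P.Nonce n)).bind fun nonce =>
        (P.garbling.Gb n (P.compile n (req i.1).1 (req i.1).2)).bind fun g =>
        (P.enc.enc n (P.bitKey n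
            (P.nike.sharedKey n params coins P.group (P.node P.nG))
            (!x i.2.1 i.2.2) i.2.2 (nonce i.2.1))
          (g.2.1 i.2 (!x i.2.1 i.2.2))).map fun c => (P.enc.dec n (P.bitKey n
            (P.nike.sharedKey n params coins P.group (P.node P.nG))
            (x i.2.1 i.2.2) i.2.2 (nonce i.2.1)) c).isSome) true := by
  refine toOuterMeasure_bind_le_sum _ _ (fun i params => _) fun params hparams => ?_
  refine toOuterMeasure_bind_le_sum _ _ (fun i coins => _) fun coins _ => ?_
  refine toOuterMeasure_bind_le_sum _ _ (fun i nonce => _) fun nonce _ => ?_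
  simp only [P.sharedKey_party hG hM hK n hparams]
  rw [PMF.toOuterMeasure_map_apply]
  refine (MeasureTheory.OuterMeasure.mono _ (show _ ⊆ {comp : Fin q → P.Computation n |
    ∃ t, comp t ∈ {c | c.2 ≠ P.contract n (req t).2 (x (req t).1) x}} from ?_)).trans ?_
  · intro comp hcomp
    by_contra hcon
    simp only [Set.mem_ofPred_eq, not_exists, not_not] at hcon
    exact hcomp (funext hcon)
  · refine (toOuterMeasure_sampleAll_le _ _).trans ?_
    rw [Fintype.sum_prod_type]
    exact Finset.sum_le_sum fun t _ => P.seccomp_wrong_le hCompile hEnc hGarb n _ nonce x (req t)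

/-- The results of all computations are correct except with negligible probability. -/
theorem exists_execute_bound (hG : P.nG ∈ P.keyNodes) (hM : N + P.keyNodes.card ≤ M)
    (hEff : P.IsEfficient) (hCompile : P.CompileCorrect) (hK : P.nike.Correct)
    (hNike : P.nike.Secure) (hPRF : P.prf.Pseudorandom) (hEnc : P.enc.Correct)
    (hRej : P.enc.RejectsWrongKey) (hGarb : P.garbling.Correct)
    {Q : ℕ → ℕ} (hQ : PolyBounded id Q) (x : ∀ n, Fin N → P.Input n)
    (req : ∀ n, Fin (Q n) → P.Request n) :
    ∃ δ, Negligible δ ∧ ∀ n, ((P.execute n (Q n) (x n) (req n)).toOuterMeasure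
      {T | (fun t => (T.comp t).2) ≠ P.idealResult n (Q n) (x n) (req n)}).toReal ≤ δ n := by
  obtain ⟨ε, hε, hb⟩ := P.exists_wrongKey_bound hG hM hEff hNike hPRF hRej
  refine ⟨_, hε.poly_mul (hQ.mul ((PolyBounded.const N).mul hEff.1)), fun n => ?_⟩
  have h1 := P.execute_wrong_le hG hM hK hCompile hEnc hGarb n (Q n) (x n) (req n)
  refine (ENNReal.toReal_mono (ENNReal.sum_ne_top.2 fun i _ => PMF.apply_ne_top _ _) h1).trans ?_
  rw [ENNReal.toReal_sum fun i _ => PMF.apply_ne_top _ _]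
  refine (Finset.sum_le_sum (g := fun _ => ε n) fun i _ => ?_).trans (le_of_eq (by simp))
  -- The nonces and the garbling are independent of the group key.
  have hcomm : ∀ {A B C D : Type} (a : PMF A) (b : PMF B) (c : PMF C) (d : PMF D)
      (F : A → B → C → D → PMF Bool),
      (a.bind fun u => b.bind fun v => c.bind fun w => d.bind fun z => F u v w z) =
      c.bind fun w => d.bind fun z => a.bind fun u => b.bind fun v => F u v w z := by
    intro A B C D a b c d F
    simp only [PMF.bind_comm b c, PMF.bind_comm a c, PMF.bind_comm b d, PMF.bind_comm a d]
  rw [hcomm]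
  refine prTrue_bind_le _ _ fun nonce => prTrue_bind_le _ _ fun g => ?_
  have := hb n i.2.2 (x n i.2.1 i.2.2) (nonce i.2.1) (g.2.1 i.2 (!x n i.2.1 i.2.2))
  exact this

end Setting

/-! ### Pivot tables with a distinguished entry -/

/-- Two bit strings in random order. -/
theorem OracleEfficient.randomOrder {J : Type} {size : J → ℕ} {a b α : J → Type}
    [∀ i, BitRep (α i)] {L : J → ℕ} (hL : PolyBounded size L) {u v : ∀ i, α i → Bits (L i)}
    (hu : ∀ i, Wire (u i)) (hv : ∀ i, Wire (v i)) :
    OracleEfficient size (a := a) (b := b) (β := fun i => Bits (L i) × Bits (L i))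
      fun i _ z => (PMF.uniformOfFintype Bool).map fun swap =>
        if swap then (v i z, u i z) else (u i z, v i z) := by
  have h : OracleEfficient size (a := a) (b := b) (α := α) (β := fun i => Bits (L i) × Bits (L i))
      fun i _ z => (PMF.uniformOfFintype Bool).bind fun swap =>
        (PMF.pure (if swap then v i z else u i z)).bind fun y =>
          (PMF.pure (if swap then u i z else v i z)).map fun y' => (y, y') := by
    refine OracleEfficient.bind OracleEfficient.coin ?_
    refine OracleEfficient.bind (β := fun i => Bits (L i))
      (OracleEfficient.muxBits hL (s := fun i (z : α i × Bool) => z.2) (f := fun i z => v i z.1)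
      (g := fun i z => u i z.1) (fun i => by fun_prop) (fun i => (hv i).comp Wire.fst)
      fun i => (hu i).comp Wire.fst) ?_
    exact OracleEfficient.map (β := fun i => Bits (L i))
      (OracleEfficient.muxBits hL (s := fun i (z : (α i × Bool) × Bits (L i)) => z.1.2)
      (f := fun i z => u i z.1.1)
      (g := fun i z => v i z.1.1) (fun i => by fun_prop)
      (fun i => (hu i).comp (Wire.fst.comp Wire.fst))
      fun i => (hv i).comp (Wire.fst.comp Wire.fst)) fun i => by fun_prop
  refine cast ?_ h
  congr 1; funext i O z
  rw [← PMF.bind_pure_comp]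
  congr 1; funext swap
  rw [PMF.pure_bind, PMF.pure_map]
  cases swap <;> rfl

namespace Setting

variable {M N m : ℕ} (P : Setting M N m)

/-- Keys for the two values of every input wire. -/
abbrev KeyTable (n : ℕ) : Type := Fin N → Fin (P.inputLen n) → Bool → P.EncKey n

/-- One label for every input wire. -/
abbrev LabelTable (n : ℕ) : Type := Fin N → Fin (P.inputLen n) → Bits (P.labelLen n)

/-- The pivot table in which the labels `w` are encrypted under the keys at `false` and the labels
`w'` under the keys at `true`. -/
noncomputable def mixPivot (n : ℕ) (p : P.KeyTable n) (w w' : P.LabelTable n) : PMF (P.Pivot n) :=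
  sampleAll fun j => sampleAll fun l => P.mixEntry n (p j l false) (w j l) (p j l true) (w' j l)

/-- The view of the evaluator that has stored the keys of `p` at `false` as encodings and receives
pivot tables with the labels `w` and `w'`. -/
noncomputable def mixView (n q : ℕ) (nonce : Fin N → P.Nonce n) (req : Fin q → P.Request n)
    (gc : Fin q → Bits (P.garbling.gcLen n)) (p : P.KeyTable n)
    (w w' : Fin q → P.LabelTable n) : PMF (P.EvaluatorView n q) :=
  (sampleAll fun t => P.mixPivot n p (w t) (w' t)).map fun piv =>
    (fun j => (fun l => p j l false, nonce j), fun t => (req t, gc t, piv t))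

section Efficiency

variable {J : Type} {size : J → ℕ} {a b α : J → Type} [∀ i, BitRep (α i)] {g : J → ℕ}

theorem efficient_enc (hEff : P.enc.IsEfficient) (hg : PolyBounded size g)
    {k : ∀ i, α i → P.EncKey (g i)} {w : ∀ i, α i → Bits (P.labelLen (g i))}
    (hk : ∀ i, Wire (k i)) (hw : ∀ i, Wire (w i)) :
    OracleEfficient size (a := a) (b := b) (β := fun i => P.Cipher (g i))
      fun i _ z => P.enc.enc (g i) (k i z) (w i z) :=
  OracleEfficient.precomp (hEff.2.2.2.1.comap g hg).oracleEfficient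
    (f := fun i z => (k i z, w i z)) fun i => (hk i).prodMk (hw i)

theorem efficient_mixEntry (hEff : P.enc.IsEfficient) (hg : PolyBounded size g)
    {k k' : ∀ i, α i → P.EncKey (g i)} {w w' : ∀ i, α i → Bits (P.labelLen (g i))}
    (hk : ∀ i, Wire (k i)) (hk' : ∀ i, Wire (k' i)) (hw : ∀ i, Wire (w i))
    (hw' : ∀ i, Wire (w' i)) :
    OracleEfficient size (a := a) (b := b) (β := fun i => P.Cipher (g i) × P.Cipher (g i))
      fun i _ z => P.mixEntry (g i) (k i z) (w i z) (k' i z) (w' i z) := by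
  have hct : PolyBounded size fun i => P.enc.ctLen (g i) := hEff.2.2.1.at_index hg
  simp only [mixEntry]
  refine OracleEfficient.bind (β := fun i => P.Cipher (g i)) (P.efficient_enc hEff hg hk hw) ?_
  refine OracleEfficient.bind (β := fun i => P.Cipher (g i))
    (P.efficient_enc hEff hg (fun i => (hk' i).comp Wire.fst) fun i => (hw' i).comp Wire.fst) ?_
  exact OracleEfficient.randomOrder (L := fun i => P.enc.ctLen (g i))
    (α := fun i => (α i × P.Cipher (g i)) × P.Cipher (g i)) (u := fun i z => z.1.2)
    (v := fun i z => z.2) hct (fun i => by fun_prop) fun i => by fun_prop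

theorem efficient_mixPivot (hℓ : PolyBounded id P.inputLen) (hEff : P.enc.IsEfficient)
    (hg : PolyBounded size g)
    {p : ∀ i, α i → P.KeyTable (g i)} {w w' : ∀ i, α i → P.LabelTable (g i)}
    (hp : ∀ i, Wire (p i)) (hw : ∀ i, Wire (w i)) (hw' : ∀ i, Wire (w' i)) :
    OracleEfficient size (a := a) (b := b) (β := fun i => P.Pivot (g i))
      fun i _ z => P.mixPivot (g i) (p i z) (w i z) (w' i z) := by
  refine OracleEfficient.sampleAll (q := fun _ => N)
    (β := fun i => Fin (P.inputLen (g i)) → P.Cipher (g i) × P.Cipher (g i))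
    (PolyBounded.const N) ?_
  have hg' : PolyBounded (fun p : Σ _ : J, Fin N => size p.1) fun p => g p.1 := hg.comap _
  refine OracleEfficient.sampleAll (P := Σ _ : J, Fin N)
    (β := fun i => P.Cipher (g i.1) × P.Cipher (g i.1)) (hℓ.at_index hg') ?_
  refine P.efficient_mixEntry (J := Σ i : (Σ _ : J, Fin N), Fin (P.inputLen (g i.1))) hEff
    (g := fun i => g i.1.1) (hg'.comap _) (fun i => ?_) (fun i => ?_) (fun i => ?_) fun i => ?_
  · have := hp i.1.1
    fun_prop
  · have := hp i.1.1
    fun_prop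
  · have := hw i.1.1
    fun_prop
  · have := hw' i.1.1
    fun_prop

theorem efficient_mixView (hℓ : PolyBounded id P.inputLen) (hEff : P.enc.IsEfficient)
    (hg : PolyBounded size g) {q : J → ℕ} (hq : PolyBounded size q)
    {nonce : ∀ i, α i → Fin N → P.Nonce (g i)} {req : ∀ i, α i → Fin (q i) → P.Request (g i)}
    {gc : ∀ i, α i → Fin (q i) → Bits (P.garbling.gcLen (g i))}
    {p : ∀ i, α i → P.KeyTable (g i)} {w w' : ∀ i, α i → Fin (q i) → P.LabelTable (g i)}
    (hnonce : ∀ i, Wire (nonce i)) (hreq : ∀ i, Wire (req i)) (hgc : ∀ i, Wire (gc i))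
    (hp : ∀ i, Wire (p i)) (hw : ∀ i, Wire (w i)) (hw' : ∀ i, Wire (w' i)) :
    OracleEfficient size (a := a) (b := b) (β := fun i => P.EvaluatorView (g i) (q i))
      fun i _ z => P.mixView (g i) (q i) (nonce i z) (req i z) (gc i z) (p i z) (w i z)
        (w' i z) := by
  refine OracleEfficient.map (β := fun i => Fin (q i) → P.Pivot (g i))
    (f := fun i z piv => (fun j => (fun l => p i z j l false, nonce i z j),
      fun t => (req i z t, gc i z t, piv t)))
    (OracleEfficient.sampleAll hq (β := fun i => P.Pivot (g i)) ?_) fun i => ?_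
  · refine P.efficient_mixPivot (J := Σ i, Fin (q i)) (g := fun i => g i.1) hℓ hEff (hg.comap _)
      (fun i => hp i.1) (fun i => ?_) fun i => ?_
    · have := hw i.1
      fun_prop
    · have := hw' i.1
      fun_prop
  · have := hnonce i
    have := hreq i
    have := hgc i
    have := hp i
    fun_prop

end Efficiency

/-! ### Replacing the labels of the other wire values -/

/-- The entries of one wire in `q` pivot tables, together with the key of the labels `w`. -/
noncomputable def column (n q : ℕ) (w w' : Fin q → Bits (P.labelLen n)) :
    PMF (P.EncKey n × (Fin q → P.Cipher n × P.Cipher n)) :=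
  (PMF.uniformOfFintype (P.EncKey n)).bind fun k =>
    (PMF.uniformOfFintype (P.EncKey n)).bind fun k' =>
      (sampleAll fun t => P.mixEntry n k (w t) k' (w' t)).map fun c => (k, c)

/-- The pivot tables of all computations, sorted by wires: the keys of different wires are
independent. -/
theorem mixPivots_eq_columns (n q : ℕ) (w w' : Fin q → P.LabelTable n) :
    ((PMF.uniformOfFintype (P.KeyTable n)).bind fun p =>
      (sampleAll fun t => P.mixPivot n p (w t) (w' t)).map fun piv =>
        ((fun j l => p j l false, piv) :
          (Fin N → Fin (P.inputLen n) → P.EncKey n) × (Fin q → P.Pivot n))) =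
    (sampleAll fun j => sampleAll fun l =>
      P.column n q (fun t => w t j l) (fun t => w' t j l)).map fun c =>
        (fun j l => (c j l).1, fun t j l => (c j l).2 t) := by
  have h1 : ∀ u u' : Fin q → Bits (P.labelLen n), P.column n q u u' =
      (PMF.uniformOfFintype (Bool → P.EncKey n)).bind fun s =>
        (sampleAll fun t => P.mixEntry n (s false) (u t) (s true) (u' t)).map
          fun c => (s false, c) := by
    intro u u'
    rw [uniform_bool_fun]
    simp only [column, PMF.bind_bind, PMF.bind_map, Function.comp_def]
    rfl
  simp only [h1, sampleAll_bind, sampleAll_map, sampleAll_uniform, PMF.map_bind, PMF.map_comp]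
  congr 1; funext p
  simp only [mixPivot]
  rw [sampleAll_comm]
  have h2 : ∀ j : Fin N, (sampleAll fun t => sampleAll fun l =>
      P.mixEntry n (p j l false) (w t j l) (p j l true) (w' t j l)) =
      (sampleAll fun l => sampleAll fun t =>
        P.mixEntry n (p j l false) (w t j l) (p j l true) (w' t j l)).map fun y t l => y l t :=
    fun j => sampleAll_comm _
  simp only [h2, sampleAll_map, PMF.map_comp]
  rfl

section

variable {J : Type} {size : J → ℕ} {q : J → ℕ}

/-- The key of the labels `w'` is used for nothing but their encryption. -/
theorem indist_column (hCPA : P.enc.IndCPA) (hq : PolyBounded size q)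
    (w w' w'' : ∀ i, Fin (q i) → Bits (P.labelLen (size i))) :
    Indist size (fun i => P.column (size i) (q i) (w i) (w' i))
      (fun i => P.column (size i) (q i) (w i) (w'' i)) := by
  -- The reduction gets the key `k`, its ciphertexts and the order of the pairs as advice.
  have h : ∀ (n q : ℕ) (w w' : Fin q → Bits (P.labelLen n)), P.column n q w w' =
      (PMF.uniformOfFintype (P.EncKey n)).bind fun k =>
        (sampleAll fun t => (P.enc.enc n k (w t)).bind fun c =>
          (PMF.uniformOfFintype Bool).map fun swap => (c, swap)).bind fun z =>
          ((PMF.uniformOfFintype (P.EncKey n)).bind fun k' =>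
            sampleAll fun t => P.enc.enc n k' (w' t)).map fun c' =>
              (k, fun t => if (z t).2 then (c' t, (z t).1) else ((z t).1, c' t)) := by
    intro n q w w'
    rw [column]
    congr 1; funext k
    simp only [PMF.map_bind]
    rw [PMF.bind_comm]
    congr 1; funext k'
    have h1 : ∀ t, P.mixEntry n k (w t) k' (w' t) = ((P.enc.enc n k (w t)).bind fun c =>
        (PMF.uniformOfFintype Bool).map fun swap => (c, swap)).bind fun z =>
          (P.enc.enc n k' (w' t)).map fun c' => if z.2 then (c', z.1) else (z.1, c') := by
      intro t
      simp only [mixEntry, PMF.bind_bind, PMF.bind_map, Function.comp_def]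
      congr 1; funext c
      exact PMF.bind_comm _ _ _
    simp only [h1]
    rw [sampleAll_bind, PMF.map_bind]
    congr 1; funext z
    rw [sampleAll_map, PMF.map_comp]
    rfl
  simp only [h]
  refine Indist.average _ (Indist.average _ ?_)
  refine Indist.map (SymEnc.indist P.enc hCPA (hq.comap fun p :
    (Σ p : (Σ i, P.EncKey (size i)), Fin (q p.1) → P.Cipher (size p.1) × Bool) => p.1.1)
    (fun p => w' p.1.1) (fun p => w'' p.1.1)) fun p => ?_
  refine (Wire.const _).prodMk (Wire.pi fun t => ?_)
  cases (p.2 t).2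
  · simp only [Bool.false_eq_true, if_false]; fun_prop
  · simp only [if_true]; fun_prop

/-- The labels encrypted under the keys at `true` may be replaced in all pivot tables, even in the
presence of the keys at `false`. -/
theorem indist_mixPivots (hCPA : P.enc.IndCPA) (hℓ : PolyBounded id P.inputLen)
    (hq : PolyBounded size q)
    (w w' w'' : ∀ i, Fin (q i) → P.LabelTable (size i)) :
    Indist size (α := fun i => (Fin N → Fin (P.inputLen (size i)) → P.EncKey (size i)) ×
        (Fin (q i) → P.Pivot (size i)))
      (fun i => (PMF.uniformOfFintype (P.KeyTable (size i))).bind fun p =>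
        (sampleAll fun t => P.mixPivot (size i) p (w i t) (w' i t)).map fun piv =>
          (fun j l => p j l false, piv))
      (fun i => (PMF.uniformOfFintype (P.KeyTable (size i))).bind fun p =>
        (sampleAll fun t => P.mixPivot (size i) p (w i t) (w'' i t)).map fun piv =>
          (fun j l => p j l false, piv)) := by
  simp only [mixPivots_eq_columns]
  refine Indist.map (α := fun i => Fin N → Fin (P.inputLen (size i)) →
    P.EncKey (size i) × (Fin (q i) → P.Cipher (size i) × P.Cipher (size i))) ?_
    fun i => by fun_prop
  refine Indist.sampleAll (q := fun _ => N) (α := fun i => Fin (P.inputLen (size i)) →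
    P.EncKey (size i) × (Fin (q i) → P.Cipher (size i) × P.Cipher (size i)))
    (PolyBounded.const N) ?_
  refine Indist.sampleAll (P := Σ _ : J, Fin N) (q := fun i => P.inputLen (size i.1))
    (hℓ.at_index PolyBounded.self) ?_
  exact P.indist_column hCPA (hq.comap fun i :
    (Σ i : (Σ _ : J, Fin N), Fin (P.inputLen (size i.1))) => i.1.1) _ _ _

end

/-! ### The execution in terms of the keys of the actual inputs -/

/-- The keys that `k` gives to the wires, the one of the actual input `x` at `false`. -/
noncomputable def inputKeys (n : ℕ) (k : Bits (P.nike.keyLen n)) (nonce : Fin N → P.Nonce n)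
    (x : Fin N → P.Input n) : P.KeyTable n :=
  fun j l c => P.bitKey n k (x j l ^^ c) l (nonce j)

/-- What the evaluator receives in the computations, in terms of the wire values of the actual
inputs. -/
theorem sampleAll_seccomp_bind {β : Type} (n q : ℕ) (k : Bits (P.nike.keyLen n))
    (nonce : Fin N → P.Nonce n) (X : Fin N → Fin (P.inputLen n) → P.EncKey n)
    (x : Fin N → P.Input n) (req : Fin q → P.Request n)
    (F : (Fin q → Bits (P.garbling.gcLen n) × P.Pivot n) → PMF β) :
    ((sampleAll fun t => P.seccomp n k nonce X (req t)).bind fun comp => F fun t => (comp t).1) =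
      (sampleAll fun t => P.garbling.Gb n (P.compile n (req t).1 (req t).2)).bind fun g =>
        (sampleAll fun t => P.mixPivot n (P.inputKeys n k nonce x)
          (fun j l => (g t).2.1 (j, l) (x j l)) (fun j l => (g t).2.1 (j, l) (!x j l))).bind
          fun piv => F fun t => ((g t).1, piv t) := by
  have h : ∀ e : Fin N × Fin (P.inputLen n) → Bool → Bits (P.labelLen n),
      (sampleAll fun j => sampleAll fun l =>
        P.pivotEntry n (fun c => P.bitKey n k c l (nonce j)) (e (j, l))) =
      P.mixPivot n (P.inputKeys n k nonce x) (fun j l => e (j, l) (x j l))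
        (fun j l => e (j, l) (!x j l)) := by
    intro e
    simp only [mixPivot, inputKeys, Bool.xor_false, Bool.xor_true]
    congr 1; funext j; congr 1; funext l
    exact P.pivotEntry_eq n _ _ (x j l)
  simp only [seccomp, h, sampleAll_bind, sampleAll_map, PMF.bind_bind, PMF.bind_map,
    Function.comp_def]

/-- An execution, without the results, when every user holds the key of the garbling node. -/
theorem execute_bind (hG : P.nG ∈ P.keyNodes) (hM : N + P.keyNodes.card ≤ M)
    (hK : P.nike.Correct) {β : Type} (n q : ℕ) (x : Fin N → P.Input n)
    (req : Fin q → P.Request n)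
    (F : P.Params n → (Fin (N + m) → P.Coins n) → P.EvaluatorView n q → PMF β) :
    ((P.execute n q x req).bind fun T => F T.params T.coins
      (fun j => (T.encoding j, T.nonce j), fun t => (req t, (T.comp t).1))) =
    (PMF.uniformOfFintype (Fin N → P.Nonce n)).bind fun nonce =>
      (sampleAll fun t => P.garbling.Gb n (P.compile n (req t).1 (req t).2)).bind fun g =>
      (P.nike.setup n).bind fun params =>
        (PMF.uniformOfFintype (Fin (N + m) → P.Coins n)).bind fun coins =>
          (P.mixView n q nonce req (fun t => (g t).1) (P.inputKeys n
            (P.nike.sharedKey n params coins P.group (P.node P.nG)) nonce x)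
            (fun t j l => (g t).2.1 (j, l) (x j l))
            (fun t j l => (g t).2.1 (j, l) (!x j l))).bind (F params coins) := by
  -- The key exchange is independent of the nonces and the garbling.
  have hcomm : ∀ {A B C D : Type} (a : PMF A) (b : PMF B) (c : PMF C) (d : PMF D)
      (F : A → B → C → D → PMF β),
      (a.bind fun u => b.bind fun v => c.bind fun w => d.bind fun z => F u v w z) =
      c.bind fun w => d.bind fun z => a.bind fun u => b.bind fun v => F u v w z := by
    intro A B C D a b c d F
    simp only [PMF.bind_comm b c, PMF.bind_comm a c, PMF.bind_comm b d, PMF.bind_comm a d]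
  rw [← hcomm]
  simp only [execute, PMF.bind_bind, PMF.bind_map, Function.comp_def]
  refine pmf_bind_congr _ fun params hparams => ?_
  simp only [P.sharedKey_party hG hM hK n hparams]
  congr 1; funext coins
  congr 1; funext nonce
  rw [P.sampleAll_seccomp_bind n q _ nonce _ x req fun comp => F params coins
    (fun j => (fun l => P.bitKey n (P.nike.sharedKey n params coins P.group (P.node P.nG))
      (x j l) l (nonce j), nonce j), fun t => (req t, comp t))]
  simp only [mixView, PMF.bind_map, Function.comp_def, inputKeys, Bool.xor_false]

end Setting

/-! ### Nonces -/

/-- Independent uniform nonces collide with negligible probability. -/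
theorem nonce_collision_le (N n : ℕ) :
    ((PMF.uniformOfFintype (Fin N → Bits n)).toOuterMeasure
      {ν | ¬ Function.Injective ν}).toReal ≤ (N * N : ℕ) * ((2 : ℝ) ^ n)⁻¹ := by
  have h1 : ∀ i j : Fin N, i ≠ j → (PMF.uniformOfFintype (Fin N → Bits n)).toOuterMeasure
      {ν | ν i = ν j} = ((2 : ENNReal) ^ n)⁻¹ := by
    intro i j hij
    have hpts : Function.Injective fun c : Bool => if c then j else i := by
      intro c c' h
      cases c <;> cases c' <;> simp_all
    have h2 := uniform_map_comp (B := Bits n) (fun c : Bool => if c then j else i) hpts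
    have h3 : {ν : Fin N → Bits n | ν i = ν j} =
        (fun f (c : Bool) => f (if c then j else i)) ⁻¹' {τ | τ false = τ true} := rfl
    rw [h3, ← PMF.toOuterMeasure_map_apply, h2, uniform_bool_fun,
      PMF.toOuterMeasure_bind_apply]
    have h4 : ∀ k : Bits n, ((PMF.uniformOfFintype (Bits n)).map fun k' (c : Bool) =>
        if c then k' else k).toOuterMeasure {τ | τ false = τ true} = ((2 : ENNReal) ^ n)⁻¹ := by
      intro k
      rw [PMF.toOuterMeasure_map_apply]
      have : ((fun k' (c : Bool) => if c then k' else k) ⁻¹' {τ : Bool → Bits n |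
          τ false = τ true}) = {k} := by
        ext k'; simp [eq_comm]
      rw [this, PMF.toOuterMeasure_apply_singleton]
      simp
    simp only [h4]
    rw [ENNReal.tsum_mul_right, PMF.tsum_coe, one_mul]
  have h5 : {ν : Fin N → Bits n | ¬ Function.Injective ν} ⊆
      ⋃ p : Fin N × Fin N, {ν | ν p.1 = ν p.2 ∧ p.1 ≠ p.2} := by
    intro ν hν
    simp only [Function.Injective, Set.mem_ofPred_eq, not_forall] at hν
    obtain ⟨i, j, h, hij⟩ := hν
    exact Set.mem_iUnion.2 ⟨(i, j), h, hij⟩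
  have h6 : (PMF.uniformOfFintype (Fin N → Bits n)).toOuterMeasure
      {ν | ¬ Function.Injective ν} ≤ ∑ _p : Fin N × Fin N, ((2 : ENNReal) ^ n)⁻¹ := by
    refine (MeasureTheory.OuterMeasure.mono _ h5).trans ?_
    refine (MeasureTheory.measure_iUnion_le (μ := (PMF.uniformOfFintype
      (Fin N → Bits n)).toOuterMeasure) _).trans ?_
    rw [tsum_fintype]
    refine Finset.sum_le_sum fun p _ => ?_
    by_cases hp : p.1 = p.2
    · simp [hp]
    · rw [← h1 p.1 p.2 hp]
      exact MeasureTheory.OuterMeasure.mono _ fun ν hν => hν.1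
  refine (ENNReal.toReal_mono ?_ h6).trans (le_of_eq ?_)
  · exact ENNReal.sum_ne_top.2 fun _ _ => ENNReal.inv_ne_top.2 (by positivity)
  · simp

namespace Setting

variable {M N m : ℕ} (P : Setting M N m)

/-! ### The view of the evaluator -/

/-- Enumeration of the wire values. -/
def wireEquiv (N ℓ : ℕ) : Fin N × Fin ℓ × Bool ≃ Fin (N * (ℓ * 2)) :=
  ((Equiv.refl _).prodCongr (((Equiv.refl _).prodCongr finTwoEquiv.symm).trans
    finProdFinEquiv)).trans finProdFinEquiv

/-- Key tables as lists of keys, in the order of `wireEquiv`. -/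
def keyTableEquiv (n : ℕ) :
    (Fin (N * (P.inputLen n * 2)) → P.EncKey n) ≃ P.KeyTable n where
  toFun τ j l c := τ (wireEquiv N (P.inputLen n) (j, l, c))
  invFun p t := p ((wireEquiv N (P.inputLen n)).symm t).1 ((wireEquiv N (P.inputLen n)).symm t).2.1
    ((wireEquiv N (P.inputLen n)).symm t).2.2
  left_inv τ := by funext t; simp
  right_inv p := by funext j l c; simp

/-- With distinct nonces, the keys of all wire values look independent and uniform to users outside
of the group. -/
theorem indist_inputKeys (hG : P.nG ∈ P.keyNodes) (hM : N + P.keyNodes.card ≤ M)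
    (hEff : P.IsEfficient) (hNike : P.nike.Secure) (hPRF : P.prf.Pseudorandom)
    {C : Finset (Fin (N + m))} (hC : Disjoint C P.group) {J : Type} {size : J → ℕ}
    (nonce : ∀ i, Fin N → P.Nonce (size i)) (hnonce : ∀ i, Function.Injective (nonce i))
    (x : ∀ i, Fin N → P.Input (size i)) :
    Indist size (α := fun i => P.KeyView C (size i) × P.KeyTable (size i))
      (fun i => (P.nike.setup (size i)).bind fun params =>
        (PMF.uniformOfFintype (Fin (N + m) → P.Coins (size i))).map fun coins =>
          (P.keyView C (size i) params coins, P.inputKeys (size i)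
            (P.nike.sharedKey (size i) params coins P.group (P.node P.nG)) (nonce i) (x i)))
      (fun i => (P.nike.setup (size i)).bind fun params =>
        (PMF.uniformOfFintype (Fin (N + m) → P.Coins (size i))).bind fun coins =>
          (PMF.uniformOfFintype (P.KeyTable (size i))).map fun p =>
            (P.keyView C (size i) params coins, p)) := by
  have hq : PolyBounded size fun i => N * (P.inputLen (size i) * 2) :=
    (PolyBounded.const N).mul ((hEff.1.at_index PolyBounded.self).mul (PolyBounded.const 2))
  let e := fun i => (wireEquiv N (P.inputLen (size i))).symm
  have h := P.indist_groupKey hG hM hEff hNike hPRF hC hq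
    (fun i t => P.prfBlock (size i) (x i (e i t).1 (e i t).2.1 ^^ (e i t).2.2) (e i t).2.1
      (nonce i (e i t).1)) (by
    intro i t t' htt
    obtain ⟨h1, h2, h3⟩ := P.prfBlock_injective _ htt
    have h4 := hnonce i h3
    apply (e i).injective
    refine Prod.ext h4 (Prod.ext h2 ?_)
    rw [h4, h2] at h1
    exact Bool.xor_right_inj.1 h1)
  refine (h.map (β := fun i => P.KeyView C (size i) × P.KeyTable (size i))
    (f := fun i z => (z.1, P.keyTableEquiv (size i) z.2)) fun i => ?_).congr
    (fun i => ?_) fun i => ?_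
  · simp only [keyTableEquiv, Equiv.coe_fn_mk]
    fun_prop
  · simp only [PMF.map_bind, PMF.map_comp]
    congr 1; funext params; congr 1; funext coins
    refine Prod.ext rfl ?_
    funext j l c
    simp [keyTableEquiv, e, inputKeys, bitKey]
  · rw [← uniform_map_equiv (P.keyTableEquiv (size i))]
    simp only [PMF.map_bind, PMF.map_comp]
    rfl

section

variable {Q : ℕ → ℕ} (x : ∀ n, Fin N → P.Input n) (req : ∀ n, Fin (Q n) → P.Request n)

/-- Independent uniform keys may replace those derived from the group key. -/
theorem indist_view_uniformKeys (hG : P.nG ∈ P.keyNodes) (hM : N + P.keyNodes.card ≤ M)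
    (hEff : P.IsEfficient) (hNike : P.nike.Secure) (hPRF : P.prf.Pseudorandom)
    {C : Finset (Fin (N + m))} (hC : Disjoint C P.group) (hQ : PolyBounded id Q) :
    Indist (fun n => n) (α := fun n => P.KeyView C n × P.EvaluatorView n (Q n))
      (fun n => (PMF.uniformOfFintype (Fin N → P.Nonce n)).bind fun nonce =>
        (sampleAll fun t => P.garbling.Gb n (P.compile n (req n t).1 (req n t).2)).bind fun g =>
        (P.nike.setup n).bind fun params =>
        (PMF.uniformOfFintype (Fin (N + m) → P.Coins n)).bind fun coins =>
          (P.mixView n (Q n) nonce (req n) (fun t => (g t).1) (P.inputKeys n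
            (P.nike.sharedKey n params coins P.group (P.node P.nG)) nonce (x n))
            (fun t j l => (g t).2.1 (j, l) (x n j l))
            (fun t j l => (g t).2.1 (j, l) (!x n j l))).map fun v =>
              (P.keyView C n params coins, v))
      (fun n => (PMF.uniformOfFintype (Fin N → P.Nonce n)).bind fun nonce =>
        (sampleAll fun t => P.garbling.Gb n (P.compile n (req n t).1 (req n t).2)).bind fun g =>
        (P.nike.setup n).bind fun params =>
        (PMF.uniformOfFintype (Fin (N + m) → P.Coins n)).bind fun coins =>
        (PMF.uniformOfFintype (P.KeyTable n)).bind fun p =>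
          (P.mixView n (Q n) nonce (req n) (fun t => (g t).1) p
            (fun t j l => (g t).2.1 (j, l) (x n j l))
            (fun t j l => (g t).2.1 (j, l) (!x n j l))).map fun v =>
              (P.keyView C n params coins, v)) := by
  -- Nonces and garblings become part of the index, the colliding nonces being a bad event.
  refine Indist.average_of_bad (fun n => PMF.uniformOfFintype (Fin N → P.Nonce n))
    (fun n => {ν | ¬ Function.Injective ν}) (Negligible.inv_two_pow.const_mul ((N * N : ℕ) : ℝ))
    (fun n => nonce_collision_le N n) ?_
  refine Indist.average (fun p : (Σ n, {ν : Fin N → P.Nonce n //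
      ν ∈ (PMF.uniformOfFintype (Fin N → P.Nonce n)).support ∧
        ν ∉ {ν : Fin N → P.Nonce n | ¬ Function.Injective ν}}) =>
    sampleAll fun t => P.garbling.Gb p.1 (P.compile p.1 (req p.1 t).1 (req p.1 t).2)) ?_
  have h := P.indist_inputKeys hG hM hEff hNike hPRF hC
    (size := fun p : (Σ p : (Σ n, {ν : Fin N → P.Nonce n //
      ν ∈ (PMF.uniformOfFintype (Fin N → P.Nonce n)).support ∧
        ν ∉ {ν : Fin N → P.Nonce n | ¬ Function.Injective ν}}),
      Fin (Q p.1) → Bits (P.garbling.gcLen p.1) ×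
        (Fin N × Fin (P.inputLen p.1) → Bool → Bits (P.labelLen p.1)) ×
        Bits (P.garbling.decLen p.1)) => p.1.1)
    (fun p => p.1.2.1) (fun p => not_not.1 p.1.2.2.2) (fun p => x p.1.1)
  refine Indist.congr (Indist.bind h
    (A := fun p z => (P.mixView p.1.1 (Q p.1.1) p.1.2.1 (req p.1.1) (fun t => (p.2 t).1) z.2
      (fun t j l => (p.2 t).2.1 (j, l) (x p.1.1 j l))
      (fun t j l => (p.2 t).2.1 (j, l) (!x p.1.1 j l))).map fun v => (z.1, v)) ?_)
    (fun p => ?_) fun p => ?_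
  · refine OracleEfficient.efficient (OracleEfficient.map
      (P.efficient_mixView hEff.1 hEff.2.2.2.2.1 PolyBounded.self (hQ.at_index PolyBounded.self)
      ?_ ?_ ?_ ?_ ?_ ?_) ?_)
    all_goals intro p; fun_prop
  · simp only [PMF.bind_bind, PMF.bind_map]
    rfl
  · simp only [PMF.bind_bind, PMF.bind_map]
    rfl

/-- The labels of the wire values other than the actual inputs may be replaced by zeros. -/
theorem indist_view_zeroLabels (hEff : P.IsEfficient) (hCPA : P.enc.IndCPA)
    (C : Finset (Fin (N + m))) (hQ : PolyBounded id Q) :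
    Indist (fun n => n) (α := fun n => P.KeyView C n × P.EvaluatorView n (Q n))
      (fun n => (PMF.uniformOfFintype (Fin N → P.Nonce n)).bind fun nonce =>
        (sampleAll fun t => P.garbling.Gb n (P.compile n (req n t).1 (req n t).2)).bind fun g =>
        (P.nike.setup n).bind fun params =>
        (PMF.uniformOfFintype (Fin (N + m) → P.Coins n)).bind fun coins =>
        (PMF.uniformOfFintype (P.KeyTable n)).bind fun p =>
          (P.mixView n (Q n) nonce (req n) (fun t => (g t).1) p
            (fun t j l => (g t).2.1 (j, l) (x n j l))
            (fun t j l => (g t).2.1 (j, l) (!x n j l))).map fun v =>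
              (P.keyView C n params coins, v))
      (fun n => (PMF.uniformOfFintype (Fin N → P.Nonce n)).bind fun nonce =>
        (sampleAll fun t => P.garbling.Gb n (P.compile n (req n t).1 (req n t).2)).bind fun g =>
        (P.nike.setup n).bind fun params =>
        (PMF.uniformOfFintype (Fin (N + m) → P.Coins n)).bind fun coins =>
        (PMF.uniformOfFintype (P.KeyTable n)).bind fun p =>
          (P.mixView n (Q n) nonce (req n) (fun t => (g t).1) p
            (fun t j l => (g t).2.1 (j, l) (x n j l)) (fun _ _ _ _ => false)).map fun v =>
              (P.keyView C n params coins, v)) := by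
  refine Indist.average _ (Indist.average _ (Indist.average _ (Indist.average _ ?_)))
  refine Indist.congr (Indist.map (P.indist_mixPivots hCPA hEff.1
    (hQ.at_index PolyBounded.self)
    (fun i t j l => (i.1.1.2 t).2.1 (j, l) (x i.1.1.1.1 j l))
    (fun i t j l => (i.1.1.2 t).2.1 (j, l) (!x i.1.1.1.1 j l)) (fun _ _ _ _ _ => false))
    (f := fun i z => (P.keyView C i.1.1.1.1 i.1.2 i.2, (fun j => (z.1 j, i.1.1.1.2 j),
      fun t => (req i.1.1.1.1 t, (i.1.1.2 t).1, z.2 t)))) fun i => by fun_prop)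
    (fun i => ?_) fun i => ?_
  · simp only [PMF.map_bind, PMF.map_comp, mixView]
    rfl
  · simp only [PMF.map_bind, PMF.map_comp, mixView]
    rfl

/-- Obliviousness with one bound for all functions and inputs. -/
theorem indist_garbled (Sim : ∀ n, Bits (P.garbling.funLen n) → PMF (Bits (P.garbling.gcLen n) ×
      (Fin N × Fin (P.inputLen n) → Bits (P.labelLen n))))
    (hSim : ∀ (f : ∀ n, Bits (P.garbling.funLen n))
      (y : ∀ n, Fin N × Fin (P.inputLen n) → Bool),
      CompIndist (α := fun n => Bits (P.garbling.gcLen n) ×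
          (Fin N × Fin (P.inputLen n) → Bits (P.labelLen n)))
        (fun n => (P.garbling.Gb n (f n)).map fun g => (g.1, En g.2.1 (y n)))
        (fun n => Sim n (f n)))
    {J : Type} {size : J → ℕ} (f : ∀ i, Bits (P.garbling.funLen (size i)))
    (y : ∀ i, Fin N × Fin (P.inputLen (size i)) → Bool) :
    Indist size (α := fun i => Bits (P.garbling.gcLen (size i)) ×
          (Fin N × Fin (P.inputLen (size i)) → Bits (P.labelLen (size i))))
      (fun i => (P.garbling.Gb (size i) (f i)).map fun g => (g.1, En g.2.1 (y i)))
      (fun i => Sim (size i) (f i)) := by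
  have h := Indist.of_forall_compIndist
    (J := fun n => Bits (P.garbling.funLen n) × (Fin N × Fin (P.inputLen n) → Bool))
    (α := fun n => Bits (P.garbling.gcLen n) ×
      (Fin N × Fin (P.inputLen n) → Bits (P.labelLen n)))
    (X := fun n j => (P.garbling.Gb n j.1).map fun g => (g.1, En g.2.1 j.2))
    (Y := fun n j => Sim n j.1) (P := J) (size := size)
  have h' := h fun j => hSim (fun n => (j n).1) fun n => (j n).2
  exact h' fun i => (f i, y i)

/-- The garblings of all computations may be simulated at once. -/
theorem indist_simulated (hEff : P.IsEfficient)
    (Sim : ∀ n, Bits (P.garbling.funLen n) → PMF (Bits (P.garbling.gcLen n) ×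
      (Fin N × Fin (P.inputLen n) → Bits (P.labelLen n))))
    (hSim : ∀ (f : ∀ n, Bits (P.garbling.funLen n))
      (y : ∀ n, Fin N × Fin (P.inputLen n) → Bool),
      CompIndist (α := fun n => Bits (P.garbling.gcLen n) ×
          (Fin N × Fin (P.inputLen n) → Bits (P.labelLen n)))
        (fun n => (P.garbling.Gb n (f n)).map fun g => (g.1, En g.2.1 (y n)))
        (fun n => Sim n (f n)))
    {C : Finset (Fin (N + m))} {J : Type} {size q : J → ℕ} (hq : PolyBounded size q)
    (kv : ∀ i, P.KeyView C (size i)) (nonce : ∀ i, Fin N → P.Nonce (size i))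
    (p : ∀ i, P.KeyTable (size i)) (req : ∀ i, Fin (q i) → P.Request (size i))
    (x : ∀ i, Fin N → P.Input (size i)) :
    Indist size (α := fun i => P.KeyView C (size i) × P.EvaluatorView (size i) (q i))
      (fun i => (sampleAll fun t => (P.garbling.Gb (size i)
          (P.compile (size i) (req i t).1 (req i t).2)).map fun g =>
            (g.1, En g.2.1 fun w => x i w.1 w.2)).bind fun g =>
          (P.mixView (size i) (q i) (nonce i) (req i) (fun t => (g t).1) (p i)
            (fun t j l => (g t).2 (j, l)) (fun _ _ _ _ => false)).map fun v => (kv i, v))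
      (fun i => (sampleAll fun t => Sim (size i)
          (P.compile (size i) (req i t).1 (req i t).2)).bind fun g =>
          (P.mixView (size i) (q i) (nonce i) (req i) (fun t => (g t).1) (p i)
            (fun t j l => (g t).2 (j, l)) (fun _ _ _ _ => false)).map fun v => (kv i, v)) := by
  refine Indist.bind (Indist.sampleAll hq ?_) (OracleEfficient.efficient ?_)
  · exact P.indist_garbled Sim hSim (size := fun i : (Σ i, Fin (q i)) => size i.1)
      (fun i => P.compile (size i.1) (req i.1 i.2).1 (req i.1 i.2).2)
      (fun i w => x i.1 w.1 w.2)
  · refine OracleEfficient.map (P.efficient_mixView hEff.1 hEff.2.2.2.2.1 PolyBounded.self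
      hq ?_ ?_ ?_ ?_ ?_ ?_) ?_
    all_goals intro i; fun_prop

/-- Garbled circuits and garbled inputs may be simulated without the inputs. -/
theorem indist_view_oblivious (hEff : P.IsEfficient)
    (Sim : ∀ n, Bits (P.garbling.funLen n) → PMF (Bits (P.garbling.gcLen n) ×
      (Fin N × Fin (P.inputLen n) → Bits (P.labelLen n))))
    (hSim : ∀ (f : ∀ n, Bits (P.garbling.funLen n))
      (y : ∀ n, Fin N × Fin (P.inputLen n) → Bool),
      CompIndist (α := fun n => Bits (P.garbling.gcLen n) ×
          (Fin N × Fin (P.inputLen n) → Bits (P.labelLen n)))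
        (fun n => (P.garbling.Gb n (f n)).map fun g => (g.1, En g.2.1 (y n)))
        (fun n => Sim n (f n)))
    (C : Finset (Fin (N + m))) (hQ : PolyBounded id Q) :
    Indist (fun n => n) (α := fun n => P.KeyView C n × P.EvaluatorView n (Q n))
      (fun n => (PMF.uniformOfFintype (Fin N → P.Nonce n)).bind fun nonce =>
        (sampleAll fun t => P.garbling.Gb n (P.compile n (req n t).1 (req n t).2)).bind fun g =>
        (P.nike.setup n).bind fun params =>
        (PMF.uniformOfFintype (Fin (N + m) → P.Coins n)).bind fun coins =>
        (PMF.uniformOfFintype (P.KeyTable n)).bind fun p =>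
          (P.mixView n (Q n) nonce (req n) (fun t => (g t).1) p
            (fun t j l => (g t).2.1 (j, l) (x n j l)) (fun _ _ _ _ => false)).map fun v =>
              (P.keyView C n params coins, v))
      (fun n => (P.nike.setup n).bind fun params =>
        (PMF.uniformOfFintype (Fin (N + m) → P.Coins n)).bind fun coins =>
        (PMF.uniformOfFintype (Fin N → P.Nonce n)).bind fun nonce =>
        (PMF.uniformOfFintype (P.KeyTable n)).bind fun p =>
        (sampleAll fun t => Sim n (P.compile n (req n t).1 (req n t).2)).bind fun g =>
          (P.mixView n (Q n) nonce (req n) (fun t => (g t).1) p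
            (fun t j l => (g t).2 (j, l)) (fun _ _ _ _ => false)).map fun v =>
              (P.keyView C n params coins, v)) := by
  have h1 : Indist (fun n => n) (α := fun n => P.KeyView C n × P.EvaluatorView n (Q n))
      (fun n => (P.nike.setup n).bind fun params =>
        (PMF.uniformOfFintype (Fin (N + m) → P.Coins n)).bind fun coins =>
        (PMF.uniformOfFintype (Fin N → P.Nonce n)).bind fun nonce =>
        (PMF.uniformOfFintype (P.KeyTable n)).bind fun p =>
        (sampleAll fun t => (P.garbling.Gb n (P.compile n (req n t).1 (req n t).2)).map fun g =>
          (g.1, En g.2.1 fun w => x n w.1 w.2)).bind fun g =>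
          (P.mixView n (Q n) nonce (req n) (fun t => (g t).1) p
            (fun t j l => (g t).2 (j, l)) (fun _ _ _ _ => false)).map fun v =>
              (P.keyView C n params coins, v))
      (fun n => (P.nike.setup n).bind fun params =>
        (PMF.uniformOfFintype (Fin (N + m) → P.Coins n)).bind fun coins =>
        (PMF.uniformOfFintype (Fin N → P.Nonce n)).bind fun nonce =>
        (PMF.uniformOfFintype (P.KeyTable n)).bind fun p =>
        (sampleAll fun t => Sim n (P.compile n (req n t).1 (req n t).2)).bind fun g =>
          (P.mixView n (Q n) nonce (req n) (fun t => (g t).1) p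
            (fun t j l => (g t).2 (j, l)) (fun _ _ _ _ => false)).map fun v =>
              (P.keyView C n params coins, v)) := by
    refine Indist.average _ (Indist.average _ (Indist.average _ (Indist.average _ ?_)))
    exact P.indist_simulated hEff Sim hSim
      (J := Σ i : (Σ i : (Σ i : (Σ n, P.Params n), Fin (N + m) → P.Coins i.1),
        Fin N → P.Nonce i.1.1), P.KeyTable i.1.1.1)
      (size := fun i => i.1.1.1.1) (q := fun i => Q i.1.1.1.1)
      (hQ.at_index PolyBounded.self)
      (fun i => P.keyView C i.1.1.1.1 i.1.1.1.2 i.1.1.2) (fun i => i.1.2) (fun i => i.2)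
      (fun i => req i.1.1.1.1) (fun i => x i.1.1.1.1)
  refine h1.congr (fun n => ?_) fun n => rfl
  -- The garbling is sampled independently, and at the end only its labels of `x` are used.
  have hcomm : ∀ {A B C D E F : Type} (a : PMF A) (b : PMF B) (c : PMF C) (d : PMF D)
      (e : PMF E) (H : A → B → C → D → E → PMF F),
      (a.bind fun u => b.bind fun v => c.bind fun w => d.bind fun z => e.bind fun s =>
        H u v w z s) =
      c.bind fun w => d.bind fun z => a.bind fun u => e.bind fun s => b.bind fun v =>
        H u v w z s := by
    intro A B C D E F a b c d e H
    simp only [PMF.bind_comm b c, PMF.bind_comm a c, PMF.bind_comm b d, PMF.bind_comm a d,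
      PMF.bind_comm b e]
  rw [hcomm]
  simp only [sampleAll_map, PMF.bind_map]
  rfl

end

/-! ### Correctness of the results -/

/-- The results of an execution may be replaced by those of the ideal functionality, statistically
and in the presence of the whole transcript. -/
theorem indist_idealResult (hG : P.nG ∈ P.keyNodes) (hM : N + P.keyNodes.card ≤ M)
    (hEff : P.IsEfficient) (hCompile : P.CompileCorrect) (hK : P.nike.Correct)
    (hNike : P.nike.Secure) (hPRF : P.prf.Pseudorandom) (hEnc : P.enc.Correct)
    (hRej : P.enc.RejectsWrongKey) (hGarb : P.garbling.Correct)
    {Q : ℕ → ℕ} (hQ : PolyBounded id Q) (x : ∀ n, Fin N → P.Input n)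
    (req : ∀ n, Fin (Q n) → P.Request n) {α : ℕ → Type} [∀ n, BitRep (α n)]
    (G : ∀ n, P.Transcript n (Q n) → (Fin (Q n) → P.Output n) → α n) :
    Indist (fun n => n)
      (fun n => (P.execute n (Q n) (x n) (req n)).map fun T => G n T fun t => (T.comp t).2)
      (fun n => (P.execute n (Q n) (x n) (req n)).map fun T =>
        G n T (P.idealResult n (Q n) (x n) (req n))) := by
  obtain ⟨δ, hδ, hb⟩ := P.exists_execute_bound hG hM hEff hCompile hK hNike hPRF hEnc hRej hGarb
    hQ x req
  refine Indist.of_bad (fun n => P.execute n (Q n) (x n) (req n)) (fun n =>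
    {T | (fun t => (T.comp t).2) ≠ P.idealResult n (Q n) (x n) (req n)}) hδ hb
    (X := fun n T => PMF.pure (G n T fun t => (T.comp t).2))
    (Y := fun n T => PMF.pure (G n T (P.idealResult n (Q n) (x n) (req n)))) fun n T hT => ?_
  rw [Set.mem_ofPred_eq, not_not] at hT
  simp only [hT]

/-- The key exchange and the nonces do not depend on the inputs and requests. -/
theorem execute_map (n q : ℕ) (x : Fin N → P.Input n) (req : Fin q → P.Request n) {β : Type}
    (F : P.Params n → (Fin (N + m) → P.Coins n) → (Fin N → P.Nonce n) → β) :
    ((P.execute n q x req).map fun T => F T.params T.coins T.nonce) =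
      (P.nike.setup n).bind fun params =>
        (PMF.uniformOfFintype (Fin (N + m) → P.Coins n)).bind fun coins =>
          (PMF.uniformOfFintype (Fin N → P.Nonce n)).map (F params coins) := by
  simp only [execute, PMF.map_bind, PMF.map_comp, Function.comp_def]
  congr 1; funext params
  congr 1; funext coins
  rw [← PMF.bind_pure_comp]
  congr 1; funext nonce
  exact PMF.map_const _ _

/-! ### Corrupted parties -/

/-- Besides the key exchange and the results, the parties see nothing but their own nonces. -/
theorem secureAgainstParties (hG : P.nG ∈ P.keyNodes) (hM : N + P.keyNodes.card ≤ M)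
    (hEff : P.IsEfficient) (hCompile : P.CompileCorrect) (hK : P.nike.Correct)
    (hNike : P.nike.Secure) (hPRF : P.prf.Pseudorandom) (hEnc : P.enc.Correct)
    (hRej : P.enc.RejectsWrongKey) (hGarb : P.garbling.Correct) (I : Finset (Fin N)) :
    P.SecureAgainstParties I := by
  refine ⟨fun i z => (PMF.uniformOfFintype (Fin N → P.Nonce i.1)).map fun ν =>
    (z.1, fun j => (z.2.1 j, ν j), z.2.2), ?_, fun Q hQ x req => ?_⟩
  · refine OracleEfficient.efficient ?_
    refine OracleEfficient.map (β := fun i : ℕ × ℕ => Fin N → P.Nonce i.1)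
      (f := fun (i : ℕ × ℕ) (z : P.PartyIdeal I i.1 i.2) (ν : Fin N → P.Nonce i.1) =>
        ((z.1, fun j => (z.2.1 j, ν j), z.2.2) : P.PartyView I i.1 i.2)) ?_ fun i => ?_
    · exact OracleEfficient.uniform_pi (PolyBounded.const N)
        (OracleEfficient.uniform_bits (PolyBounded.self.mono fun i => Nat.le_add_right _ _))
    · fun_prop
  · refine Indist.compIndist ?_
    refine (P.indist_idealResult hG hM hEff hCompile hK hNike hPRF hEnc hRej hGarb hQ x req
      (α := fun n => P.PartyView I n (Q n) × P.Outputs n (Q n))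
      fun n T y => ((P.keyView (I.image P.party) n T.params T.coins,
        (fun i => (x n i, T.nonce i)), P.ownResults I (req n) y),
          (T.params, P.nike.pk n T.params T.coins), y)).congr (fun n => rfl) fun n => ?_
    refine Eq.trans ?_ (P.execute_map n (Q n) (x n) (req n) fun params coins nonce =>
      (((P.keyView (I.image P.party) n params coins, (fun i => (x n i, nonce i)),
        P.ownResults I (req n) (P.idealResult n (Q n) (x n) (req n))),
          (params, P.nike.pk n params coins), P.idealResult n (Q n) (x n) (req n)) :
            P.PartyView I n (Q n) × P.Outputs n (Q n))).symm
    simp only [PMF.map_comp]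
    rfl

/-! ### Corrupted nodes -/

/-- Nodes other than the evaluator see nothing but the key exchange. -/
theorem secureAgainstNodes_of_not_mem (hG : P.nG ∈ P.keyNodes) (hM : N + P.keyNodes.card ≤ M)
    (hEff : P.IsEfficient) (hCompile : P.CompileCorrect) (hK : P.nike.Correct)
    (hNike : P.nike.Secure) (hPRF : P.prf.Pseudorandom) (hEnc : P.enc.Correct)
    (hRej : P.enc.RejectsWrongKey) (hGarb : P.garbling.Correct) {C : Finset (Fin m)}
    (hC : P.nE ∉ C) : P.SecureAgainstNodes C := by
  have hempty : IsEmpty {j : Fin m // j ∈ C ∧ j = P.nE} := ⟨fun j => hC (j.2.2 ▸ j.2.1)⟩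
  refine ⟨fun i z => PMF.pure (z.1, hempty.elim), ?_, fun Q hQ x req => ?_⟩
  · refine OracleEfficient.efficient (OracleEfficient.pure fun i => ?_)
    fun_prop
  · refine Indist.compIndist ?_
    refine (P.indist_idealResult hG hM hEff hCompile hK hNike hPRF hEnc hRej hGarb hQ x req
      (α := fun n => P.NodeView C n (Q n) × P.Outputs n (Q n))
      fun n T y => ((P.keyView (C.image P.node) n T.params T.coins, hempty.elim),
          (T.params, P.nike.pk n T.params T.coins), y)).congr (fun n => ?_) fun n => ?_
    · congr 1; funext T
      exact Prod.ext (Prod.ext rfl (Subsingleton.elim _ _)) rfl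
    · rw [P.execute_map n (Q n) (x n) (req n) fun params coins _ =>
        (((P.keyView (C.image P.node) n params coins, hempty.elim),
          (params, P.nike.pk n params coins), P.idealResult n (Q n) (x n) (req n)) :
            P.NodeView C n (Q n) × P.Outputs n (Q n))]
      simp only [PMF.pure_map]
      congr 1; funext params
      congr 1; funext coins
      exact (PMF.map_const _ _).symm

/-- The simulated view of the evaluator: uniform encodings and nonces, simulated garbled circuits
with simulated labels, and pivot tables whose other entries encrypt zeros. -/
noncomputable def simView (Sim : ∀ n, Bits (P.garbling.funLen n) →
      PMF (Bits (P.garbling.gcLen n) × (Fin N × Fin (P.inputLen n) → Bits (P.labelLen n))))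
    (n q : ℕ) (req : Fin q → P.Request n) : PMF (P.EvaluatorView n q) :=
  (PMF.uniformOfFintype (Fin N → P.Nonce n)).bind fun nonce =>
    (PMF.uniformOfFintype (P.KeyTable n)).bind fun p =>
      (sampleAll fun t => Sim n (P.compile n (req t).1 (req t).2)).bind fun g =>
        P.mixView n q nonce req (fun t => (g t).1) p (fun t j l => (g t).2 (j, l))
          (fun _ _ _ _ => false)

section Efficiency

variable {J : Type} {size g : J → ℕ} {a b α : J → Type} [∀ i, BitRep (α i)]

theorem efficient_uniform_keyTable (hℓ : PolyBounded id P.inputLen)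
    (hk : PolyBounded id P.encKeyLen) (hg : PolyBounded size g) :
    OracleEfficient size (a := a) (b := b) (α := α)
      fun i _ _ => PMF.uniformOfFintype (P.KeyTable (g i)) := by
  have h := OracleEfficient.uniform_pair (a := a) (b := b) (α := α) (hk.at_index hg)
  have h' := OracleEfficient.uniform_pi (hℓ.at_index hg) h
  exact OracleEfficient.uniform_pi (PolyBounded.const N) h'

theorem efficient_simulated (hEff : P.IsEfficient) {Sim : ∀ n, Bits (P.garbling.funLen n) →
      PMF (Bits (P.garbling.gcLen n) × (Fin N × Fin (P.inputLen n) → Bits (P.labelLen n)))}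
    (hSim : Efficient id Sim) (hg : PolyBounded size g)
    {req : ∀ i, α i → P.Request (g i)} (hreq : ∀ i, Wire (req i)) :
    OracleEfficient size (a := a) (b := b) (α := α)
      (β := fun i => Bits (P.garbling.gcLen (g i)) ×
        (Fin N × Fin (P.inputLen (g i)) → Bits (P.labelLen (g i))))
      fun i _ z => Sim (g i) (P.compile (g i) (req i z).1 (req i z).2) := by
  have hc := (hEff.2.2.2.2.2.2.comap g hg).oracleEfficient (a := a) (b := b)
  have hs := (hSim.comap g hg).oracleEfficient (a := a) (b := b)
  have h := OracleEfficient.bind (B := fun i _ _ f => Sim (g i) f) hc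
    (hs.precomp (α := fun i => P.Request (g i) × Bits (P.garbling.funLen (g i)))
      (f := fun i z => z.2) fun i => Wire.snd)
  simp only [PMF.pure_bind] at h
  exact h.precomp hreq

theorem efficient_simView (hEff : P.IsEfficient) {Sim : ∀ n, Bits (P.garbling.funLen n) →
      PMF (Bits (P.garbling.gcLen n) × (Fin N × Fin (P.inputLen n) → Bits (P.labelLen n)))}
    (hSim : Efficient id Sim) (hg : PolyBounded size g) {q : J → ℕ} (hq : PolyBounded size q) :
    OracleEfficient size (a := a) (b := b) (α := fun i => Fin (q i) → P.Request (g i))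
      (β := fun i => P.EvaluatorView (g i) (q i)) fun i _ req => P.simView Sim (g i) (q i) req := by
  refine OracleEfficient.bind (β := fun i => Fin N → P.Nonce (g i))
    (B := fun i _ (req : Fin (q i) → P.Request (g i)) nonce =>
      (PMF.uniformOfFintype (P.KeyTable (g i))).bind fun p =>
      (sampleAll fun t => Sim (g i) (P.compile (g i) (req t).1 (req t).2)).bind fun gl =>
        P.mixView (g i) (q i) nonce req (fun t => (gl t).1) p (fun t j l => (gl t).2 (j, l))
          (fun _ _ _ _ => false)) ?_ ?_
  · exact OracleEfficient.uniform_pi (PolyBounded.const N) (OracleEfficient.uniform_bits hg)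
  refine OracleEfficient.bind (β := fun i => P.KeyTable (g i))
    (B := fun i _ (z : (Fin (q i) → P.Request (g i)) × (Fin N → P.Nonce (g i))) p =>
      (sampleAll fun t => Sim (g i) (P.compile (g i) (z.1 t).1 (z.1 t).2)).bind fun gl =>
        P.mixView (g i) (q i) z.2 z.1 (fun t => (gl t).1) p (fun t j l => (gl t).2 (j, l))
          (fun _ _ _ _ => false)) ?_ ?_
  · exact P.efficient_uniform_keyTable hEff.1 hEff.2.2.2.2.1.1 hg
  refine OracleEfficient.bind (β := fun i => Fin (q i) → Bits (P.garbling.gcLen (g i)) ×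
      (Fin N × Fin (P.inputLen (g i)) → Bits (P.labelLen (g i))))
    (B := fun i _ (z : ((Fin (q i) → P.Request (g i)) × (Fin N → P.Nonce (g i))) ×
        P.KeyTable (g i)) gl =>
        P.mixView (g i) (q i) z.1.2 z.1.1 (fun t => (gl t).1) z.2 (fun t j l => (gl t).2 (j, l))
          (fun _ _ _ _ => false)) ?_ ?_
  · refine OracleEfficient.sampleAll hq (A := fun i t _ (z : ((Fin (q i) → P.Request (g i)) ×
      (Fin N → P.Nonce (g i))) × P.KeyTable (g i)) =>
        Sim (g i) (P.compile (g i) (z.1.1 t).1 (z.1.1 t).2)) ?_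
    refine P.efficient_simulated (J := Σ i, Fin (q i)) (g := fun i => g i.1)
      (α := fun i => ((Fin (q i.1) → P.Request (g i.1)) × (Fin N → P.Nonce (g i.1))) ×
        P.KeyTable (g i.1)) hEff hSim (hg.comap _) (req := fun i z => z.1.1 i.2) fun i => ?_
    fun_prop
  · refine P.efficient_mixView hEff.1 hEff.2.2.2.2.1 hg hq ?_ ?_ ?_ ?_ ?_ ?_
    all_goals intro p; fun_prop

end Efficiency

theorem secureAgainstNodes_of_mem (hG : P.nG ∈ P.keyNodes) (hM : N + P.keyNodes.card ≤ M)
    (hEff : P.IsEfficient) (hCompile : P.CompileCorrect) (hK : P.nike.Correct)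
    (hNike : P.nike.Secure) (hPRF : P.prf.Pseudorandom) (hEnc : P.enc.Correct)
    (hCPA : P.enc.IndCPA) (hRej : P.enc.RejectsWrongKey) (hGarb : P.garbling.Correct)
    (hObl : P.garbling.Oblivious) {C : Finset (Fin m)} (hC : Disjoint C P.keyNodes)
    (hE : P.nE ∈ C) : P.SecureAgainstNodes C := by
  obtain ⟨Sim, hSim, hSim'⟩ := hObl
  refine ⟨fun i z => (P.simView Sim i.1 i.2 (z.2 ⟨P.nE, hE, rfl⟩).2).map fun v =>
    (z.1, fun _ => v), ?_, fun Q hQ x req => ?_⟩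
  · refine OracleEfficient.efficient ?_
    refine OracleEfficient.map (β := fun i : ℕ × ℕ => P.EvaluatorView i.1 i.2)
      (f := fun (i : ℕ × ℕ) (z : P.NodeIdeal C i.1 i.2) (v : P.EvaluatorView i.1 i.2) =>
        ((z.1, fun _ => v) : P.NodeView C i.1 i.2)) ?_ fun i => ?_
    · have h := P.efficient_simView (size := fun i : ℕ × ℕ => i.1 + i.2) (g := fun i => i.1)
        (q := fun i => i.2) (a := fun _ => Empty) (b := fun _ => Empty) hEff hSim
        (PolyBounded.self.mono fun i => Nat.le_add_right _ _)
        (PolyBounded.self.mono fun i => Nat.le_add_left _ _)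
      refine h.precomp (f := fun (i : ℕ × ℕ) (z : P.NodeIdeal C i.1 i.2) =>
        (z.2 ⟨P.nE, hE, rfl⟩).2) fun i => ?_
      fun_prop
    · fun_prop
  · refine Indist.compIndist ?_
    have hD := P.disjoint_nodes_group hC
    have h1 := P.indist_idealResult hG hM hEff hCompile hK hNike hPRF hEnc hRej hGarb hQ x req
      (α := fun n => P.NodeView C n (Q n) × P.Outputs n (Q n))
      fun n T y => ((P.keyView (C.image P.node) n T.params T.coins,
        fun _ => (fun j => (T.encoding j, T.nonce j), fun t => (req n t, (T.comp t).1))),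
          (T.params, P.nike.pk n T.params T.coins), y)
    have h2 := (((P.indist_view_uniformKeys x req hG hM hEff hNike hPRF hD hQ).trans
      (P.indist_view_zeroLabels x req hEff hCPA (C.image P.node) hQ)).trans
      (P.indist_view_oblivious x req hEff Sim (fun f y => hSim' f y) (C.image P.node) hQ)).map
      (β := fun n => P.NodeView C n (Q n) × P.Outputs n (Q n))
      (f := fun n z => ((z.1, fun _ => z.2), (z.1.1, z.1.2.1),
        P.idealResult n (Q n) (x n) (req n))) fun n => by fun_prop
    refine (h1.congr (fun n => rfl) fun n => ?_).trans (h2.congr (fun n => rfl) fun n => ?_)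
    · refine Eq.trans ?_ ((P.execute_bind hG hM hK n (Q n) (x n) (req n) fun params coins v =>
        PMF.pure (((P.keyView (C.image P.node) n params coins, fun _ => v),
          (params, P.nike.pk n params coins), P.idealResult n (Q n) (x n) (req n)) :
            P.NodeView C n (Q n) × P.Outputs n (Q n))).symm.trans (PMF.bind_pure_comp _ _))
      simp only [PMF.map_bind, PMF.map_comp]
      rfl
    · simp only [simView, PMF.map_bind, PMF.map_comp]
      rfl

end Setting
end Outsourcing

theorem mainTheorem1 (M N m : ℕ) (P : Outsourcing.Setting M N m)
    (hG : P.nG ∈ P.keyNodes) (hE : P.nE ∉ P.keyNodes) (hM : N + P.keyNodes.card ≤ M)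
    (hEff : P.IsEfficient) (hCompile : P.CompileCorrect)
    (hNikeCorrect : P.nike.Correct) (hNike : P.nike.Secure)
    (hPRF : P.prf.Pseudorandom)
    (hEncCorrect : P.enc.Correct) (hEncCPA : P.enc.IndCPA) (hEncKey : P.enc.RejectsWrongKey)
    (hGarbCorrect : P.garbling.Correct) (hGarbPrivate : P.garbling.Private)
    (hGarbOblivious : P.garbling.Oblivious) :
    P.SecurelyRealises := by
  refine ⟨fun I => P.secureAgainstParties hG hM hEff hCompile hNikeCorrect hNike hPRF hEncCorrect
    hEncKey hGarbCorrect I, fun C hC => ?_⟩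
  by_cases h : P.nE ∈ C
  · exact P.secureAgainstNodes_of_mem hG hM hEff hCompile hNikeCorrect hNike hPRF hEncCorrect
      hEncCPA hEncKey hGarbCorrect hGarbOblivious hC h
  · exact P.secureAgainstNodes_of_not_mem hG hM hEff hCompile hNikeCorrect hNike hPRF hEncCorrect
      hEncKey hGarbCorrect h
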